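/- Let $K$ be a field of characteristic $0$. A \emph{differential superalgebra} is a supercommutative $K$-superalgebra $A$ with an odd superderivation $\mathcal D$; put $\partial_x=\mathcal D^2$. Super pseudodifferential operators over $A$ are formal series $\sum_{k\le N}a_k\mathcal D^k$, $a_k\in A$, multiplied by the super Leibniz rule; $P_+$ is the part with $k\ge 0$, $\mathrm{sres}\,P=a_{-1}$, and $[\cdot,\cdot]$ is the supercommutator. For odd $\phi\in A$ let $K\{\phi\}$ be the subalgebra of differential polynomials, generated by all $\mathcal D^k\phi$; for $h\in A$ let $\int h\,dx\,d\theta$ be the class of $h$ modulo $\mathcal D(K\{\phi\})$. It is called fermionic if it is represented by an even element of $K\{\phi\}$. Let $$L=(\mathcal D^3+\phi)(\mathcal D^3+\phi).$$ (1) There is a unique odd operator $\Lambda=\mathcal D+O(1)$ with $\Lambda^3=\mathcal D^3+\phi$; it satisfies $\Lambda^6=L$, and $\Lambda^2$ is the unique cube root of $L$ of the form $\partial_x+O(\mathcal D)$. Put $L^{n/6}=\Lambda^n$ for $n\ge0$. All coefficients of $L^{n/6}$ lie in $K\{\phi\}$ (so $\mathrm{sres}\,L^{n/6}$ is local), and $\int\mathrm{sres}\,L^{n/6}\,dx\,d\theta$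 is fermionic. (2) Let $\partial_t$ be an even $K$-linear derivation of $A$ commuting with $\mathcal D$ such that $\phi$ satisfies the supersymmetric Sawada--Kotera equation $$\phi_t+\phi_{xxxxx}+5\phi_{xxx}(\mathcal D\phi)+5\phi_{xx}(\mathcal D\phi_x)+5\phi_x(\mathcal D\phi)^2=0 .$$ Then for every $n\ge 0$ $$\partial_tL^{n/6}=[9(L^{5/3})_+,L^{n/6}],\qquad \int\partial_t\,\mathrm{sres}\,L^{n/6}\,dx\,d\theta=0,$$ so $\int \mathrm{sres}\,L^{n/6}\,dx\,d\theta$ is conserved. (3) One has $$\int\mathrm{sres}\,L^{7/6}\,dx\,d\theta=-\tfrac19\int[2(\mathcal D\phi_{xx})+(\mathcal D\phi)^2-6\phi_x\phi]\,dx\,d\theta,$$ $$\int\mathrm{sres}\,L^{11/6}\,dx\,d\theta=-\tfrac1{81}\int[6(\mathcal D\phi_{xxxx})+18(\mathcal D\phi_{xx})(\mathcal D\phi)+9(\mathcal D\phi_x)^2+4(\mathcal D\phi)^3-18\phi_{xxx}\phi+6\phi_{xx}\phi_x-36\phi_x\phi(\mathcal D\phi)]\,dx\,d\theta.$$ (4)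 Let $A$ be the free supercommutative algebra on $\phi,\mathcal D\phi,\mathcal D^2\phi,\dots$ with $\phi$ odd. There the flow $\partial_t$ of (2) exists and is unique; among $0\le n\le 11$ exactly $n=7$ and $n=11$ give $\int\mathrm{sres}\,L^{n/6}\,dx\,d\theta\ne0$; infinitely many $n$ give a nonzero functional, and these nonzero functionals are linearly independent over $K$. -/

import Mathlib

noncomputable section

namespace SSK

/-! ### Supercommutative algebras with an odd superderivation -/

/-- A supercommutative `K`-superalgebra `A` with an odd superderivation `superD`
(the abstract form of `𝒟 = ∂_θ + θ ∂_x`).  The `ℤ/2`-grading is recorded by the parity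
automorphism `f ↦ (-1)^{|f|} f`; over a field of characteristic zero this is the same as a
decomposition into even and odd parts. -/
class SuperDifferentialAlgebra (K A : Type*) [Field K] [Ring A] [Algebra K A] where
  parityHom : A →ₐ[K] A
  superD : A →ₗ[K] A
  parity_parity : ∀ f : A, parityHom (parityHom f) = f
  even_comm : ∀ f g : A, parityHom f = f → f * g = g * f
  odd_anticomm : ∀ f g : A, parityHom f = -f → parityHom g = -g → f * g = -(g * f)
  superD_parity : ∀ f : A, superD (parityHom f) = -parityHom (superD f)
  superD_mul : ∀ f g : A, superD (f * g) = superD f * g + parityHom f * superD g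

section Basic

variable (K : Type*) {A : Type*} [Field K] [Ring A] [Algebra K A] [SuperDifferentialAlgebra K A]

/-- The parity automorphism `f ↦ (-1)^{|f|} f`. -/
abbrev parity : A →ₐ[K] A := SuperDifferentialAlgebra.parityHom

/-- The super derivative `𝒟`. -/
abbrev D : A →ₗ[K] A := SuperDifferentialAlgebra.superD

/-- The derivative `∂_x = 𝒟²`. -/
def dx : A →ₗ[K] A := D K ∘ₗ D K

/-- `f` is even (bosonic). -/
def IsEven (f : A) : Prop := parity K f = f

/-- `f` is odd (fermionic). -/
def IsOdd (f : A) : Prop := parity K f = -f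

/-- The algebra of differential polynomials in `φ`: the subalgebra generated by all `𝒟^k φ`. -/
def diffPoly (φ : A) : Subalgebra K A :=
  Algebra.adjoin K (Set.range fun k : ℕ => (⇑(D K : A →ₗ[K] A))^[k] φ)

/-- The densities `𝒟 J` with `J` a differential polynomial in `φ`; their superspace integral
`∫ 𝒟 J dx dθ` vanishes. -/
def exactDensities (φ : A) : Submodule K A :=
  (Subalgebra.toSubmodule (diffPoly K φ)).map (D K)

/-- The superspace integral `h ↦ ∫ h dx dθ` of the formal variational calculus: the class of the
density `h` modulo super derivatives of differential polynomials in `φ`. -/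
def superIntegral (φ : A) : A →ₗ[K] A ⧸ exactDensities K φ :=
  (exactDensities K φ).mkQ

/-- A functional is fermionic if it is the integral of an even differential polynomial
(the measure `dx dθ` is odd). -/
def IsFermionicFunctional (φ : A) (F : A ⧸ exactDensities K φ) : Prop :=
  ∃ h ∈ diffPoly K φ, IsEven K h ∧ superIntegral K φ h = F

end Basic

/-! ### Super pseudodifferential operators -/

/-- The formal series `∑_{k ≤ N} a_k 𝒟^k`, written with coefficients on the left and recorded by
the family of coefficients `k ↦ a_k`. -/
def SPDO (K A : Type*) [Field K] [Ring A] [Algebra K A] : Submodule K (ℤ → A) where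
  carrier := {P | ∃ N : ℤ, ∀ k > N, P k = 0}
  zero_mem' := ⟨0, fun _ _ => rfl⟩
  add_mem' := by
    rintro P Q ⟨N, hN⟩ ⟨M, hM⟩
    refine ⟨max N M, fun k hk => ?_⟩
    have h1 : k > N := lt_of_le_of_lt (le_max_left _ _) hk
    have h2 : k > M := lt_of_le_of_lt (le_max_right _ _) hk
    simp [hN k h1, hM k h2]
  smul_mem' := by
    rintro c P ⟨N, hN⟩
    exact ⟨N, fun k hk => by simp [hN k hk]⟩

/-- The super binomial coefficient `[n ; i]`, for `n ∈ ℤ` and `i ∈ ℕ`: zero if `n` is even and `i`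
is odd, and `binom(⌊n/2⌋, ⌊i/2⌋)` otherwise. -/
def superChoose (n : ℤ) (i : ℕ) : ℤ :=
  if Even n ∧ Odd i then 0 else Ring.choose (n / 2) (i / 2)

namespace SPDO

section Ops

variable {K A : Type*} [Field K] [Ring A] [Algebra K A]

/-- The coefficient of `𝒟^k`. -/
def coeff (P : SPDO K A) (k : ℤ) : A := (P : ℤ → A) k

variable (K) in
/-- The operator `a 𝒟^n`. -/
def monomial (n : ℤ) (a : A) : SPDO K A :=
  ⟨Pi.single n a, n, fun _ hk => Pi.single_eq_of_ne (M := fun _ => A) (ne_of_gt hk) a⟩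

/-- The projection `P_+` to the differential part. -/
def diffPart (P : SPDO K A) : SPDO K A :=
  ⟨fun k => if 0 ≤ k then coeff P k else 0, by
    obtain ⟨N, hN⟩ := P.2
    exact ⟨N, fun k hk => by simp [coeff, hN k hk]⟩⟩

/-- The super residue: the coefficient of `𝒟^{-1}`. -/
def sres (P : SPDO K A) : A := coeff P (-1)

/-- Apply a linear map to every coefficient. -/
def mapCoeff (T : A →ₗ[K] A) (P : SPDO K A) : SPDO K A :=
  ⟨fun k => T (coeff P k), by
    obtain ⟨N, hN⟩ := P.2
    exact ⟨N, fun k hk => by simp [coeff, hN k hk]⟩⟩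

variable [SuperDifferentialAlgebra K A]

/-- The product of operators, determined by the generalized super Leibniz rule
`𝒟^n f = ∑_{i ≥ 0} [n ; i] (-1)^{|f| (n - i)} (𝒟^i f) 𝒟^{n-i}`, valid for all `n ∈ ℤ`.
The sum giving the coefficient of `𝒟^k` has only finitely many nonzero terms. -/
instance : Mul (SPDO K A) where
  mul P Q :=
    ⟨fun k => ∑ᶠ p : ℤ × ℕ, superChoose p.1 p.2 •
        (coeff P p.1 * (⇑(D K : A →ₗ[K] A))^[p.2]
          ((⇑(parity K : A →ₐ[K] A))^[(p.1 - p.2).natAbs] (coeff Q (k + p.2 - p.1)))), by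
      obtain ⟨N, hN⟩ := P.2
      obtain ⟨M, hM⟩ := Q.2
      refine ⟨N + M, fun k hk => ?_⟩
      refine finsum_eq_zero_of_forall_eq_zero fun p => ?_
      rcases lt_or_ge N p.1 with h | h
      · simp [coeff, hN p.1 h]
      · have h2 : coeff Q (k + p.2 - p.1) = 0 := hM _ (by omega)
        rw [h2, Function.iterate_fixed (map_zero _), Function.iterate_fixed (map_zero _)]
        simp⟩

instance : One (SPDO K A) := ⟨monomial K 0 1⟩

/-- Powers with natural exponent. -/
instance : Pow (SPDO K A) ℕ := ⟨fun P n => Nat.rec 1 (fun _ R => R * P) n⟩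

/-- The parity automorphism of operators: `a 𝒟^k ↦ (-1)^{|a| + k} a 𝒟^k`. -/
def parityOp (P : SPDO K A) : SPDO K A :=
  ⟨fun k => (k.negOnePow : ℤ) • parity K (coeff P k), by
    obtain ⟨N, hN⟩ := P.2
    exact ⟨N, fun k hk => by simp [coeff, hN k hk]⟩⟩

/-- The even part of an operator. -/
def evenPart (P : SPDO K A) : SPDO K A := (2 : K)⁻¹ • (P + parityOp P)

/-- The odd part of an operator. -/
def oddPart (P : SPDO K A) : SPDO K A := (2 : K)⁻¹ • (P - parityOp P)

/-- The supercommutator `[P, Q] = P Q - (-1)^{|P| |Q|} Q P`, extended bilinearly. -/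
def superCommutator (P Q : SPDO K A) : SPDO K A :=
  P * Q - (Q * evenPart P + parityOp Q * oddPart P)

end Ops

end SPDO

/-! ### The supersymmetric Sawada-Kotera equation and its Lax operator -/

section Equation

variable (K : Type*) {A : Type*} [Field K] [Ring A] [Algebra K A] [SuperDifferentialAlgebra K A]

/-- `T` is the time derivative along a solution `φ` of the supersymmetric Sawada-Kotera equation
`φ_t + φ_xxxxx + 5 φ_xxx (𝒟φ) + 5 φ_xx (𝒟φ_x) + 5 φ_x (𝒟φ)² = 0`:
an even derivation commuting with `𝒟` for which the equation holds. -/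
structure IsSSKFlow (φ : A) (T : A →ₗ[K] A) : Prop where
  leibniz : ∀ f g : A, T (f * g) = T f * g + f * T g
  comm_parity : ∀ f : A, T (parity K f) = parity K (T f)
  comm_D : ∀ f : A, T (D K f) = D K (T f)
  equation : T φ + (dx K)^[5] φ + 5 * ((dx K)^[3] φ * D K φ)
      + 5 * ((dx K)^[2] φ * D K (dx K φ)) + 5 * (dx K φ * (D K φ) ^ 2) = 0

/-- The operator `𝒟³ + φ`. -/
def laxFactor (φ : A) : SPDO K A := SPDO.monomial K 3 1 + SPDO.monomial K 0 φ

/-- The Lax operator `L = (𝒟³ + φ)(𝒟³ + φ)`. -/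
def laxOperator (φ : A) : SPDO K A := laxFactor K φ * laxFactor K φ

/-- `P = 𝒟^m + (terms of lower order)`. -/
def IsMonicOfOrder {K : Type*} [Field K] [Algebra K A] (m : ℤ) (P : SPDO K A) : Prop :=
  SPDO.coeff P m = 1 ∧ ∀ k > m, SPDO.coeff P k = 0

/-- `Λ` is the root `L^{1/6}`: an odd operator `Λ = 𝒟 + O(1)` with `Λ³ = 𝒟³ + φ`. -/
structure IsLaxRoot (φ : A) (Λ : SPDO K A) : Prop where
  odd : SPDO.parityOp Λ = -Λ
  monic : IsMonicOfOrder 1 Λ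
  cube : Λ ^ 3 = laxFactor K φ

/-- `-(1/9) [2 (𝒟φ_xx) + (𝒟φ)² - 6 φ_x φ]`. -/
def density7 (φ : A) : A :=
  (-(1 / 9) : K) • (2 * D K ((dx K)^[2] φ) + (D K φ) ^ 2 - 6 * (dx K φ * φ))

/-- `-(1/81) [6 (𝒟φ_xxxx) + 18 (𝒟φ_xx)(𝒟φ) + 9 (𝒟φ_x)² + 4 (𝒟φ)³ - 18 φ_xxx φ + 6 φ_xx φ_x
- 36 φ_x φ (𝒟φ)]`. -/
def density11 (φ : A) : A :=
  (-(1 / 81) : K) • (6 * D K ((dx K)^[4] φ) + 18 * (D K ((dx K)^[2] φ) * D K φ)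
    + 9 * (D K (dx K φ)) ^ 2 + 4 * (D K φ) ^ 3 - 18 * ((dx K)^[3] φ * φ)
    + 6 * ((dx K)^[2] φ * dx K φ) - 36 * (dx K φ * φ * D K φ))

end Equation

/-! ### The free algebra of differential superpolynomials in one odd variable `φ` -/

section Free

variable (K : Type*) [Field K]

/-- The supercommutation relations between the generators `x_k = 𝒟^k φ`, of parity `k + 1`. -/
inductive SuperRel : FreeAlgebra K ℕ → FreeAlgebra K ℕ → Prop
  | swap (i j : ℕ) : SuperRel (FreeAlgebra.ι K i * FreeAlgebra.ι K j)
      ((-1 : K) ^ ((i + 1) * (j + 1)) • (FreeAlgebra.ι K j * FreeAlgebra.ι K i))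

/-- The free supercommutative algebra on `φ, 𝒟φ, 𝒟²φ, …` with `φ` odd. -/
def FreeSDA : Type _ := RingQuot (SuperRel K)

namespace FreeSDA

instance : Ring (FreeSDA K) := inferInstanceAs (Ring (RingQuot (SuperRel K)))

instance : Algebra K (FreeSDA K) := inferInstanceAs (Algebra K (RingQuot (SuperRel K)))

/-- The generator `𝒟^k φ`. -/
def jet (k : ℕ) : FreeSDA K := RingQuot.mkAlgHom K (SuperRel K) (FreeAlgebra.ι K k)

theorem jet_swap (i j : ℕ) :
    jet K i * jet K j = (-1 : K) ^ ((i + 1) * (j + 1)) • (jet K j * jet K i) := by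
  have h := RingQuot.mkAlgHom_rel K (SuperRel.swap (K := K) i j)
  rw [map_mul, map_smul, map_mul] at h
  exact h

theorem jet_induction {p : FreeSDA K → Prop} (h0 : ∀ c : K, p (algebraMap K _ c))
    (h1 : ∀ k, p (jet K k)) (hm : ∀ a b, p a → p b → p (a * b))
    (ha : ∀ a b, p a → p b → p (a + b)) (f : FreeSDA K) : p f := by
  obtain ⟨g, rfl⟩ := RingQuot.mkAlgHom_surjective K (SuperRel K) f
  induction g using FreeAlgebra.induction with
  | grade0 c =>
    have h : RingQuot.mkAlgHom K (SuperRel K) (algebraMap K _ c) = algebraMap K (FreeSDA K) c :=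
      AlgHom.commutes (RingQuot.mkAlgHom K (SuperRel K)) c
    rw [h]
    exact h0 c
  | grade1 k => exact h1 k
  | mul a b iha ihb => rw [map_mul]; exact hm _ _ iha ihb
  | add a b iha ihb => rw [map_add]; exact ha _ _ iha ihb

/-- The algebra homomorphism with prescribed values `v k` on the generators `𝒟^k φ`. -/
def lift {B : Type*} [Ring B] [Algebra K B] (v : ℕ → B)
    (hv : ∀ i j, v i * v j = (-1 : K) ^ ((i + 1) * (j + 1)) • (v j * v i)) : FreeSDA K →ₐ[K] B :=
  RingQuot.liftAlgHom K ⟨FreeAlgebra.lift K v, by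
    rintro _ _ ⟨i, j⟩
    simpa using hv i j⟩

theorem lift_jet {B : Type*} [Ring B] [Algebra K B] (v : ℕ → B)
    (hv : ∀ i j, v i * v j = (-1 : K) ^ ((i + 1) * (j + 1)) • (v j * v i)) (k : ℕ) :
    lift K v hv (jet K k) = v k := by
  unfold lift jet
  exact (RingQuot.liftAlgHom_mkAlgHom_apply _ _ _ _).trans (by simp)

/-- Parity: `𝒟^k φ ↦ (-1)^{k+1} 𝒟^k φ`. -/
def par : FreeSDA K →ₐ[K] FreeSDA K :=
  lift K (fun k => (-1 : K) ^ (k + 1) • jet K k) fun i j => by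
    simp only [smul_mul_assoc, mul_smul_comm]
    rw [jet_swap K i j]
    simp only [smul_smul]
    congr 1
    ring

theorem par_jet (k : ℕ) : par K (jet K k) = (-1 : K) ^ (k + 1) • jet K k := lift_jet K _ _ k

/-- The homomorphism `f ↦ !![σ f, 𝒟 f; 0, f]` that encodes the odd superderivation
with `𝒟^k φ ↦ 𝒟^{k+1} φ`. -/
def derMat : FreeSDA K →ₐ[K] Matrix (Fin 2) (Fin 2) (FreeSDA K) :=
  lift K (fun k => !![(-1 : K) ^ (k + 1) • jet K k, jet K (k + 1); 0, jet K k]) fun i j => by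
    rw [Matrix.mul_fin_two, Matrix.mul_fin_two]
    ext a b
    fin_cases a <;> fin_cases b
    · simp only [smul_mul_assoc, mul_smul_comm, Matrix.smul_apply]
      simp
      rw [jet_swap K i j]
      simp only [smul_smul]
      congr 1
      ring
    · simp
      rw [jet_swap K i (j + 1), jet_swap K (i + 1) j]
      simp only [smul_smul]
      rw [add_comm]
      congr 2
      · ring
      · rcases Nat.even_or_odd i with h | h <;> rcases Nat.even_or_odd j with h' | h' <;>
          simp [pow_add, pow_mul, h.neg_one_pow, h'.neg_one_pow]
    · simp
    · simpa using jet_swap K i j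

/-- The super derivative, with `𝒟 (𝒟^k φ) = 𝒟^{k+1} φ`. -/
def der : FreeSDA K →ₗ[K] FreeSDA K where
  toFun f := derMat K f 0 1
  map_add' f g := by simp
  map_smul' c f := by simp

theorem derMat_apply (f : FreeSDA K) :
    derMat K f 0 0 = par K f ∧ derMat K f 1 0 = 0 ∧ derMat K f 1 1 = f := by
  induction f using jet_induction with
  | h0 c => simp [Matrix.algebraMap_matrix_apply]
  | h1 k => rw [par_jet, derMat, lift_jet]; simp
  | hm a b ha hb =>
    obtain ⟨a1, a2, a3⟩ := ha
    obtain ⟨b1, b2, b3⟩ := hb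
    simp [Matrix.mul_apply, Fin.sum_univ_two, a1, a2, a3, b1, b2, b3]
  | ha a b ha hb =>
    obtain ⟨a1, a2, a3⟩ := ha
    obtain ⟨b1, b2, b3⟩ := hb
    simp [a1, a2, a3, b1, b2, b3]

theorem der_mul (f g : FreeSDA K) : der K (f * g) = der K f * g + par K f * der K g := by
  have hf := derMat_apply K f
  have hg := derMat_apply K g
  simp [der, Matrix.mul_apply, Fin.sum_univ_two, hf.1, hg.2.2, add_comm]

theorem der_jet (k : ℕ) : der K (jet K k) = jet K (k + 1) := by
  simp [der, derMat, lift_jet]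

theorem der_algebraMap (c : K) : der K (algebraMap K _ c) = 0 := by
  simp [der, Matrix.algebraMap_matrix_apply]

theorem par_par (f : FreeSDA K) : par K (par K f) = f := by
  induction f using jet_induction with
  | h0 c => simp
  | h1 k => simp [par_jet, smul_smul, ← mul_pow]
  | hm a b ha hb => simp [ha, hb]
  | ha a b ha hb => simp [ha, hb]

theorem der_par (f : FreeSDA K) : der K (par K f) = -par K (der K f) := by
  induction f using jet_induction with
  | h0 c => simp [der_algebraMap]
  | h1 k => simp [par_jet, der_jet, pow_succ]
  | hm a b ha hb => simp [der_mul, ha, hb, par_par]; abel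
  | ha a b ha hb => simp [ha, hb]; abel

/-- Every element is a sum of an even central element and an odd element that
commutes with all elements up to their parity. -/
theorem exists_decomp (f : FreeSDA K) : ∃ f0 f1 : FreeSDA K, f = f0 + f1 ∧ par K f0 = f0 ∧
    par K f1 = -f1 ∧ (∀ g, f0 * g = g * f0) ∧ ∀ g, f1 * g = par K g * f1 := by
  induction f using jet_induction with
  | h0 c => exact ⟨algebraMap K _ c, 0, by simp, by simp, by simp,
      fun g => Algebra.commutes c g, by simp⟩
  | h1 k =>
    rcases Nat.even_or_odd k with hk | hk
    · refine ⟨0, jet K k, by simp, by simp, by simp [par_jet, pow_succ, hk.neg_one_pow],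
        by simp, fun g => ?_⟩
      induction g using jet_induction with
      | h0 c => rw [AlgHom.commutes, Algebra.commutes]
      | h1 j =>
        rw [jet_swap, par_jet, pow_mul, hk.add_one.neg_one_pow, smul_mul_assoc]
      | hm a b ha hb => rw [← mul_assoc, ha, mul_assoc, hb, map_mul, mul_assoc]
      | ha a b ha hb => rw [mul_add, ha, hb, map_add, add_mul]
    · refine ⟨jet K k, 0, by simp, by simp [par_jet, pow_succ, hk.neg_one_pow], by simp,
        fun g => ?_, by simp⟩
      induction g using jet_induction with
      | h0 c => rw [Algebra.commutes]
      | h1 j => rw [jet_swap, pow_mul, hk.add_one.neg_one_pow]; simp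
      | hm a b ha hb => rw [← mul_assoc, ha, mul_assoc, hb, mul_assoc]
      | ha a b ha hb => rw [mul_add, ha, hb, add_mul]
  | hm a b ha hb =>
    obtain ⟨a0, a1, rfl, pa0, pa1, ca0, ca1⟩ := ha
    obtain ⟨b0, b1, rfl, pb0, pb1, cb0, cb1⟩ := hb
    refine ⟨a0 * b0 + a1 * b1, a0 * b1 + a1 * b0, by noncomm_ring,
      by simp [pa0, pa1, pb0, pb1], by simp [pa0, pa1, pb0, pb1, add_comm], fun g => ?_, fun g => ?_⟩
    · rw [add_mul, mul_add, mul_assoc, cb0, ← mul_assoc, ca0, mul_assoc, mul_assoc, cb1,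
        ← mul_assoc, ca1, map_mul, par_par, pb1]
      simp only [mul_assoc, ca1, mul_neg, neg_mul]
      simp [pb1]
    · rw [add_mul, mul_add, mul_assoc, cb1, ← mul_assoc, ca0, mul_assoc, mul_assoc, cb0,
        ← mul_assoc, ca1, map_mul, pb0]
      simp only [mul_assoc, cb0 a1]
  | ha a b ha hb =>
    obtain ⟨a0, a1, rfl, pa0, pa1, ca0, ca1⟩ := ha
    obtain ⟨b0, b1, rfl, pb0, pb1, cb0, cb1⟩ := hb
    refine ⟨a0 + b0, a1 + b1, by abel, by simp [*], by simp [*]; abel, fun g => ?_, fun g => ?_⟩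
    · rw [add_mul, mul_add, ca0, cb0]
    · rw [add_mul, mul_add, ca1, cb1]

instance [CharZero K] : SuperDifferentialAlgebra K (FreeSDA K) where
  parityHom := par K
  superD := der K
  parity_parity := par_par K
  superD_parity := der_par K
  superD_mul := der_mul K
  even_comm := by
    intro f g hf
    obtain ⟨f0, f1, rfl, p0, p1, c0, c1⟩ := exists_decomp K f
    rw [map_add, p0, p1] at hf
    have h2 : (2 : K) • f1 = 0 := by
      rw [two_smul]
      have h3 := add_left_cancel hf
      nth_rewrite 1 [← h3]
      simp
    have h4 : f1 = 0 := by simpa using h2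
    simp [h4, c0]
  odd_anticomm := by
    intro f g hf hg
    obtain ⟨f0, f1, rfl, p0, p1, c0, c1⟩ := exists_decomp K f
    rw [map_add, p0, p1, neg_add] at hf
    have h2 : (2 : K) • f0 = 0 := by
      rw [two_smul]
      have h3 := add_right_cancel hf
      nth_rewrite 1 [h3]
      simp
    have h4 : f0 = 0 := by simpa using h2
    simp [h4, c1, hg]

end FreeSDA

end Free

end SSK

end

open SSK

/-! Ring structure. Everything rests on 𝒟·f = 𝒟f + σ(f)·𝒟, with σ the parity. The maps `leib`
satisfy the Pascal-type recursion `leib_succ_succ`, which says 𝒟·(𝒟^n·Q) = 𝒟^{n+1}·Q. Since 𝒟 can be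
cancelled on the left, associativity passes to all integral powers and then, coefficient by
coefficient, to all operators.

Cube roots. If P and Q are monic of order d and X has leading coefficient x, then P²X + PXQ + XQ²
has leading coefficient 2x + σ^d(x), and this map is injective in characteristic zero. Hence monic
cube roots are unique (`cube_injective`), and one of order 1 can be built one order at a time
without leaving K{φ}. Uniqueness also makes Λ odd and homogeneous for the weights |φ| = 3, |𝒟| = 1.
The same argument shows that two derivations of the operator ring which agree on Λ³ agree on Λ, so
the Lax equation has to be verified only for 𝒟³ + φ, where it is an identity of differential
operators.

Trace. The super residue of a supercommutator lies in 𝒟(K{φ}) (`traceComm_of_homogeneous`). This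
gives conservation. It also makes the functionals with n even trivial, because [Λ, Λ^{n-1}] = 2Λ^n
for even n > 0.

Explicit formulas. From Λ^{i+3m} = Λ^i (𝒟³ + φ)^m, truncations of Λ and Λ² suffice. They are given
as integer tables and certified by evaluating a normal form for differential superpolynomials;
`ordLE_sub_of_cube` turns a small defect of the cube into closeness to Λ.

Nonvanishing and independence. The density sres Λ^n has weight n + 1, so nonzero functionals are
eigenvectors of the scaling with distinct eigenvalues. To see that infinitely many are nonzero,
differentiate along T with Tφ = φ: up to a nonzero factor the result is ∫ φ·c, where c is the
coefficient of 𝒟^{-1} in Λ^{2M} and n = 2M + 3. A quadratic functional killing exact densities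
(`quad`) reads off the linear part of c. Linearizing [L, Λ^{2M}] = 0 gives a recursion for such
linear parts governed by 3q² + 3q + 1. Its roots ω satisfy ω⁶ = (1+ω)⁶ = -1/27, so the answer is
explicit and nonzero for M ≡ 2 mod 6, that is n ≡ 7 mod 12. The case n = 11 is evaluated directly.
-/

set_option linter.unusedSectionVars false

/-! ### The super Leibniz rule and the ring of super pseudodifferential operators. -/

noncomputable section

namespace SSK

section Parity

variable (K : Type*) {A : Type*} [Field K] [Ring A] [Algebra K A] [SuperDifferentialAlgebra K A]

theorem parity_parity (f : A) : parity K (parity K f) = f :=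
  SuperDifferentialAlgebra.parity_parity f

theorem D_parity (f : A) : D K (parity K f) = -parity K (D K f) :=
  SuperDifferentialAlgebra.superD_parity f

theorem D_mul (f g : A) : D K (f * g) = D K f * g + parity K f * D K g :=
  SuperDifferentialAlgebra.superD_mul f g

theorem D_one : D K (1 : A) = 0 := by
  have h := D_mul K (1 : A) 1
  simpa using h

/-- The power `f ↦ (-1)^{n |f|} f` of the parity automorphism. -/
def sg (n : ℤ) : A →ₗ[K] A := if Even n then LinearMap.id else (parity K).toLinearMap

variable {K}

theorem sg_of_even {n : ℤ} (h : Even n) (f : A) : sg K n f = f := by simp [sg, h]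

theorem sg_of_odd {n : ℤ} (h : ¬ Even n) (f : A) : sg K n f = parity K f := by simp [sg, h]

@[simp] theorem sg_zero (f : A) : sg K 0 f = f := sg_of_even (by simp) f

@[simp] theorem sg_one_right (n : ℤ) : sg K n (1 : A) = 1 := by
  by_cases h : Even n
  · exact sg_of_even h _
  · simp [sg_of_odd h]

theorem parity_sg (n : ℤ) (f : A) : parity K (sg K n f) = sg K (n + 1) f := by
  by_cases h : Even n
  · rw [sg_of_even h, sg_of_odd (by simpa [Int.even_add_one] using h)]
  · rw [sg_of_odd h, sg_of_even (by simpa [Int.even_add_one] using h), parity_parity]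

theorem sg_sg (n m : ℤ) (f : A) : sg K n (sg K m f) = sg K (n + m) f := by
  by_cases h : Even n
  · rw [sg_of_even h]
    by_cases h' : Even m
    · rw [sg_of_even h', sg_of_even (h.add h')]
    · rw [sg_of_odd h', sg_of_odd (by simpa [Int.even_add, h] using h')]
  · rw [sg_of_odd h, parity_sg]
    have : Even (m + 1) ↔ Even (n + m) := by
      simp [Int.even_add, h]
    unfold sg
    simp only [this]

theorem parity_iterate (n : ℤ) (f : A) :
    (⇑(parity K : A →ₐ[K] A))^[n.natAbs] f = sg K n f := by
  have key : ∀ m : ℕ, (⇑(parity K : A →ₐ[K] A))^[m] f = sg K (m : ℤ) f := by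
    intro m
    induction m with
    | zero => simp
    | succ m ih => rw [Function.iterate_succ_apply', ih, parity_sg]; push_cast; rfl
  rw [key]
  unfold sg
  simp [even_abs]

theorem parity_D_pow (i : ℕ) (f : A) :
    parity K ((D K ^ i : Module.End K A) f) = (-1 : ℤ) ^ i • (D K ^ i : Module.End K A) (parity K f) := by
  induction i generalizing f with
  | zero => simp
  | succ i ih =>
    rw [pow_succ, Module.End.mul_apply, ih, Module.End.mul_apply, D_parity, map_neg, pow_succ]
    simp

variable (K) in
/-- The map `f ↦ [n ; i] (-1)^{|f| (n - i)} 𝒟^i f` of the generalized super Leibniz rule. -/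
def leib (n : ℤ) (i : ℕ) : A →ₗ[K] A :=
  superChoose n i • ((D K ^ i : Module.End K A) ∘ₗ sg K (n - i))

theorem leib_apply (n : ℤ) (i : ℕ) (f : A) :
    leib K n i f = superChoose n i • (D K ^ i : Module.End K A) (sg K (n - i) f) := rfl

theorem superChoose_zero_right (n : ℤ) : superChoose n 0 = 1 := by
  simp [superChoose]

theorem superChoose_zero_succ (i : ℕ) : superChoose 0 (i + 1) = 0 := by
  unfold superChoose
  split_ifs with h
  · rfl
  · have h1 : ¬ Odd (i + 1) := fun h' => h ⟨by simp, h'⟩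
    rw [Nat.not_odd_iff_even] at h1
    obtain ⟨j, hj⟩ := h1
    have : (i + 1) / 2 = (j - 1) + 1 := by omega
    rw [this, EuclideanDomain.zero_div, Ring.choose_zero_succ]

/-- The sign comes from moving the parity past 𝒟^{i+1}. Of the four parity cases only n and i both
odd uses Pascal's rule; in the others at most one binomial survives or two cancel. -/
theorem superChoose_succ (n : ℤ) (i : ℕ) :
    superChoose (n + 1) (i + 1) = superChoose n i + (-1) ^ (i + 1) * superChoose n (i + 1) := by
  unfold superChoose
  have oz : ∀ h : ℤ, ¬ Odd (2 * h) := fun h => by simp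
  have on : ∀ h : ℕ, ¬ Odd (2 * h) := fun h => by simp
  rcases Int.even_or_odd' n with ⟨h, rfl | rfl⟩ <;> rcases Nat.even_or_odd' i with ⟨j, rfl | rfl⟩
  · have e1 : (2 * h + 1) / 2 = h := by omega
    have e2 : (2 * j + 1) / 2 = j := by omega
    have e3 : 2 * h / 2 = h := by omega
    have e4 : 2 * j / 2 = j := by omega
    simp [e1, e2, oz, on]
  · have e1 : (2 * h + 1) / 2 = h := by omega
    have e2 : (2 * j + 1 + 1) / 2 = j + 1 := by omega
    have e3 : 2 * h / 2 = h := by omega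
    simp [e1, e2, Nat.odd_add_one, pow_succ]
  · have e1 : (2 * h + 1 + 1) / 2 = h + 1 := by omega
    have e2 : (2 * j + 1) / 2 = j := by omega
    have e3 : (2 * h + 1) / 2 = h := by omega
    have e4 : 2 * j / 2 = j := by omega
    simp [e2, e3, pow_succ, pow_mul, oz, on]
  · have e1 : (2 * h + 1 + 1) / 2 = h + 1 := by omega
    have e2 : (2 * j + 1 + 1) / 2 = j + 1 := by omega
    have e3 : (2 * h + 1) / 2 = h := by omega
    have e4 : (2 * j + 1) / 2 = j := by omega
    simp [e1, e2, e3, e4, Nat.odd_add_one, pow_succ, pow_mul,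
      Ring.choose_succ_succ]

theorem leib_zero_right (n : ℤ) (f : A) : leib K n 0 f = sg K n f := by
  simp [leib_apply, superChoose_zero_right]

theorem leib_zero_zero (f : A) : leib K 0 0 f = f := by simp [leib_zero_right]

theorem leib_zero_succ (i : ℕ) (f : A) : leib K 0 (i + 1) f = 0 := by
  simp [leib_apply, superChoose_zero_succ]

theorem leib_succ_zero (n : ℤ) (f : A) : leib K (n + 1) 0 f = parity K (leib K n 0 f) := by
  simp only [leib_zero_right, parity_sg]

/-- Compares coefficients in 𝒟·(𝒟^n f) = 𝒟^{n+1} f: the new 𝒟 either differentiates a coefficient or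
passes it with a parity sign. -/
theorem leib_succ_succ (n : ℤ) (i : ℕ) (f : A) :
    leib K (n + 1) (i + 1) f = D K (leib K n i f) + parity K (leib K n (i + 1) f) := by
  have e1 : n + 1 - ((i + 1 : ℕ) : ℤ) = n - i := by push_cast; ring
  have e2 : n - ((i + 1 : ℕ) : ℤ) + 1 = n - i := by push_cast; ring
  rw [leib_apply, leib_apply, leib_apply, map_zsmul, map_zsmul, parity_D_pow, parity_sg, e1, e2,
    superChoose_succ, pow_succ' (D K), Module.End.mul_apply, add_smul,
    mul_comm _ (superChoose n (i + 1)), mul_smul]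

end Parity

namespace SPDO

section Additive

variable {K A : Type*} [Field K] [Ring A] [Algebra K A]

theorem ext_coeff {P Q : SPDO K A} (h : ∀ k, coeff P k = coeff Q k) : P = Q :=
  Subtype.ext (funext h)

@[simp] theorem coeff_add (P Q : SPDO K A) (k : ℤ) : coeff (P + Q) k = coeff P k + coeff Q k := rfl
@[simp] theorem coeff_sub (P Q : SPDO K A) (k : ℤ) : coeff (P - Q) k = coeff P k - coeff Q k := rfl
@[simp] theorem coeff_neg (P : SPDO K A) (k : ℤ) : coeff (-P) k = -coeff P k := rfl
@[simp] theorem coeff_zero (k : ℤ) : coeff (0 : SPDO K A) k = 0 := rfl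
@[simp] theorem coeff_smul (c : K) (P : SPDO K A) (k : ℤ) : coeff (c • P) k = c • coeff P k := rfl

/-- Extraction of a coefficient as a linear map. -/
def coeffHom (k : ℤ) : SPDO K A →ₗ[K] A where
  toFun P := coeff P k
  map_add' _ _ := rfl
  map_smul' _ _ := rfl

@[simp] theorem coeffHom_apply (k : ℤ) (P : SPDO K A) : coeffHom k P = coeff P k := rfl

theorem coeff_sum {ι : Type*} (s : Finset ι) (f : ι → SPDO K A) (k : ℤ) :
    coeff (∑ i ∈ s, f i) k = ∑ i ∈ s, coeff (f i) k :=
  map_sum (coeffHom (K := K) k) f s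

theorem coeff_monomial (n : ℤ) (a : A) (k : ℤ) :
    coeff (monomial K n a) k = if k = n then a else 0 := by
  unfold coeff monomial
  simp [Pi.single_apply]

/-- The order of `P` is at most `N`. -/
def OrdLE (N : ℤ) (P : SPDO K A) : Prop := ∀ k > N, coeff P k = 0

theorem exists_ordLE (P : SPDO K A) : ∃ N, OrdLE N P := P.2

theorem OrdLE.mono {N M : ℤ} {P : SPDO K A} (h : OrdLE N P) (hNM : N ≤ M) : OrdLE M P :=
  fun k hk => h k (lt_of_le_of_lt hNM hk)

theorem OrdLE.add {N : ℤ} {P Q : SPDO K A} (hP : OrdLE N P) (hQ : OrdLE N Q) :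
    OrdLE N (P + Q) := fun k hk => by simp [hP k hk, hQ k hk]

theorem OrdLE.sub {N : ℤ} {P Q : SPDO K A} (hP : OrdLE N P) (hQ : OrdLE N Q) :
    OrdLE N (P - Q) := fun k hk => by simp [hP k hk, hQ k hk]

theorem OrdLE.neg {N : ℤ} {P : SPDO K A} (hP : OrdLE N P) : OrdLE N (-P) :=
  fun k hk => by simp [hP k hk]

theorem OrdLE.smul {N : ℤ} {P : SPDO K A} (c : K) (hP : OrdLE N P) : OrdLE N (c • P) :=
  fun k hk => by simp [hP k hk]

theorem OrdLE.zero (N : ℤ) : OrdLE N (0 : SPDO K A) := fun _ _ => rfl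

theorem ordLE_monomial (n : ℤ) (a : A) : OrdLE n (monomial K n a) := fun k hk => by
  rw [coeff_monomial, if_neg (ne_of_gt hk)]

theorem OrdLE.of_leading {N : ℤ} {P : SPDO K A} (h : OrdLE N P) (h0 : coeff P N = 0) :
    OrdLE (N - 1) P := fun k hk => by
  rcases (show N ≤ k by omega).eq_or_lt with rfl | hk'
  · exact h0
  · exact h k hk'

/-- An operator whose possible leading coefficients of order above `c` all vanish has order at
most `c`. -/
theorem ordLE_of_forall_leading {P : SPDO K A} (c : ℤ)
    (h : ∀ N > c, OrdLE N P → coeff P N = 0) : OrdLE c P := by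
  obtain ⟨N, hN⟩ := exists_ordLE P
  have key : ∀ j : ℕ, ∀ M : ℤ, M ≤ c + j → OrdLE M P → OrdLE c P := by
    intro j
    induction j with
    | zero => intro M hM hP; exact hP.mono (by simpa using hM)
    | succ j ih =>
      intro M hM hP
      rcases le_or_gt M c with hc | hc
      · exact hP.mono hc
      · exact ih (M - 1) (by push_cast at hM; omega) (hP.of_leading (h M hc hP))
  exact key (N - c).toNat N (by omega) hN

theorem eq_zero_of_forall_ordLE {P : SPDO K A} (h : ∀ N, OrdLE N P) : P = 0 :=
  ext_coeff fun k => h (k - 1) k (by omega)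

theorem eq_zero_of_forall_leading {P : SPDO K A}
    (h : ∀ N, OrdLE N P → coeff P N = 0) : P = 0 :=
  eq_zero_of_forall_ordLE fun c => ordLE_of_forall_leading c fun N _ => h N

/-- Truncation principle: an additive map that kills operators of low order vanishes at `P` as
soon as it kills the homogeneous terms of `P`. -/
theorem map_eq_zero {G : Type*} [AddCommGroup G] (F : SPDO K A →+ G) (c : ℤ)
    (hlow : ∀ Q, OrdLE c Q → F Q = 0) (P : SPDO K A)
    (hmon : ∀ n, F (monomial K n (coeff P n)) = 0) : F P = 0 := by
  obtain ⟨N, hN⟩ := exists_ordLE P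
  have h1 : OrdLE c (P - ∑ n ∈ Finset.Ioc c N, monomial K n (coeff P n)) := by
    intro k hk
    rw [coeff_sub, coeff_sum]
    simp only [coeff_monomial]
    rw [Finset.sum_ite_eq]
    split_ifs with h
    · simp
    · rw [hN k (by simp only [Finset.mem_Ioc, not_and, not_le] at h; exact h hk)]; simp
  have h2 := hlow _ h1
  rw [map_sub, map_sum, Finset.sum_eq_zero (fun n _ => hmon n), sub_zero] at h2
  exact h2

end Additive

section Mul

variable {K A : Type*} [Field K] [Ring A] [Algebra K A] [SuperDifferentialAlgebra K A]

theorem coeff_mul (P Q : SPDO K A) (k : ℤ) :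
    coeff (P * Q) k = ∑ᶠ p : ℤ × ℕ, coeff P p.1 * leib K p.1 p.2 (coeff Q (k + p.2 - p.1)) := by
  refine finsum_congr fun p => ?_
  rw [parity_iterate, leib_apply, mul_smul_comm, Module.End.coe_pow]

theorem support_coeff_mul {N M : ℤ} {P Q : SPDO K A} (hP : OrdLE N P) (hQ : OrdLE M Q)
    {k lo : ℤ} {I : ℕ} (hlo : lo ≤ k - M) (hI : N + M - k < I) :
    (Function.support fun p : ℤ × ℕ =>
      coeff P p.1 * leib K p.1 p.2 (coeff Q (k + p.2 - p.1))) ⊆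
      ↑(Finset.Icc lo N ×ˢ Finset.range I) := by
  intro p hp
  simp only [Finset.coe_product, Set.mem_prod, Finset.mem_coe, Finset.mem_Icc, Finset.mem_range]
  rw [Function.mem_support] at hp
  have h1 : p.1 ≤ N := by
    by_contra h
    exact hp (by rw [hP p.1 (by omega), zero_mul])
  have h2 : k + p.2 - p.1 ≤ M := by
    by_contra h
    exact hp (by rw [hQ _ (by omega), map_zero, mul_zero])
  omega

/-- The bounds `lo` and `I` are left free so that several products can be expanded over one common
rectangle and compared termwise. -/
theorem coeff_mul_of_ordLE {N M : ℤ} {P Q : SPDO K A} (hP : OrdLE N P) (hQ : OrdLE M Q)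
    (k lo : ℤ) (I : ℕ) (hlo : lo ≤ k - M) (hI : N + M - k < I) :
    coeff (P * Q) k = ∑ n ∈ Finset.Icc lo N, ∑ i ∈ Finset.range I,
      coeff P n * leib K n i (coeff Q (k + i - n)) := by
  rw [coeff_mul, finsum_eq_sum_of_support_subset _ (support_coeff_mul hP hQ hlo hI),
    Finset.sum_product]

theorem OrdLE.mul {N M : ℤ} {P Q : SPDO K A} (hP : OrdLE N P) (hQ : OrdLE M Q) :
    OrdLE (N + M) (P * Q) := fun k hk => by
  rw [coeff_mul_of_ordLE hP hQ k (k - M) 0 le_rfl (by push_cast; omega)]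
  simp

theorem leading_mul {N M : ℤ} {P Q : SPDO K A} (hP : OrdLE N P) (hQ : OrdLE M Q) :
    coeff (P * Q) (N + M) = coeff P N * sg K N (coeff Q M) := by
  rw [coeff_mul_of_ordLE hP hQ (N + M) N 1 (by omega) (by push_cast; omega)]
  simp [leib_zero_right]

protected theorem add_mul (P Q R : SPDO K A) : (P + Q) * R = P * R + Q * R := by
  obtain ⟨N, hN⟩ := exists_ordLE P
  obtain ⟨N', hN'⟩ := exists_ordLE Q
  obtain ⟨M, hM⟩ := exists_ordLE R
  have h1 := hN.mono (le_max_left N N')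
  have h2 := hN'.mono (le_max_right N N')
  refine ext_coeff fun k => ?_
  have hI : max N N' + M - k < ((max N N' + M - k + 1).toNat : ℕ) := by omega
  rw [coeff_add, coeff_mul_of_ordLE (h1.add h2) hM k _ _ le_rfl hI,
    coeff_mul_of_ordLE h1 hM k _ _ le_rfl hI, coeff_mul_of_ordLE h2 hM k _ _ le_rfl hI]
  simp only [← Finset.sum_add_distrib, coeff_add, add_mul]

protected theorem mul_add (P Q R : SPDO K A) : P * (Q + R) = P * Q + P * R := by
  obtain ⟨N, hN⟩ := exists_ordLE Q
  obtain ⟨N', hN'⟩ := exists_ordLE R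
  obtain ⟨M, hM⟩ := exists_ordLE P
  have h1 := hN.mono (le_max_left N N')
  have h2 := hN'.mono (le_max_right N N')
  refine ext_coeff fun k => ?_
  have hI : M + max N N' - k < ((M + max N N' - k + 1).toNat : ℕ) := by omega
  rw [coeff_add, coeff_mul_of_ordLE hM (h1.add h2) k _ _ le_rfl hI,
    coeff_mul_of_ordLE hM h1 k _ _ le_rfl hI, coeff_mul_of_ordLE hM h2 k _ _ le_rfl hI]
  simp only [← Finset.sum_add_distrib, coeff_add, map_add, mul_add]

protected theorem zero_mul (P : SPDO K A) : 0 * P = 0 := by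
  have h := SPDO.add_mul 0 0 P
  simpa using h

protected theorem mul_zero (P : SPDO K A) : P * 0 = 0 := by
  have h := SPDO.mul_add P 0 0
  simpa using h

theorem coeff_monomial_mul {M : ℤ} {Q : SPDO K A} (hQ : OrdLE M Q) (n : ℤ) (a : A) (k : ℤ)
    (I : ℕ) (hI : n + M - k < I) :
    coeff (monomial K n a * Q) k =
      a * ∑ i ∈ Finset.range I, leib K n i (coeff Q (k + i - n)) := by
  rw [coeff_mul_of_ordLE (ordLE_monomial n a) hQ k (min n (k - M)) I (min_le_right _ _) hI,
    Finset.sum_eq_single n]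
  · rw [Finset.mul_sum]
    simp [coeff_monomial]
  · intro m _ hm
    simp [coeff_monomial, hm]
  · intro h
    simp at h

theorem coeff_monomial_zero_mul (a : A) (Q : SPDO K A) (k : ℤ) :
    coeff (monomial K 0 a * Q) k = a * coeff Q k := by
  obtain ⟨M, hM⟩ := exists_ordLE Q
  rw [coeff_monomial_mul hM 0 a k ((M - k).toNat + 1) (by push_cast; omega),
    Finset.sum_range_succ']
  simp [leib_zero_zero, leib_zero_succ]

variable (K A) in
/-- The operator `𝒟^n`. -/
def Dn (n : ℤ) : SPDO K A := monomial K n 1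

theorem monomial_mul (n : ℤ) (a : A) (Q : SPDO K A) :
    monomial K n a * Q = monomial K 0 a * (Dn K A n * Q) := by
  obtain ⟨M, hM⟩ := exists_ordLE Q
  refine ext_coeff fun k => ?_
  have hI : n + M - k < (((n + M - k).toNat + 1 : ℕ) : ℤ) := by push_cast; omega
  rw [coeff_monomial_zero_mul, Dn, coeff_monomial_mul hM n a k _ hI,
    coeff_monomial_mul hM n 1 k _ hI, one_mul]

theorem coeff_Dn_mul {M : ℤ} {Q : SPDO K A} (hQ : OrdLE M Q) (n k : ℤ)
    (I : ℕ) (hI : n + M - k < I) :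
    coeff (Dn K A n * Q) k = ∑ i ∈ Finset.range I, leib K n i (coeff Q (k + i - n)) := by
  rw [Dn, coeff_monomial_mul hQ n 1 k I hI, one_mul]

protected theorem one_mul (Q : SPDO K A) : 1 * Q = Q :=
  ext_coeff fun k => (coeff_monomial_zero_mul 1 Q k).trans (one_mul _)

theorem superChoose_one (i : ℕ) : superChoose 1 (i + 2) = 0 := by
  have h := superChoose_succ 0 (i + 1)
  simpa [superChoose_zero_succ] using h

theorem leib_one_one (f : A) : leib K 1 1 f = D K f := by
  have h := leib_succ_succ (K := K) 0 0 f
  simpa [leib_zero_zero, leib_zero_succ] using h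

theorem coeff_D_mul (Q : SPDO K A) (k : ℤ) :
    coeff (Dn K A 1 * Q) k = D K (coeff Q k) + parity K (coeff Q (k - 1)) := by
  obtain ⟨M, hM⟩ := exists_ordLE Q
  rw [coeff_Dn_mul hM 1 k ((1 + M - k).toNat + 2) (by push_cast; omega),
    Finset.sum_range_succ', Finset.sum_range_succ', Finset.sum_eq_zero]
  · have h : leib K 1 0 (coeff Q (k - 1)) = parity K (coeff Q (k - 1)) := by
      rw [leib_zero_right, sg_of_odd (by decide)]
    simp [leib_one_one, h]
  · intro i _
    rw [leib_apply, superChoose_one, zero_smul]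

/-- The recursion for `leib` in operator form. It holds for negative n too, which is what makes the
induction in both directions in `Dn_assoc` possible. -/
theorem D_mul_Dn_mul (n : ℤ) (Q : SPDO K A) :
    Dn K A 1 * (Dn K A n * Q) = Dn K A (n + 1) * Q := by
  obtain ⟨M, hM⟩ := exists_ordLE Q
  refine ext_coeff fun k => ?_
  set I := (n + M - k).toNat + 2 with hI
  rw [coeff_D_mul, coeff_Dn_mul hM n k I (by push_cast [hI]; omega),
    coeff_Dn_mul hM n (k - 1) (I + 1) (by push_cast [hI]; omega),
    coeff_Dn_mul hM (n + 1) k (I + 1) (by push_cast [hI]; omega),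
    Finset.sum_range_succ' _ I, Finset.sum_range_succ' _ I, map_sum, map_add, map_sum, ← add_assoc,
    ← Finset.sum_add_distrib]
  congr 1
  · refine Finset.sum_congr rfl fun i _ => ?_
    rw [show k - 1 + ((i + 1 : ℕ) : ℤ) - n = k + i - n by push_cast; ring,
      show k + ((i + 1 : ℕ) : ℤ) - (n + 1) = k + i - n by push_cast; ring, leib_succ_succ]
  · rw [leib_succ_zero]
    congr 3
    push_cast; ring

theorem monomial_zero_assoc (a : A) (Q R : SPDO K A) :
    monomial K 0 a * (Q * R) = monomial K 0 a * Q * R := by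
  obtain ⟨N, hN⟩ := exists_ordLE Q
  obtain ⟨M, hM⟩ := exists_ordLE R
  refine ext_coeff fun k => ?_
  have h1 : OrdLE N (monomial K 0 a * Q) := fun k hk => by
    rw [coeff_monomial_zero_mul, hN k hk, mul_zero]
  have hI : N + M - k < (((N + M - k).toNat + 1 : ℕ) : ℤ) := by push_cast; omega
  rw [coeff_monomial_zero_mul, coeff_mul_of_ordLE hN hM k _ _ le_rfl hI,
    coeff_mul_of_ordLE h1 hM k _ _ le_rfl hI]
  simp only [coeff_monomial_zero_mul, Finset.mul_sum, mul_assoc]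

/-- Additive defect of associativity in the first nontrivial argument. -/
def assocHom (P R : SPDO K A) : SPDO K A →+ SPDO K A where
  toFun Q := P * (Q * R) - P * Q * R
  map_zero' := by simp [SPDO.zero_mul, SPDO.mul_zero]
  map_add' Q Q' := by simp only [SPDO.add_mul, SPDO.mul_add]; abel

theorem D_assoc (Q R : SPDO K A) : Dn K A 1 * (Q * R) = Dn K A 1 * Q * R := by
  rw [← sub_eq_zero]
  refine ext_coeff fun k => ?_
  obtain ⟨M, hM⟩ := exists_ordLE R
  have hD : OrdLE 1 (Dn K A 1) := ordLE_monomial 1 1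
  -- For Q of order at most k - M - 2 both products have order below k, so Q may be replaced by a
  -- single term b𝒟^n.
  refine map_eq_zero ((coeffHom (K := K) k).toAddMonoidHom.comp (assocHom (Dn K A 1) R))
    (k - M - 2) ?_ Q ?_
  · intro Q hQ
    exact (((hD.mul (hQ.mul hM)).mono (by omega : _ ≤ k - 1)).sub
      (((hD.mul hQ).mul hM).mono (by omega))) k (by omega)
  · intro n
    change coeff (Dn K A 1 * (monomial K n (coeff Q n) * R) -
      Dn K A 1 * monomial K n (coeff Q n) * R) k = 0
    generalize coeff Q n = b
    have h1 : Dn K A 1 * monomial K n b = monomial K n (D K b) + monomial K (n + 1) (parity K b) := by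
      refine ext_coeff fun k => ?_
      rw [coeff_D_mul, coeff_add]
      simp only [coeff_monomial, sub_eq_iff_eq_add]
      split_ifs <;> simp
    rw [h1, SPDO.add_mul, monomial_mul, monomial_mul n, monomial_mul (n + 1), ← D_mul_Dn_mul]
    simp only [coeff_sub, coeff_add, coeff_D_mul, coeff_monomial_zero_mul, D_mul, map_mul, mul_add]
    abel

/-- The leading coefficient of 𝒟·X is the parity image of that of X, and parity is an involution. -/
theorem D_mul_cancel {X Y : SPDO K A} (h : Dn K A 1 * X = Dn K A 1 * Y) : X = Y := by
  rw [← sub_eq_zero]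
  refine eq_zero_of_forall_leading fun N hN => ?_
  have h1 : Dn K A 1 * (X - Y) = 0 := by
    have := SPDO.mul_add (Dn K A 1) (X - Y) Y
    rw [sub_add_cancel, h] at this
    simpa using this.symm
  have h2 := coeff_D_mul (X - Y) (N + 1)
  rw [h1, hN (N + 1) (by omega)] at h2
  simp only [coeff_zero, map_zero, zero_add, add_sub_cancel_right] at h2
  rw [← parity_parity K (coeff (X - Y) N), ← h2, map_zero]

theorem Dn_assoc (n : ℤ) (Q R : SPDO K A) : Dn K A n * (Q * R) = Dn K A n * Q * R := by
  induction n using Int.induction_on with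
  | zero => exact (SPDO.one_mul _).trans (congrArg (· * R) (SPDO.one_mul Q).symm)
  | succ n ih => rw [← D_mul_Dn_mul, ih, D_assoc, D_mul_Dn_mul]
  | pred n ih =>
    apply D_mul_cancel
    rw [D_mul_Dn_mul, D_assoc, D_mul_Dn_mul, sub_add_cancel, ih]

protected theorem mul_assoc (P Q R : SPDO K A) : P * Q * R = P * (Q * R) := by
  rw [← sub_eq_zero]
  refine ext_coeff fun k => ?_
  obtain ⟨M, hM⟩ := exists_ordLE R
  obtain ⟨N, hN⟩ := exists_ordLE Q
  let F : SPDO K A →+ SPDO K A :=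
    { toFun := fun P => P * Q * R - P * (Q * R)
      map_zero' := by simp [SPDO.zero_mul]
      map_add' := fun P P' => by simp only [SPDO.add_mul]; abel }
  refine map_eq_zero ((coeffHom (K := K) k).toAddMonoidHom.comp F) (k - M - N - 1) ?_ P ?_
  · intro P hP
    exact ((((hP.mul hN).mul hM).mono (by omega : _ ≤ k - 1)).sub
      ((hP.mul (hN.mul hM)).mono (by omega))) k (by omega)
  · intro n
    change coeff (monomial K n (coeff P n) * Q * R - monomial K n (coeff P n) * (Q * R)) k = 0
    rw [monomial_mul n _ Q, monomial_mul n _ (Q * R), Dn_assoc, monomial_zero_assoc _ (_ * Q) R,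
      sub_self, coeff_zero]

theorem leib_one_right (n : ℤ) (i : ℕ) : leib K n (i + 1) (1 : A) = 0 := by
  rw [leib_apply, sg_one_right, pow_succ, Module.End.mul_apply, D_one, map_zero, smul_zero]

protected theorem mul_one (P : SPDO K A) : P * 1 = P := by
  obtain ⟨N, hN⟩ := exists_ordLE P
  refine ext_coeff fun k => ?_
  rw [coeff_mul_of_ordLE hN (show OrdLE 0 (1 : SPDO K A) from ordLE_monomial 0 1) k (min k N)
    ((N - k).toNat + 1) (by simp) (by push_cast; omega)]
  rw [Finset.sum_eq_single k]
  · rw [Finset.sum_range_succ', Finset.sum_eq_zero]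
    · change _ + coeff P k * leib K k 0 (coeff (monomial K 0 1) _) = _
      simp [leib_zero_right, coeff_monomial]
    · intro i _
      change coeff P k * leib K k (i + 1) (coeff (monomial K 0 1) _) = _
      rw [coeff_monomial, if_neg (by push_cast; omega), map_zero, mul_zero]
  · intro n _ hn
    refine Finset.sum_eq_zero fun i _ => ?_
    change coeff P n * leib K n i (coeff (monomial K 0 1) _) = _
    rw [coeff_monomial]
    split_ifs with h
    · obtain ⟨j, rfl⟩ : ∃ j, i = j + 1 := ⟨i - 1, by omega⟩
      rw [leib_one_right, mul_zero]
    · simp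
  · intro h
    rw [hN k (by simp at h; exact h)]
    simp

/-- The ring of super pseudodifferential operators. -/
@[reducible] def instRing : Ring (SPDO K A) :=
  { (inferInstance : AddCommGroup (SPDO K A)) with
    mul := (· * ·)
    one := 1
    left_distrib := SPDO.mul_add
    right_distrib := SPDO.add_mul
    zero_mul := SPDO.zero_mul
    mul_zero := SPDO.mul_zero
    mul_assoc := SPDO.mul_assoc
    one_mul := SPDO.one_mul
    mul_one := SPDO.mul_one
    -- Taking the existing power as `npow` keeps ring powers definitionally equal to those in the
    -- definitions of Λ and L.
    npow := fun n P => P ^ n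
    npow_zero := fun _ => rfl
    npow_succ := fun _ _ => rfl }

theorem smul_mul (c : K) (P Q : SPDO K A) : (c • P) * Q = c • (P * Q) := by
  obtain ⟨N, hN⟩ := exists_ordLE P
  obtain ⟨M, hM⟩ := exists_ordLE Q
  refine ext_coeff fun k => ?_
  have hI : N + M - k < (((N + M - k).toNat + 1 : ℕ) : ℤ) := by push_cast; omega
  rw [coeff_smul, coeff_mul_of_ordLE (hN.smul c) hM k _ _ le_rfl hI,
    coeff_mul_of_ordLE hN hM k _ _ le_rfl hI]
  simp only [coeff_smul, smul_mul_assoc, Finset.smul_sum]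

theorem mul_smul' (c : K) (P Q : SPDO K A) : P * (c • Q) = c • (P * Q) := by
  obtain ⟨N, hN⟩ := exists_ordLE P
  obtain ⟨M, hM⟩ := exists_ordLE Q
  refine ext_coeff fun k => ?_
  have hI : N + M - k < (((N + M - k).toNat + 1 : ℕ) : ℤ) := by push_cast; omega
  rw [coeff_smul, coeff_mul_of_ordLE hN (hM.smul c) k _ _ le_rfl hI,
    coeff_mul_of_ordLE hN hM k _ _ le_rfl hI]
  simp only [coeff_smul, map_smul, mul_smul_comm, Finset.smul_sum]

end Mul

end SPDO

end SSK

end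

/-! ### Coefficientwise maps, cube roots, and the operator Λ. -/

noncomputable section

namespace SSK

namespace SPDO

attribute [local instance] SPDO.instRing

section Maps

variable {K A : Type*} [Field K] [Ring A] [Algebra K A] [SuperDifferentialAlgebra K A]

theorem finite_support_coeff_mul (P Q : SPDO K A) (k : ℤ) :
    (Function.support fun p : ℤ × ℕ =>
      coeff P p.1 * leib K p.1 p.2 (coeff Q (k + p.2 - p.1))).Finite := by
  obtain ⟨N, hN⟩ := exists_ordLE P
  obtain ⟨M, hM⟩ := exists_ordLE Q
  exact (Finset.finite_toSet _).subset (support_coeff_mul hN hM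
    (I := (N + M - k).toNat + 1) le_rfl (by push_cast; omega))

/-- The map `a 𝒟^k ↦ c^k f(a) 𝒟^k`. -/
def mapOp (f : A →ₐ[K] A) (c : K) (P : SPDO K A) : SPDO K A :=
  ⟨fun k => c ^ k • f (coeff P k), by
    obtain ⟨N, hN⟩ := P.2
    exact ⟨N, fun k hk => by simp [coeff, hN k hk]⟩⟩

@[simp] theorem coeff_mapOp (f : A →ₐ[K] A) (c : K) (P : SPDO K A) (k : ℤ) :
    coeff (mapOp f c P) k = c ^ k • f (coeff P k) := rfl

variable {f : A →ₐ[K] A} {c : K}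

theorem map_leib (hσ : ∀ x, f (parity K x) = parity K (f x))
    (hD : ∀ x, f (D K x) = c • D K (f x)) (n : ℤ) (i : ℕ) (x : A) :
    f (leib K n i x) = c ^ i • leib K n i (f x) := by
  have h1 : ∀ (i : ℕ) (x : A), f ((D K ^ i : Module.End K A) x) =
      c ^ i • (D K ^ i : Module.End K A) (f x) := by
    intro i
    induction i with
    | zero => simp
    | succ i ih =>
      intro x
      rw [pow_succ, Module.End.mul_apply, ih, hD, Module.End.mul_apply, map_smul, smul_smul,
        pow_succ]
  have h2 : f (sg K (n - i) x) = sg K (n - i) (f x) := by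
    by_cases h : Even (n - (i : ℤ))
    · rw [sg_of_even h, sg_of_even h]
    · rw [sg_of_odd h, sg_of_odd h, hσ]
  rw [leib_apply, map_zsmul, h1, h2, leib_apply, smul_comm]

/-- If f rescales 𝒟 by c, then letting 𝒟 ↦ c𝒟 respects the Leibniz rule. Used with c = -1 for the
parity of operators and with c = 2 for the weight grading. -/
theorem mapOp_mul (hc : c ≠ 0) (hσ : ∀ x, f (parity K x) = parity K (f x))
    (hD : ∀ x, f (D K x) = c • D K (f x)) (P Q : SPDO K A) :
    mapOp f c (P * Q) = mapOp f c P * mapOp f c Q := by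
  refine ext_coeff fun k => ?_
  rw [coeff_mapOp, coeff_mul, coeff_mul]
  have h := ((c ^ k • f.toLinearMap).toAddMonoidHom).map_finsum (finite_support_coeff_mul P Q k)
  refine h.trans (finsum_congr fun p => ?_)
  change c ^ k • f (coeff P p.1 * leib K p.1 p.2 (coeff Q (k + p.2 - p.1))) = _
  rw [map_mul, map_leib hσ hD, coeff_mapOp, coeff_mapOp, map_smul, smul_mul_assoc, mul_smul_comm,
    mul_smul_comm, smul_smul, smul_smul]
  congr 1
  rw [← zpow_add₀ hc, ← zpow_natCast c, ← zpow_add₀ hc]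
  congr 1
  ring

theorem mapOp_one : mapOp f c (1 : SPDO K A) = 1 := by
  refine ext_coeff fun k => ?_
  change c ^ k • f (coeff (monomial K 0 1) k) = coeff (monomial K 0 1) k
  rw [coeff_monomial]
  split_ifs with h
  · simp [h]
  · simp

theorem mapOp_pow (hc : c ≠ 0) (hσ : ∀ x, f (parity K x) = parity K (f x))
    (hD : ∀ x, f (D K x) = c • D K (f x)) (P : SPDO K A) (n : ℕ) :
    mapOp f c (P ^ n) = mapOp f c P ^ n := by
  induction n with
  | zero => rw [pow_zero, pow_zero, mapOp_one]
  | succ n ih => rw [pow_succ, pow_succ, mapOp_mul hc hσ hD, ih]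

theorem coeff_parityOp (P : SPDO K A) (k : ℤ) :
    coeff (parityOp P) k = (-1 : K) ^ k • parity K (coeff P k) := by
  change ((k.negOnePow : ℤˣ) : ℤ) • parity K (coeff P k) = _
  rcases Int.even_or_odd k with h | h
  · rw [Int.negOnePow_even k h, h.neg_one_zpow]; simp
  · rw [Int.negOnePow_odd k h, h.neg_one_zpow]; simp

theorem parityOp_eq_mapOp (P : SPDO K A) : parityOp P = mapOp (parity K) (-1) P :=
  ext_coeff fun k => coeff_parityOp P k

theorem parityOp_mul (P Q : SPDO K A) : parityOp (P * Q) = parityOp P * parityOp Q := by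
  simp only [parityOp_eq_mapOp]
  exact mapOp_mul (by simp) (fun _ => rfl) (fun x => by rw [D_parity]; simp) P Q

theorem parityOp_smul (c : K) (P : SPDO K A) : parityOp (c • P) = c • parityOp P :=
  ext_coeff fun k => by simp [coeff_parityOp, smul_comm c]

theorem parityOp_one : parityOp (1 : SPDO K A) = 1 := by
  rw [parityOp_eq_mapOp, mapOp_one]

theorem parityOp_parityOp (P : SPDO K A) : parityOp (parityOp P) = P := by
  refine ext_coeff fun k => ?_
  rw [coeff_parityOp, coeff_parityOp, map_smul, parity_parity, smul_smul, ← mul_zpow]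
  simp

theorem parityOp_pow {P : SPDO K A} {ε : ℤ} (h : parityOp P = ε • P) (n : ℕ) :
    parityOp (P ^ n) = ε ^ n • P ^ n := by
  induction n with
  | zero => rw [pow_zero, pow_zero, parityOp_one, one_smul]
  | succ n ih =>
    rw [pow_succ, parityOp_mul, ih, h, smul_mul_smul_comm, pow_succ]

theorem coeff_mapCoeff (T : A →ₗ[K] A) (P : SPDO K A) (k : ℤ) :
    coeff (mapCoeff T P) k = T (coeff P k) := rfl

theorem mapCoeff_mul {T : A →ₗ[K] A} (hT : ∀ f g : A, T (f * g) = T f * g + f * T g)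
    (hσ : ∀ f : A, T (parity K f) = parity K (T f)) (hD : ∀ f : A, T (D K f) = D K (T f))
    (P Q : SPDO K A) :
    mapCoeff T (P * Q) = mapCoeff T P * Q + P * mapCoeff T Q := by
  refine ext_coeff fun k => ?_
  rw [coeff_add, coeff_mapCoeff, coeff_mul, coeff_mul, coeff_mul, ← finsum_add_distrib
    (finite_support_coeff_mul _ Q k) (finite_support_coeff_mul P _ k)]
  refine (T.toAddMonoidHom.map_finsum (finite_support_coeff_mul P Q k)).trans
    (finsum_congr fun p => ?_)
  have h1 : ∀ (i : ℕ) (x : A), T ((D K ^ i : Module.End K A) x) =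
      (D K ^ i : Module.End K A) (T x) := by
    intro i
    induction i with
    | zero => simp
    | succ i ih => intro x; rw [pow_succ, Module.End.mul_apply, ih, hD, Module.End.mul_apply]
  have h2 : ∀ (n : ℤ) (x : A), T (sg K n x) = sg K n (T x) := by
    intro n x
    by_cases h : Even n
    · rw [sg_of_even h, sg_of_even h]
    · rw [sg_of_odd h, sg_of_odd h, hσ]
  change T (_ * _) = _
  rw [hT, leib_apply, map_zsmul, h1, h2, coeff_mapCoeff, coeff_mapCoeff, leib_apply]

theorem mapCoeff_one {T : A →ₗ[K] A} (hT : ∀ f g : A, T (f * g) = T f * g + f * T g) :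
    mapCoeff T (1 : SPDO K A) = 0 := by
  refine ext_coeff fun k => ?_
  change T (coeff (monomial K 0 1) k) = 0
  have h1 : T 1 = 0 := by simpa using hT 1 1
  rw [coeff_monomial]
  split_ifs <;> simp [h1]

end Maps

section Stable

variable {K A : Type*} [Field K] [Ring A] [Algebra K A] [SuperDifferentialAlgebra K A]

/-- The subalgebra `S` is stable under parity and `𝒟`. -/
structure IsStable (S : Subalgebra K A) : Prop where
  parity_mem : ∀ x ∈ S, parity K x ∈ S
  D_mem : ∀ x ∈ S, D K x ∈ S

/-- All coefficients of `P` belong to `S`. -/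
def CoeffIn (S : Subalgebra K A) (P : SPDO K A) : Prop := ∀ k, coeff P k ∈ S

variable {S : Subalgebra K A}

theorem IsStable.leib_mem (hS : IsStable S) (n : ℤ) (i : ℕ) {x : A} (hx : x ∈ S) :
    leib K n i x ∈ S := by
  have h1 : ∀ (i : ℕ), ∀ x ∈ S, (D K ^ i : Module.End K A) x ∈ S := by
    intro i
    induction i with
    | zero => simp
    | succ i ih =>
      intro x hx
      rw [pow_succ, Module.End.mul_apply]
      exact ih _ (hS.D_mem _ hx)
  have h2 : sg K (n - i) x ∈ S := by
    by_cases h : Even (n - (i : ℤ))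
    · rwa [sg_of_even h]
    · rw [sg_of_odd h]; exact hS.parity_mem _ hx
  exact zsmul_mem (h1 _ _ h2) _

theorem CoeffIn.mul (hS : IsStable S) {P Q : SPDO K A} (hP : CoeffIn S P) (hQ : CoeffIn S Q) :
    CoeffIn S (P * Q) := fun k => by
  rw [coeff_mul]
  exact finsum_induction (· ∈ S) (zero_mem S) (fun _ _ => add_mem)
    fun p => mul_mem (hP _) (hS.leib_mem _ _ (hQ _))

theorem CoeffIn.add {P Q : SPDO K A} (hP : CoeffIn S P) (hQ : CoeffIn S Q) :
    CoeffIn S (P + Q) := fun k => add_mem (hP k) (hQ k)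

theorem CoeffIn.sub {P Q : SPDO K A} (hP : CoeffIn S P) (hQ : CoeffIn S Q) :
    CoeffIn S (P - Q) := fun k => sub_mem (hP k) (hQ k)

theorem CoeffIn.smul {P : SPDO K A} (c : K) (hP : CoeffIn S P) :
    CoeffIn S (c • P) := fun k => S.smul_mem (hP k) c

theorem coeffIn_monomial (n : ℤ) {a : A} (ha : a ∈ S) : CoeffIn S (monomial K n a) := fun k => by
  rw [coeff_monomial]
  split_ifs
  · exact ha
  · exact zero_mem S

theorem coeffIn_Dn (n : ℤ) : CoeffIn S (Dn K A n) := coeffIn_monomial n (one_mem S)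

theorem CoeffIn.parityOp (hS : IsStable S) {P : SPDO K A} (hP : CoeffIn S P) :
    CoeffIn S (parityOp P) := fun k => by
  rw [coeff_parityOp]
  exact S.smul_mem (hS.parity_mem _ (hP k)) _

theorem CoeffIn.pow (hS : IsStable S) {P : SPDO K A} (hP : CoeffIn S P) (n : ℕ) :
    CoeffIn S (P ^ n) := by
  induction n with
  | zero => rw [pow_zero]; exact coeffIn_Dn 0
  | succ n ih => rw [pow_succ]; exact ih.mul hS hP

end Stable

section Roots

variable {K A : Type*} [Field K] [Ring A] [Algebra K A] [SuperDifferentialAlgebra K A]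

/-- Moving x to the left past one monic factor of order d costs σ^d, past two costs nothing. With X
= P - Q this is the leading term of P³ - Q³. -/
theorem leading_cubic {d N : ℤ} {P Q X : SPDO K A} (hP : OrdLE d P) (hP1 : coeff P d = 1)
    (hQ : OrdLE d Q) (hQ1 : coeff Q d = 1) (hX : OrdLE N X) :
    coeff (P * (P * X) + P * (X * Q) + X * (Q * Q)) (d + (d + N)) =
      coeff X N + sg K d (coeff X N) + coeff X N := by
  have e1 : d + (d + N) = d + (N + d) := by ring
  have e2 : d + (d + N) = N + (d + d) := by ring
  have h1 := leading_mul hP (hP.mul hX)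
  have h2 := leading_mul hP (hX.mul hQ)
  have h3 := leading_mul hX (hQ.mul hQ)
  rw [leading_mul hP hX, hP1, one_mul, one_mul] at h1
  rw [leading_mul hX hQ, hP1, hQ1, one_mul, sg_one_right, mul_one, ← e1] at h2
  rw [leading_mul hQ hQ, hQ1, sg_one_right, one_mul, sg_one_right, mul_one, ← e2] at h3
  rw [coeff_add, coeff_add, h1, h2, h3, sg_sg, sg_of_even (Even.add_self d)]

theorem ordLE_cubic {d N : ℤ} {P Q X : SPDO K A} (hP : OrdLE d P)
    (hQ : OrdLE d Q) (hX : OrdLE N X) :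
    OrdLE (d + (d + N)) (P * (P * X) + P * (X * Q) + X * (Q * Q)) :=
  ((hP.mul (hP.mul hX)).add ((hP.mul (hX.mul hQ)).mono (by omega))).add
    ((hX.mul (hQ.mul hQ)).mono (by omega))

theorem cube_sub_cube (P Q : SPDO K A) :
    P ^ 3 - Q ^ 3 = P * (P * (P - Q)) + P * ((P - Q) * Q) + (P - Q) * (Q * Q) := by
  noncomm_ring

variable [CharZero K]

/-- The operator 2 + σ has eigenvalues 3 and 1. For a square root of odd order the analogous 1 + σ
would not be injective. -/
theorem eq_zero_of_add_sg {d : ℤ} {x : A} (h : x + sg K d x + x = 0) : x = 0 := by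
  have h3 : (3 : K) • x = 0 := by
    by_cases hd : Even d
    · rw [sg_of_even hd] at h
      rw [← h]; module
    · rw [sg_of_odd hd] at h
      have h' := congrArg (parity K) h
      rw [map_add, map_add, parity_parity, map_zero] at h'
      have : (3 : K) • x = (2 : K) • (x + parity K x + x) - (parity K x + x + parity K x) := by
        module
      rw [this, h, h']; simp
  simpa using h3

/-- Infinitesimal uniqueness: the differential of P ↦ P³ has no kernel. It carries an evolution
equation from Λ³ to Λ. -/
theorem cubic_eq_zero {d : ℤ} {P X : SPDO K A} (hP : OrdLE d P) (hP1 : coeff P d = 1)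
    (h : P * (P * X) + P * (X * P) + X * (P * P) = 0) : X = 0 := by
  refine eq_zero_of_forall_leading fun N hN => eq_zero_of_add_sg (d := d) (K := K) ?_
  rw [← leading_cubic hP hP1 hP hP1 hN, h, coeff_zero]

/-- The quantitative form of uniqueness: it certifies an explicit truncation of Λ from its
approximate cube. -/
theorem ordLE_sub_of_cube {d r : ℤ} {P Q : SPDO K A} (hP : OrdLE d P) (hP1 : coeff P d = 1)
    (hQ : OrdLE d Q) (hQ1 : coeff Q d = 1) (h : OrdLE (d + (d + r)) (P ^ 3 - Q ^ 3)) :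
    OrdLE r (P - Q) := by
  refine ordLE_of_forall_leading r fun N hr hN => eq_zero_of_add_sg (d := d) (K := K) ?_
  rw [← leading_cubic hP hP1 hQ hQ1 hN, ← cube_sub_cube, h _ (by omega)]

theorem cube_injective {d : ℤ} {P Q : SPDO K A} (hP : OrdLE d P) (hP1 : coeff P d = 1)
    (hQ : OrdLE d Q) (hQ1 : coeff Q d = 1) (h : P ^ 3 = Q ^ 3) : P = Q := by
  rw [← sub_eq_zero]
  refine eq_zero_of_forall_ordLE fun r => ordLE_sub_of_cube hP hP1 hQ hQ1 ?_
  rw [h, sub_self]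
  exact OrdLE.zero _

/-- The correction of an approximate cube root `P = 𝒟 + …` of `R` at the order `-j`. -/
def rootCorrection (R P : SPDO K A) (j : ℕ) : A :=
  (3 : K)⁻¹ • ((2 : K) • coeff (R - P ^ 3) (2 - j) - parity K (coeff (R - P ^ 3) (2 - j)))

/-- Successive approximations of the cube root of `R`. -/
def rootApprox (R : SPDO K A) : ℕ → SPDO K A
  | 0 => Dn K A 1
  | j + 1 => rootApprox R j + monomial K (-j) (rootCorrection R (rootApprox R j) j)

theorem ordLE_rootApprox (R : SPDO K A) (j : ℕ) : OrdLE 1 (rootApprox R j) := by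
  induction j with
  | zero => exact ordLE_monomial 1 1
  | succ j ih => exact ih.add ((ordLE_monomial _ _).mono (by omega))

theorem coeff_rootApprox_one (R : SPDO K A) (j : ℕ) : coeff (rootApprox R j) 1 = 1 := by
  induction j with
  | zero => simp [rootApprox, Dn, coeff_monomial]
  | succ j ih =>
    rw [rootApprox, coeff_add, ih, coeff_monomial, if_neg (by omega), add_zero]

theorem coeffIn_rootApprox {S : Subalgebra K A} (hS : IsStable S) {R : SPDO K A}
    (hR : CoeffIn S R) (j : ℕ) : CoeffIn S (rootApprox R j) := by
  induction j with
  | zero => exact coeffIn_Dn 1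
  | succ j ih =>
    have h := hR.sub (ih.pow hS 3)
    exact ih.add (coeffIn_monomial _ (S.smul_mem (sub_mem (S.smul_mem (h _) _)
      (hS.parity_mem _ (h _))) _))

theorem ordLE_sub_rootApprox_cube {R : SPDO K A} (hR : OrdLE 2 (R - Dn K A 1 ^ 3)) (j : ℕ) :
    OrdLE (2 - j) (R - rootApprox R j ^ 3) := by
  induction j with
  | zero => simpa [rootApprox] using hR
  | succ j ih =>
    set P := rootApprox R (j + 1) with hP
    set Q := rootApprox R j with hQ
    have hX : P - Q = monomial K (-j) (rootCorrection R Q j) := by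
      rw [hP, rootApprox, ← hQ, add_sub_cancel_left]
    have hXo : OrdLE (-j) (P - Q) := hX ▸ ordLE_monomial _ _
    have e : R - P ^ 3 = (R - Q ^ 3) - (P ^ 3 - Q ^ 3) := by abel
    have e2 : (1 : ℤ) + (1 + -j) = 2 - j := by ring
    have h1 := ordLE_cubic (ordLE_rootApprox R (j + 1)) (ordLE_rootApprox R j) hXo
    have h2 := leading_cubic (ordLE_rootApprox R (j + 1)) (coeff_rootApprox_one R _)
      (ordLE_rootApprox R j) (coeff_rootApprox_one R _) hXo
    rw [← hP, ← hQ, ← cube_sub_cube, e2] at h1 h2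
    -- The correction x = (2y - σy)/3 solves 2x + σx = y, so it removes the leading term y of the
    -- defect.
    have h3 := (ih.sub h1).of_leading (by
      rw [coeff_sub, h2, hX, coeff_monomial, if_pos rfl, sg_of_odd (by decide), rootCorrection]
      generalize coeff (R - Q ^ 3) (2 - (j : ℤ)) = y
      rw [map_smul, map_sub, map_smul, parity_parity]
      match_scalars <;> norm_num)
    rw [e]
    exact h3.mono (by push_cast; omega)

theorem exists_cube_root {S : Subalgebra K A} (hS : IsStable S) {R : SPDO K A}
    (hR : OrdLE 2 (R - Dn K A 1 ^ 3)) (hRS : CoeffIn S R) :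
    ∃ P : SPDO K A, OrdLE 1 P ∧ coeff P 1 = 1 ∧ P ^ 3 = R ∧ CoeffIn S P := by
  -- Passing from stage j to stage j + 1 changes only the order -j, so the coefficient of 𝒟^k is
  -- final from stage 1 - k on.
  let P : SPDO K A := ⟨fun k => coeff (rootApprox R (1 - k).toNat) k, 1, fun k hk =>
    ordLE_rootApprox R _ k hk⟩
  have hP : ∀ k, coeff P k = coeff (rootApprox R (1 - k).toNat) k := fun _ => rfl
  have h1 : OrdLE 1 P := fun k hk => ordLE_rootApprox R _ k hk
  have h2 : coeff P 1 = 1 := (hP 1).trans (coeff_rootApprox_one R _)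
  have h3 : ∀ j : ℕ, OrdLE (-j) (P - rootApprox R j) := by
    intro j k hk
    rw [coeff_sub, hP, sub_eq_zero]
    have hj : (1 - k).toNat ≤ j := by omega
    induction j, hj using Nat.le_induction with
    | base => rfl
    | succ j hj ih =>
      rw [rootApprox, coeff_add, coeff_monomial, if_neg (by omega), add_zero]
      exact ih (by omega)
  refine ⟨P, h1, h2, ?_, fun k => coeffIn_rootApprox hS hRS _ k⟩
  rw [← sub_eq_zero]
  refine eq_zero_of_forall_ordLE fun r => ?_
  have h4 := ordLE_cubic h1 (ordLE_rootApprox R (2 - r).toNat) (h3 (2 - r).toNat)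
  rw [← cube_sub_cube] at h4
  have h5 := ordLE_sub_rootApprox_cube hR (2 - r).toNat
  have e : P ^ 3 - R = (P ^ 3 - rootApprox R (2 - r).toNat ^ 3) -
    (R - rootApprox R (2 - r).toNat ^ 3) := by abel
  rw [e]
  exact (h4.mono (by omega)).sub (h5.mono (by omega))

end Roots

end SPDO

section LaxRoot

open SPDO

attribute [local instance] SPDO.instRing

variable {K A : Type*} [Field K] [Ring A] [Algebra K A] [SuperDifferentialAlgebra K A]

theorem parity_iterate_D {φ : A} (hφ : IsOdd K φ) (k : ℕ) :
    parity K ((⇑(D K : A →ₗ[K] A))^[k] φ) = (-1 : K) ^ (k + 1) • (⇑(D K : A →ₗ[K] A))^[k] φ := by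
  rw [← Module.End.coe_pow, parity_D_pow, hφ, map_neg, pow_succ]
  rcases Nat.even_or_odd k with h | h <;> simp [h.neg_one_pow]

theorem isStable_diffPoly {φ : A} (hφ : IsOdd K φ) : IsStable (diffPoly K φ) := by
  have h1 : ∀ k, (⇑(D K : A →ₗ[K] A))^[k] φ ∈ diffPoly K φ := fun k =>
    Algebra.subset_adjoin ⟨k, rfl⟩
  have h2 : ∀ x ∈ diffPoly K φ, parity K x ∈ diffPoly K φ := by
    intro x hx
    induction hx using Algebra.adjoin_induction with
    | mem x hx =>
      obtain ⟨k, rfl⟩ := hx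
      simp only [parity_iterate_D hφ]
      exact Subalgebra.smul_mem _ (h1 k) _
    | algebraMap r => rw [AlgHom.commutes]; exact Subalgebra.algebraMap_mem _ r
    | add x y _ _ hx hy => rw [map_add]; exact add_mem hx hy
    | mul x y _ _ hx hy => rw [map_mul]; exact mul_mem hx hy
  refine ⟨h2, fun x hx => ?_⟩
  induction hx using Algebra.adjoin_induction with
  | mem x hx =>
    obtain ⟨k, rfl⟩ := hx
    have := h1 (k + 1)
    rwa [Function.iterate_succ_apply'] at this
  | algebraMap r => rw [Algebra.algebraMap_eq_smul_one, map_smul, D_one, smul_zero]; exact zero_mem _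
  | add x y _ _ hx hy => rw [map_add]; exact add_mem hx hy
  | mul x y hx' hy' hx hy =>
    rw [D_mul]
    exact add_mem (mul_mem hx hy') (mul_mem (h2 _ hx') hy)

theorem self_mem_diffPoly (φ : A) : φ ∈ diffPoly K φ := Algebra.subset_adjoin ⟨0, rfl⟩

theorem Dn_mul_Dn (n m : ℤ) : Dn K A n * Dn K A m = Dn K A (n + m) := by
  have h1 : ∀ m : ℤ, Dn K A 1 * Dn K A m = Dn K A (1 + m) := fun m => by
    rw [← mul_one (Dn K A m), D_mul_Dn_mul, mul_one, add_comm]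
  induction n using Int.induction_on with
  | zero => rw [zero_add]; exact one_mul _
  | succ n ih => rw [← mul_one (Dn K A (n + 1)), ← D_mul_Dn_mul, mul_one, mul_assoc, ih, h1]; congr 1; ring
  | pred n ih =>
    apply D_mul_cancel
    rw [← mul_assoc, h1, h1, show (1 : ℤ) + (-n - 1) = -n by ring, ih]
    congr 1; ring

theorem Dn_pow (n : ℤ) (m : ℕ) : Dn K A n ^ m = Dn K A (m * n) := by
  induction m with
  | zero => simp; rfl
  | succ m ih => rw [pow_succ, ih, Dn_mul_Dn]; congr 1; push_cast; ring

theorem laxFactor_eq (φ : A) : laxFactor K φ = Dn K A 3 + monomial K 0 φ := rfl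

theorem parityOp_laxFactor {φ : A} (hφ : IsOdd K φ) :
    parityOp (laxFactor K φ) = -laxFactor K φ := by
  refine ext_coeff fun k => ?_
  rw [coeff_parityOp, laxFactor, coeff_neg, coeff_add, coeff_monomial, coeff_monomial]
  by_cases h3 : k = 3
  · subst h3; simp [Odd.neg_one_zpow (show Odd (3 : ℤ) by decide)]
  · by_cases h0 : k = 0
    · subst h0; simpa [IsOdd] using hφ
    · simp [h3, h0]

variable [CharZero K] {φ : A} {Λ : SPDO K A}

theorem IsLaxRoot.ordLE (h : IsLaxRoot K φ Λ) : OrdLE 1 Λ := h.monic.2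

theorem exists_isLaxRoot (hφ : IsOdd K φ) :
    ∃ Λ : SPDO K A, IsLaxRoot K φ Λ ∧ CoeffIn (diffPoly K φ) Λ := by
  obtain ⟨Λ, h1, h2, h3, h4⟩ := exists_cube_root (isStable_diffPoly hφ) (R := laxFactor K φ)
    (by
      rw [Dn_pow, laxFactor_eq]
      norm_num
      exact (ordLE_monomial 0 φ).mono (by norm_num))
    ((coeffIn_Dn 3).add (coeffIn_monomial 0 (self_mem_diffPoly φ)))
  refine ⟨Λ, ⟨?_, ⟨h2, h1⟩, h3⟩, h4⟩
  -- Since 𝒟³ + φ is odd, the negative of the parity image of Λ is another monic cube root of it.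
  have h5 : -parityOp Λ = Λ := by
    refine cube_injective (d := 1) ?_ ?_ h1 h2 ?_
    · intro k hk
      rw [coeff_neg, coeff_parityOp, h1 k hk]; simp
    · rw [coeff_neg, coeff_parityOp, h2]; simp
    · have h6 : parityOp (Λ ^ 3) = parityOp Λ ^ 3 := by
        simp only [pow_succ, pow_zero, parityOp_mul, parityOp_one]
      rw [Odd.neg_pow (by decide), ← h6, h3, parityOp_laxFactor hφ, neg_neg]
  exact eq_neg_of_add_eq_zero_right (by nth_rewrite 1 [← h5]; exact neg_add_cancel _)

theorem IsLaxRoot.unique {Λ' : SPDO K A} (h : IsLaxRoot K φ Λ) (h' : IsLaxRoot K φ Λ') :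
    Λ' = Λ :=
  cube_injective h'.ordLE h'.monic.1 h.ordLE h.monic.1 (h'.cube.trans h.cube.symm)

theorem IsLaxRoot.coeffIn (hφ : IsOdd K φ) (h : IsLaxRoot K φ Λ) : CoeffIn (diffPoly K φ) Λ := by
  obtain ⟨Λ', h1, h2⟩ := exists_isLaxRoot hφ
  rwa [h.unique h1] at h2

/-- Restates the field with the ring structure in scope, so that lemmas on ring powers apply. -/
theorem IsLaxRoot.cube' (h : IsLaxRoot K φ Λ) : Λ ^ 3 = laxFactor K φ := h.cube

theorem IsLaxRoot.pow_six (h : IsLaxRoot K φ Λ) : Λ ^ 6 = laxOperator K φ := by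
  rw [show 6 = 3 + 3 from rfl, pow_add, h.cube', laxOperator]

theorem IsLaxRoot.parityOp_pow (h : IsLaxRoot K φ Λ) (n : ℕ) :
    parityOp (Λ ^ n) = (-1 : ℤ) ^ n • Λ ^ n :=
  SPDO.parityOp_pow (by rw [h.odd, neg_smul, one_smul]) n

theorem ordLE_pow {N : ℤ} {P : SPDO K A} (h : OrdLE N P) (h1 : coeff P N = 1) (n : ℕ) :
    OrdLE (n * N) (P ^ n) ∧ coeff (P ^ n) (n * N) = 1 := by
  induction n with
  | zero =>
    rw [pow_zero]
    refine ⟨?_, ?_⟩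
    · rw [Nat.cast_zero, zero_mul]
      exact ordLE_monomial (K := K) 0 (1 : A)
    · change coeff (monomial K 0 1) _ = _; simp [coeff_monomial]
  | succ n ih =>
    rw [pow_succ, show ((n + 1 : ℕ) : ℤ) * N = n * N + N by push_cast; ring]
    exact ⟨ih.1.mul h, by rw [leading_mul ih.1 h, ih.2, h1, sg_one_right, one_mul]⟩

theorem IsLaxRoot.ordLE_pow (h : IsLaxRoot K φ Λ) (n : ℕ) :
    OrdLE n (Λ ^ n) ∧ coeff (Λ ^ n) n = 1 := by
  simpa using SSK.ordLE_pow h.ordLE h.monic.1 n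

theorem IsLaxRoot.cube_root_unique (h : IsLaxRoot K φ Λ) {M : SPDO K A}
    (hM : IsMonicOfOrder 2 M) (h3 : M ^ 3 = laxOperator K φ) : M = Λ ^ 2 :=
  cube_injective (d := 2) hM.2 hM.1 (h.ordLE_pow 2).1 (h.ordLE_pow 2).2
    (by rw [h3, ← pow_mul, h.pow_six])

/-- T and the commutator with B are both derivations of the operator ring. They agree on Λ³, so
their difference X at Λ satisfies Λ²X + ΛXΛ + XΛ² = 0 and vanishes; then they agree on all powers.
-/
theorem mapCoeff_pow_eq {T : A →ₗ[K] A} (hT : ∀ f g : A, T (f * g) = T f * g + f * T g)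
    (hσ : ∀ f : A, T (parity K f) = parity K (T f)) (hD : ∀ f : A, T (D K f) = D K (T f))
    (h : IsLaxRoot K φ Λ) {B : SPDO K A}
    (hB : monomial K 0 (T φ) = B * laxFactor K φ - laxFactor K φ * B) (n : ℕ) :
    mapCoeff T (Λ ^ n) = B * Λ ^ n - Λ ^ n * B := by
  have h1 : T 1 = 0 := by simpa using hT 1 1
  have hm := mapCoeff_mul hT hσ hD (K := K)
  have hL : mapCoeff T (Λ ^ 3) = monomial K 0 (T φ) := by
    rw [h.cube']
    refine ext_coeff fun k => ?_
    rw [coeff_mapCoeff, laxFactor, coeff_add, map_add]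
    simp only [coeff_monomial]
    split_ifs <;> simp [h1]
  have key : mapCoeff T Λ - (B * Λ - Λ * B) = 0 := by
    refine cubic_eq_zero h.ordLE h.monic.1 ?_
    have h3 : mapCoeff T (Λ ^ 3) = Λ * (Λ * mapCoeff T Λ) + Λ * (mapCoeff T Λ * Λ) +
        mapCoeff T Λ * (Λ * Λ) := by
      rw [show Λ ^ 3 = Λ * (Λ * Λ) by noncomm_ring, hm, hm]
      noncomm_ring
    rw [hL, hB, ← h.cube'] at h3
    have : Λ * (Λ * (mapCoeff T Λ - (B * Λ - Λ * B))) +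
        Λ * ((mapCoeff T Λ - (B * Λ - Λ * B)) * Λ) +
        (mapCoeff T Λ - (B * Λ - Λ * B)) * (Λ * Λ) =
        Λ * (Λ * mapCoeff T Λ) + Λ * (mapCoeff T Λ * Λ) + mapCoeff T Λ * (Λ * Λ) -
        (B * Λ ^ 3 - Λ ^ 3 * B) := by noncomm_ring
    rw [this, ← h3, sub_self]
  induction n with
  | zero => rw [pow_zero, mapCoeff_one hT, mul_one, one_mul, sub_self]
  | succ n ih => rw [pow_succ, hm, ih, sub_eq_zero.mp key]; noncomm_ring

end LaxRoot

end SSK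

end

/-! ### The super residue as a trace modulo exact densities. -/

noncomputable section

namespace SSK

namespace SPDO

attribute [local instance] SPDO.instRing

variable {K A : Type*} [Field K] [Ring A] [Algebra K A] [SuperDifferentialAlgebra K A]

theorem coeff_mul_Dn (Q : SPDO K A) (m k : ℤ) : coeff (Q * Dn K A m) k = coeff Q (k - m) := by
  obtain ⟨N, hN⟩ := exists_ordLE Q
  rw [coeff_mul_of_ordLE hN (show OrdLE m (Dn K A m) from ordLE_monomial m 1) k (min (k - m) N)
    ((N + m - k).toNat + 1) (by simp) (by push_cast; omega)]
  rw [Finset.sum_eq_single (k - m)]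
  · rw [Finset.sum_range_succ', Finset.sum_eq_zero]
    · simp [leib_zero_right, Dn, coeff_monomial]
    · intro i _
      rw [Dn, coeff_monomial, if_neg (by push_cast; omega), map_zero, mul_zero]
  · intro n _ hn
    refine Finset.sum_eq_zero fun i _ => ?_
    rw [Dn, coeff_monomial]
    split_ifs with h
    · obtain ⟨j, rfl⟩ : ∃ j, i = j + 1 := ⟨i - 1, by omega⟩
      rw [leib_one_right, mul_zero]
    · simp
  · intro h
    rw [hN (k - m) (by simp at h; omega)]
    simp

theorem superChoose_eq_zero_of_lt {n i : ℕ} (h : n < i) : superChoose n i = 0 := by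
  unfold superChoose
  split_ifs with h'
  · rfl
  · have e : ((n : ℤ) / 2) = ((n / 2 : ℕ) : ℤ) := by simp
    rw [e, Ring.choose_natCast, Nat.choose_eq_zero_of_lt, Nat.cast_zero]
    rw [not_and_or, Nat.not_odd_iff_even, Int.even_coe_nat, Nat.even_iff, Nat.even_iff] at h'
    omega

/-- A term q𝒟^n with n ≥ 0 yields no negative order when multiplied by a function, and n < -1 only
lowers the order, so n = -1 alone contributes. -/
theorem sres_mul_monomial_zero (Q : SPDO K A) (a : A) :
    sres (Q * monomial K 0 a) = coeff Q (-1) * parity K a := by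
  obtain ⟨N, hN⟩ := exists_ordLE Q
  rw [sres, coeff_mul_of_ordLE hN (ordLE_monomial 0 a) (-1) (min (-1) N)
    ((N + 0 - (-1)).toNat + 1) (by simp) (by push_cast; omega)]
  rw [Finset.sum_eq_single (-1)]
  · rw [Finset.sum_range_succ', Finset.sum_eq_zero]
    · rw [leib_zero_right, sg_of_odd (by decide), coeff_monomial, if_pos (by simp), zero_add]
    · intro i _
      rw [coeff_monomial, if_neg (by push_cast; omega), map_zero, mul_zero]
  · intro n _ hn
    refine Finset.sum_eq_zero fun i _ => ?_
    rw [coeff_monomial]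
    split_ifs with h
    · obtain ⟨m, rfl⟩ : ∃ m : ℕ, n = m := ⟨n.toNat, by omega⟩
      rw [leib_apply, superChoose_eq_zero_of_lt (by omega), zero_smul, mul_zero]
    · simp
  · intro h
    rw [hN (-1) (by simp at h; omega)]
    simp

/-- The iterated parity automorphism. -/
def parityPow (j : ℕ) (Q : SPDO K A) : SPDO K A := if Even j then Q else parityOp Q

theorem parityPow_of_even {j : ℕ} (h : Even j) (Q : SPDO K A) : parityPow j Q = Q := if_pos h

theorem parityPow_of_odd {j : ℕ} (h : ¬ Even j) (Q : SPDO K A) : parityPow j Q = parityOp Q :=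
  if_neg h

theorem parityPow_mul (j : ℕ) (P Q : SPDO K A) :
    parityPow j (P * Q) = parityPow j P * parityPow j Q := by
  by_cases h : Even j
  · simp only [parityPow_of_even h]
  · simp only [parityPow_of_odd h, parityOp_mul]

theorem parityPow_parityPow (i j : ℕ) (Q : SPDO K A) :
    parityPow i (parityPow j Q) = parityPow (i + j) Q := by
  by_cases h : Even i <;> by_cases h' : Even j
  · rw [parityPow_of_even h, parityPow_of_even h', parityPow_of_even (h.add h')]
  · rw [parityPow_of_even h, parityPow_of_odd h', parityPow_of_odd (by simp [Nat.even_add, h, h'])]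
  · rw [parityPow_of_odd h, parityPow_of_even h', parityPow_of_odd (by simp [Nat.even_add, h, h'])]
  · rw [parityPow_of_odd h, parityPow_of_odd h', parityOp_parityOp,
      parityPow_of_even (by simp [Nat.even_add, h, h'])]

theorem parityPow_of_homogeneous {j : ℕ} {P : SPDO K A} (h : parityOp P = (-1 : ℤ) ^ j • P)
    (i : ℕ) : parityPow i P = (-1 : ℤ) ^ (i * j) • P := by
  by_cases hi : Even i
  · rw [parityPow_of_even hi, (hi.mul_right j).neg_one_pow, one_smul]
  · rw [parityPow_of_odd hi, h, pow_mul, (Nat.not_even_iff_odd.mp hi).neg_one_pow]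

theorem CoeffIn.parityPow {S : Subalgebra K A} (hS : IsStable S) (j : ℕ) {P : SPDO K A}
    (hP : CoeffIn S P) : CoeffIn S (parityPow j P) := by
  by_cases h : Even j
  · rwa [parityPow_of_even h]
  · rw [parityPow_of_odd h]; exact hP.parityOp hS

theorem OrdLE.parityPow (j : ℕ) {N : ℤ} {P : SPDO K A} (hP : OrdLE N P) :
    OrdLE N (parityPow j P) := by
  by_cases h : Even j
  · rwa [parityPow_of_even h]
  · rw [parityPow_of_odd h]
    intro k hk
    rw [coeff_parityOp, hP k hk, map_zero, smul_zero]

/-- The super derivatives of elements of `S`. -/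
def exactIn (S : Subalgebra K A) : Submodule K A := (Subalgebra.toSubmodule S).map (D K)

/-- The super residue of the supercommutator of `P`, of parity `j`, with any operator over `S` is
exact. -/
def TraceComm (S : Subalgebra K A) (j : ℕ) (P : SPDO K A) : Prop :=
  ∀ Q, CoeffIn S Q → sres (P * Q - parityPow j Q * P) ∈ exactIn S

variable {S : Subalgebra K A}

theorem sres_add (P Q : SPDO K A) : sres (P + Q) = sres P + sres Q := rfl

theorem sres_zsmul (m : ℤ) (P : SPDO K A) : sres (m • P) = m • sres P :=
  map_zsmul (coeffHom (K := K) (-1)) m P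

theorem TraceComm.congr {i j : ℕ} {P : SPDO K A} (h : TraceComm S i P) (hij : Even i ↔ Even j) :
    TraceComm S j P := fun Q hQ => by
  have := h Q hQ
  unfold parityPow at this ⊢
  simpa only [hij] using this

/-- [PP', Q] = [P, P'Q] ± [P', QP] up to parity twists of Q. So the trace property need only be
checked for functions, 𝒟 and 𝒟^{-1}. -/
theorem TraceComm.mul (hS : IsStable S) {i j : ℕ} {P P' : SPDO K A} (h : TraceComm S i P)
    (h' : TraceComm S j P') (hP : CoeffIn S P) (hP' : CoeffIn S P')
    (hi : parityOp P = (-1 : ℤ) ^ i • P) (hj : parityOp P' = (-1 : ℤ) ^ j • P') :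
    TraceComm S (i + j) (P * P') := fun Q hQ => by
  have h1 := h (P' * Q) (hP'.mul hS hQ)
  have h2 := h' (parityPow i Q * P) ((hQ.parityPow hS i).mul hS hP)
  rw [parityPow_mul, parityPow_of_homogeneous hj] at h1
  rw [parityPow_mul, parityPow_of_homogeneous hi, parityPow_parityPow] at h2
  have h3 := add_mem h1 (zsmul_mem h2 ((-1 : ℤ) ^ (i * j)))
  rw [← sres_zsmul, ← sres_add] at h3
  convert h3 using 2
  rw [smul_sub, mul_smul_comm, smul_mul_assoc, smul_mul_assoc, smul_mul_assoc, mul_comm j i,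
    smul_smul, ← mul_pow, add_comm j i]
  simp only [mul_assoc, mul_neg, mul_one, neg_neg, one_pow, one_smul]
  abel

variable [CharZero K]

theorem odd_mul {a : A} (ha : parity K a = -a) (q : A) : a * q = parity K q * a := by
  have e : q = (2 : K)⁻¹ • (q + parity K q) + (2 : K)⁻¹ • (q - parity K q) := by
    match_scalars <;> norm_num
  have h0 : (q + parity K q) * a = a * (q + parity K q) :=
    SuperDifferentialAlgebra.even_comm (K := K) _ _ (by
      change parity K _ = _; rw [map_add, parity_parity, add_comm])
  have h1 : a * (q - parity K q) = -((q - parity K q) * a) :=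
    SuperDifferentialAlgebra.odd_anticomm (K := K) _ _ ha (by
      change parity K _ = _; rw [map_sub, parity_parity, neg_sub])
  have e' : parity K q = (2 : K)⁻¹ • (q + parity K q) - (2 : K)⁻¹ • (q - parity K q) := by
    match_scalars <;> norm_num
  rw [e', sub_mul, smul_mul_assoc, smul_mul_assoc, h0, sub_eq_add_neg, ← smul_neg, ← h1,
    ← mul_smul_comm, ← mul_smul_comm, ← mul_add, ← e]

theorem traceComm_monomial_zero {j : ℕ} {a : A} (ha : parity K a = (-1 : ℤ) ^ j • a) :
    TraceComm S j (monomial K 0 a) := fun Q _ => by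
  have : sres (monomial K 0 a * Q - parityPow j Q * monomial K 0 a) = 0 := by
    change coeff (monomial K 0 a * Q) (-1) - sres (parityPow j Q * monomial K 0 a) = 0
    rw [sres_mul_monomial_zero, coeff_monomial_zero_mul, ha]
    rcases Nat.even_or_odd j with h | h
    · rw [parityPow_of_even h, h.neg_one_pow, one_smul]
      rw [h.neg_one_pow, one_smul] at ha
      rw [SuperDifferentialAlgebra.even_comm (K := K) _ _ ha, sub_self]
    · rw [parityPow_of_odd (Nat.not_even_iff_odd.mpr h), h.neg_one_pow]
      rw [h.neg_one_pow, neg_smul, one_smul] at ha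
      rw [coeff_parityOp, odd_mul ha]
      simp
  rw [this]
  exact zero_mem _

theorem parityOp_Dn (n : ℤ) : parityOp (Dn K A n) = (-1 : ℤ) ^ n.natAbs • Dn K A n := by
  refine ext_coeff fun k => ?_
  have h1 : coeff ((-1 : ℤ) ^ n.natAbs • Dn K A n) k = (-1 : ℤ) ^ n.natAbs • coeff (Dn K A n) k :=
    map_zsmul (coeffHom (K := K) k) _ _
  rw [h1, coeff_parityOp, Dn, coeff_monomial]
  split_ifs with h
  · subst h
    rw [map_one]
    rcases Int.even_or_odd k with h | h
    · rw [h.neg_one_zpow, Even.neg_one_pow (Int.natAbs_even.mpr h), one_smul, one_smul]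
    · rw [h.neg_one_zpow, Odd.neg_one_pow (Int.natAbs_odd.mpr h)]; simp
  · simp

/-- The only source of exact terms: the residue of [𝒟, Q] is 𝒟 of the residue of Q, since the
contributions of order -2 cancel. -/
theorem traceComm_D : TraceComm S 1 (Dn K A 1) := fun Q hQ => by
  refine ⟨coeff Q (-1), hQ _, ?_⟩
  change _ = coeff (Dn K A 1 * Q) (-1) - coeff (parityPow 1 Q * Dn K A 1) (-1)
  rw [parityPow_of_odd (by decide), coeff_D_mul, coeff_mul_Dn, coeff_parityOp,
    Even.neg_one_zpow (by decide), one_smul, add_sub_cancel_right]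

/-- [𝒟^{-1}, Q] is minus the supercommutator of 𝒟 with 𝒟^{-1} σ(Q) 𝒟^{-1}. -/
theorem traceComm_D_inv (hS : IsStable S) : TraceComm S 1 (Dn K A (-1)) := fun Q hQ => by
  have h1 := traceComm_D (S := S) (Dn K A (-1) * parityOp Q * Dn K A (-1))
    (((coeffIn_Dn _).mul hS (hQ.parityOp hS)).mul hS (coeffIn_Dn _))
  have e1 : Dn K A 1 * Dn K A (-1) = 1 := Dn_mul_Dn 1 (-1)
  have e2 : Dn K A (-1) * Dn K A 1 = 1 := Dn_mul_Dn (-1) 1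
  rw [parityPow_of_odd (by decide), parityOp_mul, parityOp_mul, parityOp_Dn, parityOp_parityOp] at h1
  rw [parityPow_of_odd (by decide)]
  have h2 := neg_mem h1
  convert h2 using 1
  change _ = -coeff _ (-1)
  rw [← coeff_neg]
  change coeff _ _ = coeff _ _
  congr 1
  have e3 : ∀ X : SPDO K A, Dn K A 1 * (Dn K A (-1) * X) = X := fun X => by
    rw [← mul_assoc, e1, one_mul]
  simp [mul_assoc, e2, e3]

theorem traceComm_Dn (hS : IsStable S) (n : ℤ) : TraceComm S n.natAbs (Dn K A n) := by
  induction n using Int.induction_on with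
  | zero =>
    have : TraceComm S 0 (monomial K 0 (1 : A)) := traceComm_monomial_zero (by simp)
    exact this
  | succ n ih =>
    rw [← Dn_mul_Dn]
    refine (ih.mul hS traceComm_D (coeffIn_Dn _) (coeffIn_Dn _) (parityOp_Dn _)
      (parityOp_Dn 1)).congr ?_
    simp [Int.natAbs_even, parity_simps]
  | pred n ih =>
    rw [sub_eq_add_neg, ← Dn_mul_Dn]
    refine (ih.mul hS (traceComm_D_inv hS) (coeffIn_Dn _) (coeffIn_Dn _) (parityOp_Dn _)
      (parityOp_Dn (-1))).congr ?_
    simp [Int.natAbs_even, parity_simps]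

theorem traceComm_of_homogeneous (hS : IsStable S) {j : ℕ} {P : SPDO K A} (hP : CoeffIn S P)
    (hj : parityOp P = (-1 : ℤ) ^ j • P) : TraceComm S j P := by
  intro Q hQ
  obtain ⟨M, hM⟩ := exists_ordLE Q
  let F : SPDO K A →+ A ⧸ exactIn S :=
    { toFun := fun P => (exactIn S).mkQ (coeffHom (-1) (P * Q - parityPow j Q * P))
      map_zero' := by simp
      map_add' := fun P P' => by
        rw [← map_add, ← map_add]
        congr 2
        noncomm_ring }
  rw [← Submodule.Quotient.mk_eq_zero]
  -- Terms of P of order at most -2 - M cannot reach order -1 in either product, so P may be taken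
  -- as one term a𝒟^n.
  refine map_eq_zero F (-2 - M) ?_ P ?_
  · intro P hP
    change (exactIn S).mkQ (coeff (P * Q - parityPow j Q * P) (-1)) = 0
    rw [((hP.mul hM).mono (by omega : _ ≤ -2)).sub
      (((hM.parityPow j).mul hP).mono (by omega)) (-1) (by omega), map_zero]
  · intro n
    refine (Submodule.Quotient.mk_eq_zero _).mpr ?_
    have hc : coeff (parityOp P) n = (-1 : ℤ) ^ j • coeff P n := by
      rw [hj]; exact map_zsmul (coeffHom (K := K) n) _ _
    have hn : parity K (coeff P n) = (-1 : ℤ) ^ (j + n.natAbs) • coeff P n := by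
      rw [coeff_parityOp] at hc
      rcases Int.even_or_odd n with h | h
      · rw [h.neg_one_zpow, one_smul] at hc
        rw [hc, pow_add, Even.neg_one_pow (Int.natAbs_even.mpr h), mul_one]
      · rw [h.neg_one_zpow, neg_smul, one_smul, neg_eq_iff_eq_neg] at hc
        rw [hc, pow_add, Odd.neg_one_pow (Int.natAbs_odd.mpr h)]
        simp
    have e : monomial K n (coeff P n) = monomial K 0 (coeff P n) * Dn K A n := by
      rw [← mul_one (monomial K n _), monomial_mul, mul_one]
    have hp : parityOp (monomial K 0 (coeff P n)) =
        (-1 : ℤ) ^ (j + n.natAbs) • monomial K 0 (coeff P n) := by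
      refine ext_coeff fun k => ?_
      refine Eq.trans ?_ (map_zsmul (coeffHom (K := K) k) _ _).symm
      rw [coeff_parityOp, coeffHom_apply, coeff_monomial]
      split_ifs with h
      · subst h; rw [hn, zpow_zero, one_smul]
      · simp
    have key := (traceComm_monomial_zero hn).mul hS (traceComm_Dn hS n)
      (coeffIn_monomial 0 (hP n)) (coeffIn_Dn n) hp (parityOp_Dn n)
    rw [← e] at key
    exact key.congr (by simp [parity_simps, add_assoc]) Q hQ

end SPDO

open SPDO

section LaxRoot

attribute [local instance] SPDO.instRing

variable {K A : Type*} [Field K] [Ring A] [Algebra K A] [SuperDifferentialAlgebra K A] [CharZero K]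
  {φ : A} {Λ : SPDO K A}

theorem sres_comm_mem_exactDensities (hφ : IsOdd K φ) {j : ℕ} {P Q : SPDO K A}
    (hP : CoeffIn (diffPoly K φ) P) (hQ : CoeffIn (diffPoly K φ) Q)
    (hj : parityOp P = (-1 : ℤ) ^ j • P) :
    sres (P * Q - parityPow j Q * P) ∈ exactDensities K φ :=
  traceComm_of_homogeneous (isStable_diffPoly hφ) hP hj Q hQ

theorem IsLaxRoot.coeffIn_pow (hφ : IsOdd K φ) (h : IsLaxRoot K φ Λ) (n : ℕ) :
    CoeffIn (diffPoly K φ) (Λ ^ n) :=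
  (h.coeffIn hφ).pow (isStable_diffPoly hφ) n

/-- For even n > 0 the odd operators Λ and Λ^{n-1} have supercommutator 2Λ^n. -/
theorem IsLaxRoot.sres_mem_of_even (hφ : IsOdd K φ) (h : IsLaxRoot K φ Λ) {n : ℕ} (hn : Even n) :
    sres (Λ ^ n) ∈ exactDensities K φ := by
  rcases n with _ | n
  · rw [pow_zero]
    change coeff (monomial K 0 1) (-1) ∈ _
    rw [coeff_monomial, if_neg (by decide)]
    exact zero_mem _
  · have hn' : Odd n := by simpa [Nat.even_add_one] using hn
    have h1 := sres_comm_mem_exactDensities hφ (h.coeffIn hφ) (h.coeffIn_pow hφ n)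
      (j := 1) (by rw [h.odd]; simp)
    rw [parityPow_of_homogeneous (h.parityOp_pow n), one_mul, hn'.neg_one_pow, neg_smul, one_smul,
      neg_mul, sub_neg_eq_add, ← pow_succ, ← pow_succ', sres_add, ← two_smul K] at h1
    exact (Submodule.smul_mem_iff _ two_ne_zero).mp h1

theorem IsLaxRoot.isEven_sres_of_odd (h : IsLaxRoot K φ Λ) {n : ℕ} (hn : Odd n) :
    IsEven K (sres (Λ ^ n)) := by
  have h1 : coeff (parityOp (Λ ^ n)) (-1) = coeff ((-1 : ℤ) ^ n • Λ ^ n) (-1) := by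
    rw [h.parityOp_pow n]
  rw [coeff_parityOp, hn.neg_one_pow, neg_smul, one_smul, coeff_neg,
    Odd.neg_one_zpow (by decide), neg_smul, one_smul, neg_inj] at h1
  exact h1

theorem IsLaxRoot.isFermionic (hφ : IsOdd K φ) (h : IsLaxRoot K φ Λ) (n : ℕ) :
    IsFermionicFunctional K φ (superIntegral K φ (sres (Λ ^ n))) := by
  rcases Nat.even_or_odd n with hn | hn
  · refine ⟨0, zero_mem _, by simp [IsEven], ?_⟩
    rw [map_zero]
    exact ((Submodule.Quotient.mk_eq_zero _).mpr (h.sres_mem_of_even hφ hn)).symm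
  · exact ⟨_, h.coeffIn_pow hφ n (-1), h.isEven_sres_of_odd hn, rfl⟩

theorem superCommutator_of_even {P Q : SPDO K A} (hP : parityOp P = P) :
    superCommutator P Q = P * Q - Q * P := by
  have h1 : evenPart P = P := by
    rw [evenPart, hP, ← two_smul K, smul_smul, inv_mul_cancel₀ two_ne_zero, one_smul]
  have h2 : oddPart P = 0 := by rw [oddPart, hP, sub_self, smul_zero]
  rw [superCommutator, h1, h2, mul_zero, add_zero]

theorem parityOp_diffPart {P : SPDO K A} (hP : parityOp P = P) :
    parityOp (diffPart P) = diffPart P := by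
  refine ext_coeff fun k => ?_
  have h := congrArg (fun Q => coeff Q k) hP
  simp only [coeff_parityOp] at h
  rw [coeff_parityOp]
  change _ • parity K (if 0 ≤ k then coeff P k else 0) = if 0 ≤ k then coeff P k else 0
  split_ifs
  · exact h
  · simp

theorem coeffIn_diffPart {S : Subalgebra K A} {P : SPDO K A} (hP : CoeffIn S P) :
    CoeffIn S (diffPart P) := fun k => by
  change (if 0 ≤ k then coeff P k else 0) ∈ S
  split_ifs
  · exact hP k
  · exact zero_mem S

/-- Isolates as `hB` the only input specific to the equation: the Lax equation for the factor 𝒟³ +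
φ. -/
theorem lax_flow (hφ : IsOdd K φ) (h : IsLaxRoot K φ Λ) {T : A →ₗ[K] A}
    (hT : IsSSKFlow K φ T)
    (hB : monomial K 0 (T φ) = (9 : K) • diffPart (Λ ^ 10) * laxFactor K φ -
      laxFactor K φ * (9 : K) • diffPart (Λ ^ 10)) (n : ℕ) :
    mapCoeff T (Λ ^ n) = superCommutator ((9 : K) • diffPart (Λ ^ 10)) (Λ ^ n) ∧
      superIntegral K φ (T (sres (Λ ^ n))) = 0 := by
  have he : parityOp ((9 : K) • diffPart (Λ ^ 10)) = (9 : K) • diffPart (Λ ^ 10) := by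
    rw [parityOp_smul, parityOp_diffPart]
    rw [h.parityOp_pow, Even.neg_one_pow (by decide), one_smul]
  have h1 := mapCoeff_pow_eq hT.leibniz hT.comm_parity hT.comm_D h hB n
  refine ⟨by rw [h1, superCommutator_of_even he], ?_⟩
  have h2 := sres_comm_mem_exactDensities hφ
    ((coeffIn_diffPart (h.coeffIn_pow hφ 10)).smul 9) (h.coeffIn_pow hφ n)
    (j := 0) (by rw [he, pow_zero, one_smul])
  rw [parityPow_of_even (by decide), ← h1] at h2
  exact (Submodule.Quotient.mk_eq_zero _).mpr h2

end LaxRoot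

end SSK

end

noncomputable section

namespace SSK

/-! ### Exact computation with differential superpolynomials -/

namespace Jet

/-- A formal integral combination of words in the letters `𝒟^k φ`. -/
abbrev Poly := List (List ℕ × ℤ)

/-- The sign acquired in exchanging the letters `i` and `j`. -/
def swapSign (i j : ℕ) : ℤ := if i % 2 = 0 ∧ j % 2 = 0 then -1 else 1

/-- The parity sign of the letter `i`. -/
def letterSign (i : ℕ) : ℤ := if i % 2 = 0 then -1 else 1

/-- Insertion of a letter into a sorted word, with the resulting sign (zero if an odd letter is
repeated). -/
def insertLetter (i : ℕ) : List ℕ → ℤ × List ℕ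
  | [] => (1, [i])
  | j :: w =>
    if i < j then (1, i :: j :: w)
    else if i = j then (if i % 2 = 0 then 0 else 1, i :: j :: w)
    else (swapSign i j * (insertLetter i w).1, j :: (insertLetter i w).2)

/-- The sorted form of a word, with its sign. -/
def sortWord : List ℕ → ℤ × List ℕ
  | [] => (1, [])
  | i :: w => ((sortWord w).1 * (insertLetter i (sortWord w).2).1,
      (insertLetter i (sortWord w).2).2)

/-- Addition of a term, merging equal words. -/
def addTerm (w : List ℕ) (c : ℤ) : Poly → Poly
  | [] => [(w, c)]
  | (v, d) :: p => if w = v then (v, c + d) :: p else (v, d) :: addTerm w c p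

/-- The normal form. -/
def norm : Poly → Poly
  | [] => []
  | (w, c) :: p => addTerm (sortWord w).2 (c * (sortWord w).1) (norm p)

/-- All coefficients of the normal form vanish. -/
def isZero (p : Poly) : Bool := (norm p).all fun t => decide (t.2 = 0)

/-- Multiplication by an integer. -/
def scale (c : ℤ) (p : Poly) : Poly := p.map fun t => (t.1, c * t.2)

/-- The derivative of a word. -/
def derivWord : List ℕ → Poly
  | [] => []
  | i :: w => ((i + 1) :: w, 1) :: (derivWord w).map fun t => (i :: t.1, letterSign i * t.2)

/-- The super derivative. -/
def deriv : Poly → Poly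
  | [] => []
  | (w, c) :: p => scale c (derivWord w) ++ deriv p

/-- The parity sign of a word. -/
def wordSign : List ℕ → ℤ
  | [] => 1
  | i :: w => letterSign i * wordSign w

/-- The parity automorphism. -/
def par (p : Poly) : Poly := p.map fun t => (t.1, wordSign t.1 * t.2)

/-- The iterated super derivative. -/
def derivIter : ℕ → Poly → Poly
  | 0, p => p
  | i + 1, p => norm (deriv (derivIter i p))

/-- The product. -/
def mulPoly : Poly → Poly → Poly
  | [], _ => []
  | (w, c) :: p, q => q.map (fun t => (w ++ t.1, c * t.2)) ++ mulPoly p q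

/-- The binomial coefficient with an integral upper index. -/
def binom : ℤ → ℕ → ℤ
  | Int.ofNat h, j => Nat.choose h j
  | Int.negSucc h, j => (-1) ^ j * Nat.choose (h + j) j

/-- The super binomial coefficient. -/
def superBinom (n : ℤ) (i : ℕ) : ℤ := if n % 2 = 0 ∧ i % 2 = 1 then 0 else binom (n / 2) (i / 2)

/-- The coefficient of `𝒟^{n-i}` in `𝒟^n p`. -/
def leibPoly (n : ℤ) (i : ℕ) (p : Poly) : Poly :=
  scale (superBinom n i) (derivIter i (if (n - i) % 2 = 0 then p else par p))

/-- Operators with finitely many terms. -/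
abbrev Op := List (ℤ × Poly)

/-- The coefficient of `𝒟^k` in the product of a term with an operator. -/
def termMul (n : ℤ) (a : Poly) (k : ℤ) : Op → Poly
  | [] => []
  | (m, b) :: Q =>
    (if k ≤ n + m then mulPoly a (leibPoly n (n + m - k).toNat b) else []) ++ termMul n a k Q

/-- The coefficient of `𝒟^k` in a product of operators. -/
def opMul (k : ℤ) : Op → Op → Poly
  | [], _ => []
  | (n, a) :: P, Q => termMul n a k Q ++ opMul k P Q

/-- The coefficient of `𝒟^k`. -/
def opCoeff (k : ℤ) : Op → Poly
  | [] => []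
  | (n, a) :: P => (if k = n then a else []) ++ opCoeff k P

/-- The coefficients of `c R` in the orders `lo, …, lo + len - 1` are those of `P Q`. -/
def checkMul (P Q R : Op) (c lo : ℤ) (len : ℕ) : Bool :=
  (List.range len).all fun j =>
    isZero (opMul (lo + j) P Q ++ scale (-c) (opCoeff (lo + j) R))

/-- The coefficients of `R` in the orders `lo, …, lo + len - 1` are those of `P Q - Q P`. -/
def checkComm (P Q R : Op) (lo : ℤ) (len : ℕ) : Bool :=
  (List.range len).all fun j =>
    isZero (opMul (lo + j) P Q ++ scale (-1) (opMul (lo + j) Q P ++ opCoeff (lo + j) R))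

section Eval

open SPDO

attribute [local instance] SPDO.instRing

variable (K : Type*) {A : Type*} [Field K] [Ring A] [Algebra K A] [SuperDifferentialAlgebra K A]

/-- The value of the letter `k`. -/
def evalLetter (φ : A) (k : ℕ) : A := (⇑(D K : A →ₗ[K] A))^[k] φ

/-- The value of a word. -/
def evalWord (φ : A) (w : List ℕ) : A := (w.map (evalLetter K φ)).prod

/-- The value of a polynomial. -/
def eval (φ : A) (p : Poly) : A := (p.map fun t => t.2 • evalWord K φ t.1).sum

/-- The value of an operator. -/
def evalOp (φ : A) (P : Op) : SPDO K A := (P.map fun t => monomial K t.1 (eval K φ t.2)).sum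

variable {K} {φ : A}

@[simp] theorem eval_nil : eval K φ [] = 0 := rfl

@[simp] theorem eval_cons (w : List ℕ) (c : ℤ) (p : Poly) :
    eval K φ ((w, c) :: p) = c • evalWord K φ w + eval K φ p := by simp [eval]

@[simp] theorem evalWord_nil : evalWord K φ [] = 1 := rfl

@[simp] theorem evalWord_cons (i : ℕ) (w : List ℕ) :
    evalWord K φ (i :: w) = evalLetter K φ i * evalWord K φ w := by simp [evalWord]

theorem eval_append (p q : Poly) : eval K φ (p ++ q) = eval K φ p + eval K φ q := by
  simp [eval]

theorem eval_scale (c : ℤ) (p : Poly) : eval K φ (scale c p) = c • eval K φ p := by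
  induction p with
  | nil => simp [scale]
  | cons t p ih =>
    obtain ⟨w, d⟩ := t
    change eval K φ ((w, c * d) :: scale c p) = _
    rw [eval_cons, eval_cons, ih, smul_add, mul_smul]

theorem eval_addTerm (w : List ℕ) (c : ℤ) (p : Poly) :
    eval K φ (addTerm w c p) = c • evalWord K φ w + eval K φ p := by
  induction p with
  | nil => rfl
  | cons t p ih =>
    obtain ⟨v, d⟩ := t
    rw [addTerm]
    split_ifs with h
    · subst h; rw [eval_cons, eval_cons, add_smul, add_assoc]
    · rw [eval_cons, eval_cons, ih]; abel

theorem D_evalLetter (k : ℕ) : D K (evalLetter K φ k) = evalLetter K φ (k + 1) := by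
  rw [evalLetter, evalLetter, Function.iterate_succ_apply']

theorem parity_evalLetter (hφ : IsOdd K φ) (k : ℕ) :
    parity K (evalLetter K φ k) = letterSign k • evalLetter K φ k := by
  rw [evalLetter, parity_iterate_D hφ, letterSign, pow_succ]
  rcases Nat.even_or_odd k with h | h
  · simp [h.neg_one_pow, Nat.even_iff.mp h]
  · simp [h.neg_one_pow, Nat.odd_iff.mp h]

theorem eval_derivWord (hφ : IsOdd K φ) (w : List ℕ) :
    eval K φ (derivWord w) = D K (evalWord K φ w) := by
  induction w with
  | nil => simp [derivWord, D_one]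
  | cons i w ih =>
    have h : ∀ p : Poly, eval K φ (p.map fun t => (i :: t.1, letterSign i * t.2)) =
        letterSign i • (evalLetter K φ i * eval K φ p) := by
      intro p
      induction p with
      | nil => simp
      | cons t p ih =>
        obtain ⟨v, d⟩ := t
        rw [List.map_cons, eval_cons, ih, eval_cons, evalWord_cons, mul_add, smul_add, mul_smul,
          mul_smul_comm]
    rw [derivWord, eval_cons, h, ih, evalWord_cons, evalWord_cons, D_mul, D_evalLetter,
      parity_evalLetter hφ, one_smul, smul_mul_assoc]

theorem eval_deriv (hφ : IsOdd K φ) (p : Poly) : eval K φ (deriv p) = D K (eval K φ p) := by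
  induction p with
  | nil => simp [deriv]
  | cons t p ih =>
    obtain ⟨w, c⟩ := t
    rw [deriv, eval_append, eval_scale, eval_derivWord hφ, ih, eval_cons, map_add, map_zsmul]

theorem parity_evalWord (hφ : IsOdd K φ) (w : List ℕ) :
    parity K (evalWord K φ w) = wordSign w • evalWord K φ w := by
  induction w with
  | nil => simp [wordSign]
  | cons i w ih =>
    rw [evalWord_cons, map_mul, ih, parity_evalLetter hφ, wordSign, smul_mul_smul_comm]

theorem eval_par (hφ : IsOdd K φ) (p : Poly) : eval K φ (par p) = parity K (eval K φ p) := by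
  induction p with
  | nil => simp [par]
  | cons t p ih =>
    obtain ⟨w, c⟩ := t
    change eval K φ ((w, wordSign w * c) :: par p) = _
    rw [eval_cons, eval_cons, ih, map_add, map_zsmul, parity_evalWord hφ, mul_comm, mul_smul]

theorem eval_mulPoly (p q : Poly) : eval K φ (mulPoly p q) = eval K φ p * eval K φ q := by
  induction p with
  | nil => simp [mulPoly]
  | cons t p ih =>
    obtain ⟨w, c⟩ := t
    have h : ∀ q : Poly, eval K φ (q.map fun t => (w ++ t.1, c * t.2)) =
        c • (evalWord K φ w * eval K φ q) := by
      intro q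
      induction q with
      | nil => simp
      | cons t q ih =>
        obtain ⟨v, d⟩ := t
        rw [List.map_cons, eval_cons, ih, eval_cons, mul_add, smul_add, mul_smul, mul_smul_comm,
          evalWord, List.map_append, List.prod_append]
        rfl
    rw [mulPoly, eval_append, h, ih, eval_cons, add_mul, smul_mul_assoc]

variable [CharZero K]

theorem evalLetter_swap (hφ : IsOdd K φ) (i j : ℕ) :
    evalLetter K φ i * evalLetter K φ j = swapSign i j • (evalLetter K φ j * evalLetter K φ i) := by
  have hi := parity_evalLetter hφ i
  have hj := parity_evalLetter hφ j
  unfold letterSign at hi hj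
  unfold swapSign
  by_cases h : i % 2 = 0
  · rw [if_pos h, neg_smul, one_smul] at hi
    rw [odd_mul hi, hj]
    simp only [h, true_and, smul_mul_assoc]
  · rw [if_neg h, one_smul] at hi
    rw [if_neg (fun h' => h h'.1), one_smul,
      SuperDifferentialAlgebra.even_comm (K := K) _ _ hi]

theorem evalLetter_sq (hφ : IsOdd K φ) {i : ℕ} (hi : i % 2 = 0) :
    evalLetter K φ i * evalLetter K φ i = 0 := by
  have h := evalLetter_swap hφ i i
  rw [swapSign, if_pos ⟨hi, hi⟩, neg_smul, one_smul, eq_neg_iff_add_eq_zero, ← two_smul K] at h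
  simpa using h

theorem eval_insertLetter (hφ : IsOdd K φ) (i : ℕ) (w : List ℕ) :
    (insertLetter i w).1 • evalWord K φ (insertLetter i w).2 =
      evalLetter K φ i * evalWord K φ w := by
  induction w with
  | nil => simp [insertLetter]
  | cons j w ih =>
    rw [insertLetter]
    split_ifs with h1 h2 h3
    · simp
    · subst h2
      rw [zero_smul, evalWord_cons, ← mul_assoc, evalLetter_sq hφ h3, zero_mul]
    · simp
    · rw [evalWord_cons, evalWord_cons, ← mul_assoc, evalLetter_swap hφ i j, smul_mul_assoc,
        mul_assoc, ← ih, mul_smul, mul_smul_comm]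

theorem eval_sortWord (hφ : IsOdd K φ) (w : List ℕ) :
    (sortWord w).1 • evalWord K φ (sortWord w).2 = evalWord K φ w := by
  induction w with
  | nil => simp [sortWord]
  | cons i w ih =>
    rw [sortWord, mul_smul, eval_insertLetter hφ, evalWord_cons, ← mul_smul_comm, ih]

theorem eval_norm (hφ : IsOdd K φ) (p : Poly) : eval K φ (norm p) = eval K φ p := by
  induction p with
  | nil => rfl
  | cons t p ih =>
    obtain ⟨w, c⟩ := t
    rw [norm, eval_addTerm, ih, eval_cons, mul_smul, eval_sortWord hφ]

/-- Only soundness is needed: a vanishing normal form implies a vanishing value in every A.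
Uniqueness of normal forms plays no role. -/
theorem eval_eq_zero (hφ : IsOdd K φ) {p : Poly} (h : isZero p = true) : eval K φ p = 0 := by
  rw [← eval_norm hφ]
  unfold isZero at h
  generalize norm p = q at h
  induction q with
  | nil => rfl
  | cons t q ih =>
    obtain ⟨w, c⟩ := t
    rw [List.all_cons, Bool.and_eq_true] at h
    have hc : c = 0 := by simpa using h.1
    rw [eval_cons, ih h.2, hc, zero_smul, zero_add]

theorem eval_derivIter (hφ : IsOdd K φ) (i : ℕ) (p : Poly) :
    eval K φ (derivIter i p) = (D K ^ i : Module.End K A) (eval K φ p) := by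
  induction i with
  | zero => rfl
  | succ i ih => rw [derivIter, eval_norm hφ, eval_deriv hφ, ih, pow_succ', Module.End.mul_apply]

theorem superChoose_eq_superBinom (n : ℤ) (i : ℕ) : superChoose n i = superBinom n i := by
  have hb : ∀ (m : ℤ) (j : ℕ), Ring.choose m j = binom m j := by
    intro m j
    rcases m with h | h
    · exact Ring.choose_natCast h j
    · have e : Int.negSucc h = -((h + 1 : ℕ) : ℤ) := rfl
      have e2 : (((h + 1 : ℕ) : ℤ) + j - 1) = ((h + j : ℕ) : ℤ) := by push_cast; ring
      rw [binom, e, Ring.choose_neg, e2, Ring.choose_natCast]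
      rcases Nat.even_or_odd j with hj | hj
      · rw [Int.negOnePow_even j (by simpa using hj), hj.neg_one_pow]; simp
      · rw [Int.negOnePow_odd j (by simpa using hj), hj.neg_one_pow]; simp
  unfold superChoose superBinom
  simp only [hb, Int.even_iff, Nat.odd_iff]

theorem eval_leibPoly (hφ : IsOdd K φ) (n : ℤ) (i : ℕ) (p : Poly) :
    eval K φ (leibPoly n i p) = leib K n i (eval K φ p) := by
  rw [leibPoly, eval_scale, eval_derivIter hφ, leib_apply, superChoose_eq_superBinom]
  congr 2
  split_ifs with h
  · rw [sg_of_even (Int.even_iff.mpr h)]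
  · rw [sg_of_odd (fun h' => h (Int.even_iff.mp h')), eval_par hφ]

@[simp] theorem evalOp_nil : evalOp K φ [] = 0 := rfl

@[simp] theorem evalOp_cons (n : ℤ) (a : Poly) (P : Op) :
    evalOp K φ ((n, a) :: P) = monomial K n (eval K φ a) + evalOp K φ P := by simp [evalOp]

theorem coeff_monomial_mul_monomial (n m k : ℤ) (a b : A) :
    coeff (monomial K n a * monomial K m b) k =
      if k ≤ n + m then a * leib K n (n + m - k).toNat b else 0 := by
  split_ifs with h
  · rw [coeff_monomial_mul (ordLE_monomial m b) n a k ((n + m - k).toNat + 1) (by push_cast; omega),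
      Finset.sum_eq_single (n + m - k).toNat]
    · rw [coeff_monomial, if_pos (by omega)]
    · intro i _ hi
      rw [coeff_monomial, if_neg (by omega), map_zero]
    · simp
  · exact ((ordLE_monomial n a).mul (ordLE_monomial m b)) k (by omega)

theorem eval_termMul (hφ : IsOdd K φ) (n : ℤ) (a : Poly) (k : ℤ) (Q : Op) :
    eval K φ (termMul n a k Q) = coeff (monomial K n (eval K φ a) * evalOp K φ Q) k := by
  induction Q with
  | nil => simp [termMul]
  | cons t Q ih =>
    obtain ⟨m, b⟩ := t
    rw [termMul, eval_append, ih, evalOp_cons, mul_add, coeff_add, coeff_monomial_mul_monomial]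
    congr 1
    split_ifs
    · rw [eval_mulPoly, eval_leibPoly hφ]
    · rfl

theorem eval_opMul (hφ : IsOdd K φ) (k : ℤ) (P Q : Op) :
    eval K φ (opMul k P Q) = coeff (evalOp K φ P * evalOp K φ Q) k := by
  induction P with
  | nil => simp [opMul]
  | cons t P ih =>
    obtain ⟨n, a⟩ := t
    rw [opMul, eval_append, ih, evalOp_cons, add_mul, coeff_add, eval_termMul hφ]

theorem eval_opCoeff (k : ℤ) (P : Op) : eval K φ (opCoeff k P) = coeff (evalOp K φ P) k := by
  induction P with
  | nil => simp [opCoeff]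
  | cons t P ih =>
    obtain ⟨n, a⟩ := t
    rw [opCoeff, eval_append, ih, evalOp_cons, coeff_add, coeff_monomial]
    congr 1
    split_ifs <;> rfl

theorem coeff_mul_of_checkMul (hφ : IsOdd K φ) {P Q R : Op} {c lo : ℤ} {len : ℕ}
    (h : checkMul P Q R c lo len = true) {k : ℤ} (h1 : lo ≤ k) (h2 : k < lo + len) :
    coeff (evalOp K φ P * evalOp K φ Q) k = c • coeff (evalOp K φ R) k := by
  rw [checkMul, List.all_eq_true] at h
  have h3 := eval_eq_zero (K := K) hφ (h (k - lo).toNat (List.mem_range.mpr (by omega)))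
  rw [show lo + ((k - lo).toNat : ℤ) = k by omega, eval_append, eval_scale, eval_opMul hφ,
    eval_opCoeff, neg_smul, ← sub_eq_add_neg, sub_eq_zero] at h3
  exact h3

theorem coeff_comm_of_checkComm (hφ : IsOdd K φ) {P Q R : Op} {lo : ℤ} {len : ℕ}
    (h : checkComm P Q R lo len = true) {k : ℤ} (h1 : lo ≤ k) (h2 : k < lo + len) :
    coeff (evalOp K φ P * evalOp K φ Q - evalOp K φ Q * evalOp K φ P) k =
      coeff (evalOp K φ R) k := by
  rw [checkComm, List.all_eq_true] at h
  have h3 := eval_eq_zero (K := K) hφ (h (k - lo).toNat (List.mem_range.mpr (by omega)))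
  rw [show lo + ((k - lo).toNat : ℤ) = k by omega, eval_append, eval_scale, eval_append,
    eval_opMul hφ, eval_opMul hφ, eval_opCoeff, neg_smul, one_smul, ← sub_eq_add_neg,
    sub_eq_zero] at h3
  rw [coeff_sub, h3, add_sub_cancel_left]

theorem ordLE_evalOp {N : ℤ} {P : Op} (h : ∀ t ∈ P, t.1 ≤ N) : OrdLE N (evalOp K φ P) := by
  induction P with
  | nil => exact OrdLE.zero N
  | cons t P ih =>
    obtain ⟨n, a⟩ := t
    rw [evalOp_cons]
    exact ((ordLE_monomial n _).mono (h _ List.mem_cons_self)).add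
      (ih fun t ht => h t (List.mem_cons_of_mem _ ht))

end Eval

/-- `81 Λ` up to order `-11`. -/
def rootOp : Op :=
  [(1, [([], 81)]),
   (-2, [([0], 81)]),
   (-3, [([1], -27)]),
   (-4, [([2], -54)]),
   (-5, [([3], 27)]),
   (-6, [([4], 27), ([0, 1], -27)]),
   (-7, [([5], -18), ([0, 2], 27), ([1, 1], 18)]),
   (-8, [([6], -9), ([0, 3], 27), ([1, 2], 72)]),
   (-9, [([7], 9), ([0, 4], -54), ([1, 3], -72)]),
   (-10, [([0, 5], -18), ([1, 4], -108), ([2, 3], -108), ([0, 1, 1], 18)]),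
   (-11, [([9], -3), ([0, 6], 72), ([1, 5], 102), ([2, 4], 66), ([3, 3], 81), ([0, 1, 2], -36),
    ([1, 1, 1], -14)])]

/-- `81 Λ²` up to order `-10`. -/
def rootSqOp : Op :=
  [(2, [([], 81)]),
   (-2, [([1], 27)]),
   (-3, [([2], -27)]),
   (-5, [([4], 27)]),
   (-6, [([5], -9), ([1, 1], -9)]),
   (-7, [([6], -18), ([1, 2], 18)]),
   (-8, [([7], 9), ([1, 3], 18)]),
   (-9, [([8], 9), ([1, 4], -36), ([2, 3], -36)]),
   (-10, [([9], -6), ([1, 5], -9), ([2, 4], -21), ([3, 3], -9), ([1, 1, 1], 5)])]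

/-- `𝒟³ + φ`. -/
def laxOp : Op := [(3, [([], 1)]), (0, [([0], 1)])]

/-- `(𝒟³ + φ)²`. -/
def laxSqOp : Op := [(6, [([], 1)]), (2, [([1], 1)]), (1, [([2], -1)]), (0, [([3], 1)])]

/-- `(𝒟³ + φ)³`. -/
def laxCubeOp : Op :=
  [(9, [([], 1)]),
   (6, [([0], 1)]),
   (5, [([1], 1)]),
   (4, [([2], 2)]),
   (3, [([3], 1)]),
   (2, [([4], 3), ([0, 1], 1)]),
   (1, [([0, 2], -1)]),
   (0, [([6], 1), ([0, 3], 1)])]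

/-- `9 (L^{5/3})_+`. -/
def flowOp : Op :=
  [(10, [([], 9)]),
   (6, [([1], 15)]),
   (5, [([2], -15)]),
   (4, [([3], 30)]),
   (3, [([4], -15)]),
   (2, [([5], 25), ([1, 1], 5)]),
   (1, [([6], -10), ([1, 2], -10)]),
   (0, [([7], 10), ([1, 3], 10)])]

/-- The right-hand side of the flow, as an operator of order zero. -/
def rhsOp : Op := [(0, [([10], -1), ([6, 1], -5), ([4, 3], -5), ([2, 1, 1], -5)])]

/-- `81` times the density of `∫ sres L^{7/6}`. -/
def densityOp7 : Op := [(-1, [([5], -18), ([1, 1], -9), ([2, 0], 54)])]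

/-- `81` times the density of `∫ sres L^{11/6}`. -/
def densityOp11 : Op :=
  [(-1, [([9], -6), ([5, 1], -18), ([3, 3], -9), ([1, 1, 1], -4), ([6, 0], 18), ([4, 2], -6),
    ([2, 0, 1], 36)])]

-- The orders -10, …, 2 are those on which the truncation of Λ at order -11 determines Λ² exactly.
set_option maxRecDepth 100000 in
theorem check_root_sq : checkMul rootOp rootOp rootSqOp 81 (-10) 13 = true := by decide +kernel

-- Here 6561 = 81²: both tables carry the common denominator 81.
set_option maxRecDepth 100000 in
theorem check_root_cube : checkMul rootOp rootSqOp laxOp 6561 (-9) 13 = true := by decide +kernel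

theorem check_lax_sq : checkMul laxOp laxOp laxSqOp 1 0 7 = true := by decide +kernel

theorem check_lax_cube : checkMul laxSqOp laxOp laxCubeOp 1 0 10 = true := by decide +kernel

/-- The factor is 9 because the left side is 81 Λ^{10} while `flowOp` is 9 times its differential
part. -/
theorem check_flow : checkMul rootOp laxCubeOp flowOp 9 0 11 = true := by decide +kernel

/-- Differential operators of orders 10 and 3: the orders 0, …, 13 exhaust the commutator. -/
theorem check_comm : checkComm flowOp laxOp rhsOp 0 14 = true := by decide +kernel

theorem check_density7 : checkMul rootOp laxSqOp densityOp7 1 (-1) 1 = true := by decide +kernel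

theorem check_density11 : checkMul rootSqOp laxCubeOp densityOp11 1 (-1) 1 = true := by
  decide +kernel

theorem check_sres5 : checkMul rootSqOp laxOp [] 1 (-1) 1 = true := by decide +kernel

end Jet

end SSK

end

/-! ### From the certified tables to the Lax equation and the explicit densities. -/

noncomputable section

namespace SSK

open SPDO Jet

attribute [local instance] SPDO.instRing

variable {K A : Type*} [Field K] [Ring A] [Algebra K A] [SuperDifferentialAlgebra K A]

/-- [n ; i] = 0 for 0 ≤ n < i. This extends the finite checks to all negative orders. -/
theorem coeff_mul_eq_zero_of_neg {P Q : SPDO K A} (hP : ∀ k < 0, coeff P k = 0)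
    (hQ : ∀ k < 0, coeff Q k = 0) {k : ℤ} (hk : k < 0) : coeff (P * Q) k = 0 := by
  rw [coeff_mul]
  refine finsum_eq_zero_of_forall_eq_zero fun p => ?_
  rcases lt_or_ge p.1 0 with h | h
  · rw [hP _ h, zero_mul]
  · rcases lt_or_ge (k + p.2 - p.1) 0 with h' | h'
    · rw [hQ _ h', map_zero, mul_zero]
    · obtain ⟨n, hn⟩ := Int.eq_ofNat_of_zero_le h
      rw [leib_apply, hn, superChoose_eq_zero_of_lt (by omega), zero_smul, mul_zero]

variable [CharZero K] {φ : A} {Λ : SPDO K A}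

theorem coeff_evalOp_eq_zero_of_neg {P : Op} (h : ∀ t ∈ P, 0 ≤ t.1) {k : ℤ} (hk : k < 0) :
    coeff (evalOp K φ P) k = 0 := by
  induction P with
  | nil => rfl
  | cons t P ih =>
    obtain ⟨n, a⟩ := t
    have h0 : 0 ≤ n := h _ List.mem_cons_self
    rw [evalOp_cons, coeff_add, ih fun t ht => h t (List.mem_cons_of_mem _ ht), coeff_monomial,
      if_neg (by omega), add_zero]

theorem evalOp_mul_eq (hφ : IsOdd K φ) {P Q R : Op} {N M : ℕ} {len : ℕ}
    (h : checkMul P Q R 1 0 len = true)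
    (hP : ∀ t ∈ P, 0 ≤ t.1 ∧ t.1 ≤ N) (hQ : ∀ t ∈ Q, 0 ≤ t.1 ∧ t.1 ≤ M)
    (hR : ∀ t ∈ R, 0 ≤ t.1 ∧ t.1 ≤ (N + M : ℤ)) (hlen : len = N + M + 1) :
    evalOp K φ P * evalOp K φ Q = evalOp K φ R := by
  refine ext_coeff fun k => ?_
  rcases lt_or_ge k 0 with hk | hk
  · rw [coeff_mul_eq_zero_of_neg
      (fun k hk => coeff_evalOp_eq_zero_of_neg (fun t ht => (hP t ht).1) hk)
      (fun k hk => coeff_evalOp_eq_zero_of_neg (fun t ht => (hQ t ht).1) hk) hk,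
      coeff_evalOp_eq_zero_of_neg (fun t ht => (hR t ht).1) hk]
  · rcases lt_or_ge k len with hk' | hk'
    · rw [coeff_mul_of_checkMul hφ h hk (by simpa using hk'), one_smul]
    · rw [((ordLE_evalOp fun t ht => (hP t ht).2).mul (ordLE_evalOp fun t ht => (hQ t ht).2)) k
        (by omega), ordLE_evalOp (fun t ht => (hR t ht).2) k (by omega)]

theorem evalOp_laxOp (φ : A) : evalOp K φ laxOp = laxFactor K φ := by
  simp [laxOp, laxFactor, evalLetter]

theorem evalOp_laxSqOp (hφ : IsOdd K φ) : evalOp K φ laxSqOp = laxFactor K φ ^ 2 := by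
  rw [pow_two, ← evalOp_laxOp,
    evalOp_mul_eq hφ (N := 3) (M := 3) check_lax_sq (by decide) (by decide) (by decide) rfl]

theorem evalOp_laxCubeOp (hφ : IsOdd K φ) : evalOp K φ laxCubeOp = laxFactor K φ ^ 3 := by
  rw [pow_succ, ← evalOp_laxSqOp hφ, ← evalOp_laxOp,
    evalOp_mul_eq hφ (N := 6) (M := 3) check_lax_cube (by decide) (by decide) (by decide) rfl]

/-- The truncation of `Λ` at order `-11`. -/
def rootTrunc (K : Type*) {A : Type*} [Field K] [Ring A] [Algebra K A]
    [SuperDifferentialAlgebra K A] (φ : A) : SPDO K A := (81 : K)⁻¹ • evalOp K φ rootOp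

/-- The truncation of `Λ²` at order `-10`. -/
def rootSqTrunc (K : Type*) {A : Type*} [Field K] [Ring A] [Algebra K A]
    [SuperDifferentialAlgebra K A] (φ : A) : SPDO K A := (81 : K)⁻¹ • evalOp K φ rootSqOp

theorem ordLE_rootTrunc (φ : A) : OrdLE 1 (rootTrunc K φ) :=
  (ordLE_evalOp (by decide)).smul _

theorem ordLE_rootSqTrunc (φ : A) : OrdLE 2 (rootSqTrunc K φ) :=
  (ordLE_evalOp (by decide)).smul _

theorem coeff_rootTrunc_one (φ : A) : coeff (rootTrunc K φ) 1 = 1 := by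
  rw [rootTrunc, coeff_smul, ← eval_opCoeff]
  have : eval K φ (opCoeff 1 rootOp) = (81 : K) • 1 := by
    rw [show opCoeff 1 rootOp = [([], 81)] by decide]
    simp only [eval_cons, evalWord_nil, eval_nil, add_zero]
    module
  rw [this, smul_smul, inv_mul_cancel₀ (by norm_num), one_smul]

theorem ordLE_rootTrunc_sq (hφ : IsOdd K φ) :
    OrdLE (-11) (rootTrunc K φ * rootTrunc K φ - rootSqTrunc K φ) := by
  intro k hk
  rcases lt_or_ge k 3 with h | h
  · have h1 := coeff_mul_of_checkMul hφ (K := K) check_root_sq (k := k) (by omega) (by omega)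
    rw [coeff_sub, rootTrunc, rootSqTrunc, SPDO.smul_mul, SPDO.mul_smul', smul_smul, coeff_smul, h1, coeff_smul]
    match_scalars; norm_num
  · rw [coeff_sub, ((ordLE_rootTrunc φ).mul (ordLE_rootTrunc φ)) k (by omega),
      (ordLE_rootSqTrunc φ) k (by omega), sub_zero]

theorem ordLE_rootTrunc_mul_rootSqTrunc (hφ : IsOdd K φ) :
    OrdLE (-10) (rootTrunc K φ * rootSqTrunc K φ - laxFactor K φ) := by
  intro k hk
  rcases lt_or_ge k 4 with h | h
  · have h1 := coeff_mul_of_checkMul hφ (K := K) check_root_cube (k := k) (by omega) (by omega)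
    rw [coeff_sub, rootTrunc, rootSqTrunc, SPDO.smul_mul, SPDO.mul_smul', smul_smul, coeff_smul, h1, evalOp_laxOp]
    match_scalars; norm_num
  · rw [coeff_sub, ((ordLE_rootTrunc φ).mul
      (ordLE_rootSqTrunc φ)) k (by omega),
      ← evalOp_laxOp, ordLE_evalOp (N := 3) (by decide) k (by omega), sub_zero]

theorem IsLaxRoot.ordLE_sub_rootTrunc (hφ : IsOdd K φ) (h : IsLaxRoot K φ Λ) :
    OrdLE (-12) (Λ - rootTrunc K φ) := by
  -- The two certified defects make the cubes agree above order -10 = 1 + 1 - 12.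
  refine ordLE_sub_of_cube (d := 1) h.ordLE h.monic.1 (ordLE_rootTrunc φ) (coeff_rootTrunc_one φ) ?_
  have e : Λ ^ 3 - rootTrunc K φ ^ 3 = -(rootTrunc K φ *
      (rootTrunc K φ * rootTrunc K φ - rootSqTrunc K φ) +
      (rootTrunc K φ * rootSqTrunc K φ - laxFactor K φ)) := by
    rw [h.cube']; noncomm_ring
  rw [e]
  exact ((((ordLE_rootTrunc φ).mul (ordLE_rootTrunc_sq hφ)).mono (by norm_num)).add
    (ordLE_rootTrunc_mul_rootSqTrunc hφ)).neg

theorem IsLaxRoot.ordLE_sq_sub_rootSqTrunc (hφ : IsOdd K φ) (h : IsLaxRoot K φ Λ) :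
    OrdLE (-11) (Λ ^ 2 - rootSqTrunc K φ) := by
  have h1 := h.ordLE_sub_rootTrunc hφ
  have e : Λ ^ 2 - rootSqTrunc K φ = (Λ - rootTrunc K φ) * Λ + rootTrunc K φ * (Λ - rootTrunc K φ) +
      (rootTrunc K φ * rootTrunc K φ - rootSqTrunc K φ) := by noncomm_ring
  rw [e]
  exact (((h1.mul h.ordLE).mono (by norm_num)).add
    (((ordLE_rootTrunc φ).mul h1).mono (by norm_num))).add (ordLE_rootTrunc_sq hφ)

/-- Replacing the left factor by a truncation does not change coefficients of high order. -/
theorem coeff_mul_congr {P P' Q : SPDO K A} {r N k : ℤ} (h : OrdLE r (P - P')) (hQ : OrdLE N Q)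
    (hk : r + N < k) : coeff (P * Q) k = coeff (P' * Q) k := by
  rw [← sub_eq_zero, ← coeff_sub, ← sub_mul]
  exact (h.mul hQ) k hk

/-- High powers of Λ need no long expansions: all but at most two factors can be absorbed into an
explicit differential operator. -/
theorem IsLaxRoot.pow_add_three_mul (h : IsLaxRoot K φ Λ) (i m : ℕ) :
    Λ ^ (i + 3 * m) = Λ ^ i * laxFactor K φ ^ m := by
  rw [pow_add, pow_mul, h.cube']

theorem IsLaxRoot.coeff_pow_ten (hφ : IsOdd K φ) (h : IsLaxRoot K φ Λ) {k : ℤ} (hk : 0 ≤ k) :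
    (9 : K) • coeff (Λ ^ 10) k = coeff (evalOp K φ flowOp) k := by
  have h9 : OrdLE 9 (evalOp K φ laxCubeOp) := ordLE_evalOp (by decide)
  rcases lt_or_ge k 11 with h' | h'
  · have h1 := coeff_mul_of_checkMul hφ (K := K) check_flow (k := k) (by omega) (by omega)
    rw [show 10 = 1 + 3 * 3 from rfl, h.pow_add_three_mul, pow_one, ← evalOp_laxCubeOp hφ,
      coeff_mul_congr (h.ordLE_sub_rootTrunc hφ) h9 (by omega), rootTrunc, SPDO.smul_mul,
      coeff_smul, h1]
    match_scalars; norm_num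
  · rw [(h.ordLE_pow 10).1 k (by push_cast; omega),
      (ordLE_evalOp (by decide) : OrdLE 10 (evalOp K φ flowOp)) k (by omega), smul_zero]

theorem IsLaxRoot.diffPart_pow_ten (hφ : IsOdd K φ) (h : IsLaxRoot K φ Λ) :
    (9 : K) • diffPart (Λ ^ 10) = evalOp K φ flowOp := by
  refine ext_coeff fun k => ?_
  change (9 : K) • (if 0 ≤ k then coeff (Λ ^ 10) k else 0) = _
  split_ifs with hk
  · exact h.coeff_pow_ten hφ hk
  · rw [coeff_evalOp_eq_zero_of_neg (by decide) (not_le.mp hk), smul_zero]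

/-- The commutator of operators of orders 10 and 3 collapses to a function, which is the right-hand
side of the Sawada–Kotera equation. -/
theorem flowOp_comm (hφ : IsOdd K φ) :
    evalOp K φ flowOp * laxFactor K φ - laxFactor K φ * evalOp K φ flowOp =
      evalOp K φ rhsOp := by
  rw [← evalOp_laxOp]
  have hb : OrdLE 10 (evalOp K φ flowOp) := ordLE_evalOp (by decide)
  have hl : OrdLE 3 (evalOp K φ laxOp) := ordLE_evalOp (by decide)
  have hb0 : ∀ k < 0, coeff (evalOp K φ flowOp) k = 0 := fun k =>
    coeff_evalOp_eq_zero_of_neg (by decide)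
  have hl0 : ∀ k < 0, coeff (evalOp K φ laxOp) k = 0 := fun k =>
    coeff_evalOp_eq_zero_of_neg (by decide)
  refine ext_coeff fun k => ?_
  rcases lt_or_ge k 0 with hk | hk
  · rw [coeff_sub, coeff_mul_eq_zero_of_neg hb0 hl0 hk, coeff_mul_eq_zero_of_neg hl0 hb0 hk,
      coeff_evalOp_eq_zero_of_neg (by decide) hk, sub_zero]
  · rcases lt_or_ge k 14 with hk' | hk'
    · exact coeff_comm_of_checkComm hφ check_comm hk (by simpa using hk')
    · rw [coeff_sub, (hb.mul hl) k (by omega), (hl.mul hb) k (by omega),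
        (ordLE_evalOp (by decide) : OrdLE 0 (evalOp K φ rhsOp)) k (by omega), sub_zero]

theorem dx_iterate (n : ℕ) (f : A) :
    (dx K)^[n] f = (⇑(D K : A →ₗ[K] A))^[2 * n] f := by
  induction n with
  | zero => rfl
  | succ n ih =>
    rw [Function.iterate_succ_apply', ih, mul_add, mul_one, Function.iterate_add_apply _ (2 * n) 2,
      ← Function.iterate_add_apply, add_comm, Function.iterate_add_apply]
    rfl

theorem dx_iterate_eq_evalLetter (n : ℕ) (φ : A) : (dx K)^[n] φ = evalLetter K φ (2 * n) :=
  dx_iterate n φ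

theorem dx_eq_evalLetter (φ : A) : dx K φ = evalLetter K φ 2 := rfl

theorem D_eq_evalLetter (φ : A) : D K φ = evalLetter K φ 1 := rfl

theorem self_eq_evalLetter (φ : A) : φ = evalLetter K φ 0 := rfl

theorem IsSSKFlow.apply_eq {T : A →ₗ[K] A} (hT : IsSSKFlow K φ T) :
    monomial K 0 (T φ) = evalOp K φ rhsOp := by
  have h := hT.equation
  rw [dx_iterate_eq_evalLetter, dx_iterate_eq_evalLetter, dx_iterate_eq_evalLetter,
    dx_eq_evalLetter, D_eq_evalLetter, D_evalLetter] at h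
  have h' : T φ = eval K φ [([10], -1), ([6, 1], -5), ([4, 3], -5), ([2, 1, 1], -5)] := by
    simp only [eval_cons, evalWord_cons, evalWord_nil, eval_nil, mul_one, add_zero]
    rw [← sub_eq_zero, ← h]
    simp only [Nat.reduceMul, Nat.reduceAdd]
    noncomm_ring
  rw [rhsOp, evalOp_cons, ← h', evalOp_nil, add_zero]

theorem IsLaxRoot.flow (hφ : IsOdd K φ) (h : IsLaxRoot K φ Λ) {T : A →ₗ[K] A}
    (hT : IsSSKFlow K φ T) (n : ℕ) :
    mapCoeff T (Λ ^ n) = superCommutator ((9 : K) • diffPart (Λ ^ 10)) (Λ ^ n) ∧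
      superIntegral K φ (T (sres (Λ ^ n))) = 0 := by
  refine lax_flow hφ h hT ?_ n
  rw [h.diffPart_pow_ten hφ, flowOp_comm hφ, hT.apply_eq]

theorem IsLaxRoot.sres_one (hφ : IsOdd K φ) (h : IsLaxRoot K φ Λ) : sres (Λ ^ 1) = 0 := by
  have h1 := h.ordLE_sub_rootTrunc hφ (-1) (by norm_num)
  rw [coeff_sub, sub_eq_zero] at h1
  rw [pow_one, sres, h1, rootTrunc, coeff_smul, ← eval_opCoeff,
    show opCoeff (-1) rootOp = [] by decide, eval_nil, smul_zero]

theorem IsLaxRoot.sres_five (hφ : IsOdd K φ) (h : IsLaxRoot K φ Λ) : sres (Λ ^ 5) = 0 := by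
  have h1 := coeff_mul_of_checkMul hφ (K := K) check_sres5 (k := -1) (by omega) (by norm_num)
  rw [sres, show 5 = 2 + 3 * 1 from rfl, h.pow_add_three_mul, pow_one, ← evalOp_laxOp,
    coeff_mul_congr (N := 3) (h.ordLE_sq_sub_rootSqTrunc hφ) (ordLE_evalOp (by decide))
      (by norm_num), rootSqTrunc, SPDO.smul_mul, coeff_smul, h1]
  simp

/-- Λ^{3m} is the differential operator (𝒟³ + φ)^m. -/
theorem IsLaxRoot.sres_three_mul (h : IsLaxRoot K φ Λ) (m : ℕ) :
    sres (Λ ^ (3 * m)) = 0 := by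
  rw [pow_mul, h.cube', ← evalOp_laxOp]
  have h0 : ∀ k < 0, coeff (evalOp K φ laxOp ^ m) k = 0 := by
    induction m with
    | zero =>
      intro k hk
      rw [pow_zero]
      change coeff (monomial K 0 1) k = 0
      rw [coeff_monomial, if_neg hk.ne]
    | succ m ih =>
      intro k hk
      rw [pow_succ]
      exact coeff_mul_eq_zero_of_neg ih
        (fun k => coeff_evalOp_eq_zero_of_neg (by decide)) hk
  exact h0 (-1) (by norm_num)

theorem IsLaxRoot.sres_seven (hφ : IsOdd K φ) (h : IsLaxRoot K φ Λ) :
    sres (Λ ^ 7) = density7 K φ := by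
  have h1 := coeff_mul_of_checkMul hφ (K := K) check_density7 (k := -1) (by omega) (by norm_num)
  rw [sres, show 7 = 1 + 3 * 2 from rfl, h.pow_add_three_mul, pow_one, ← evalOp_laxSqOp hφ,
    coeff_mul_congr (N := 6) (h.ordLE_sub_rootTrunc hφ) (ordLE_evalOp (by decide))
      (by norm_num), rootTrunc, SPDO.smul_mul, coeff_smul, h1, ← eval_opCoeff,
    show opCoeff (-1) densityOp7 = [([5], -18), ([1, 1], -9), ([2, 0], 54)] by decide,
    density7, dx_iterate_eq_evalLetter, D_evalLetter, D_eq_evalLetter, dx_eq_evalLetter]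
  simp only [eval_cons, evalWord_cons, evalWord_nil, eval_nil, mul_one, add_zero, pow_two,
    ← self_eq_evalLetter, ← Nat.cast_ofNat (R := A), ← nsmul_eq_mul]
  module

theorem IsLaxRoot.sres_eleven (hφ : IsOdd K φ) (h : IsLaxRoot K φ Λ) :
    sres (Λ ^ 11) = density11 K φ := by
  have h1 := coeff_mul_of_checkMul hφ (K := K) check_density11 (k := -1) (by omega) (by norm_num)
  -- The error of order -11 in Λ² times order 9 stays at order -2, just below the residue; this
  -- fixes the length of the tables.
  rw [sres, show 11 = 2 + 3 * 3 from rfl, h.pow_add_three_mul, ← evalOp_laxCubeOp hφ,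
    coeff_mul_congr (N := 9) (h.ordLE_sq_sub_rootSqTrunc hφ) (ordLE_evalOp (by decide))
      (by norm_num), rootSqTrunc, SPDO.smul_mul, coeff_smul, h1, ← eval_opCoeff,
    show opCoeff (-1) densityOp11 = [([9], -6), ([5, 1], -18), ([3, 3], -9), ([1, 1, 1], -4),
      ([6, 0], 18), ([4, 2], -6), ([2, 0, 1], 36)] by decide,
    density11, dx_iterate_eq_evalLetter, dx_iterate_eq_evalLetter, dx_iterate_eq_evalLetter,
    dx_eq_evalLetter, D_evalLetter, D_evalLetter, D_evalLetter, D_eq_evalLetter φ]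
  simp only [eval_cons, evalWord_cons, evalWord_nil, eval_nil, mul_one, add_zero, pow_succ,
    pow_zero, one_mul, mul_assoc, ← self_eq_evalLetter, ← Nat.cast_ofNat (R := A), ← nsmul_eq_mul]
  module

end SSK

end

/-! ### Variation of the residues; derivations and scaling of the free algebra. -/

noncomputable section

namespace SSK

open SPDO

attribute [local instance] SPDO.instRing

section General

variable {K A : Type*} [Field K] [Ring A] [Algebra K A] [SuperDifferentialAlgebra K A] [CharZero K]

theorem homogeneous_comm {a b : ℕ} {f g : A} (hf : parity K f = (-1 : K) ^ a • f)
    (hg : parity K g = (-1 : K) ^ b • g) : f * g = (-1 : K) ^ (a * b) • (g * f) := by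
  rcases Nat.even_or_odd a with h | h
  · rw [h.neg_one_pow, one_smul] at hf
    rw [(h.mul_right b).neg_one_pow, one_smul, SuperDifferentialAlgebra.even_comm (K := K) _ _ hf]
  · rw [h.neg_one_pow, neg_smul, one_smul] at hf
    rw [pow_mul, h.neg_one_pow, odd_mul hf, hg, smul_mul_assoc]

/-- The right-hand side of the supersymmetric Sawada-Kotera equation. -/
def sskRhs (K : Type*) {A : Type*} [Field K] [Ring A] [Algebra K A]
    [SuperDifferentialAlgebra K A] (φ : A) : A :=
  -((dx K)^[5] φ + 5 * ((dx K)^[3] φ * D K φ)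
      + 5 * ((dx K)^[2] φ * D K (dx K φ)) + 5 * (dx K φ * (D K φ) ^ 2))

theorem ssk_equation_iff (φ t : A) : t + (dx K)^[5] φ + 5 * ((dx K)^[3] φ * D K φ)
      + 5 * ((dx K)^[2] φ * D K (dx K φ)) + 5 * (dx K φ * (D K φ) ^ 2) = 0 ↔ t = sskRhs K φ := by
  rw [sskRhs, eq_neg_iff_add_eq_zero]
  simp only [add_assoc]

theorem isOdd_sskRhs {φ : A} (hφ : IsOdd K φ) : IsOdd K (sskRhs K φ) := by
  have h : ∀ k, parity K ((⇑(D K : A →ₗ[K] A))^[k] φ) =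
      (-1 : K) ^ (k + 1) • (⇑(D K : A →ₗ[K] A))^[k] φ := parity_iterate_D hφ
  have h1 : parity K (D K φ) = D K φ := by simpa using h 1
  have h2 : parity K (dx K φ) = -dx K φ := by
    have := h 2; norm_num at this; exact this
  have h3 : parity K (D K (dx K φ)) = D K (dx K φ) := by
    have := h 3; norm_num at this; exact this
  have hx : ∀ n, parity K ((dx K)^[n] φ) = -(dx K)^[n] φ := fun n => by
    rw [dx_iterate, h, pow_succ, pow_mul]; simp
  rw [IsOdd, sskRhs]
  simp only [map_neg, map_add, map_mul, map_pow, map_ofNat, hx, h1, h2, h3]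
  noncomm_ring

variable {φ : A} {Λ : SPDO K A}

theorem superIntegral_eq_zero_iff {h : A} :
    superIntegral K φ h = 0 ↔ h ∈ exactDensities K φ := Submodule.Quotient.mk_eq_zero _

/-- Up to exact densities, a derivation acts on the residue of `Λ^n` through its action on `φ`. -/
theorem IsLaxRoot.superIntegral_derivation (hφ : IsOdd K φ) (h : IsLaxRoot K φ Λ)
    (htop : diffPoly K φ = ⊤) {T : A →ₗ[K] A} (hT : ∀ f g : A, T (f * g) = T f * g + f * T g)
    (hσ : ∀ f : A, T (parity K f) = parity K (T f)) (hD : ∀ f : A, T (D K f) = D K (T f))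
    {m : ℕ} (hm : Even m) :
    3 • superIntegral K φ (T (sres (Λ ^ (m + 3)))) =
      (m + 3) • superIntegral K φ (T φ * coeff (Λ ^ m) (-1)) := by
  have hin : ∀ P : SPDO K A, CoeffIn (diffPoly K φ) P := fun P k => by
    rw [htop]; exact Algebra.mem_top
  have hmul := mapCoeff_mul hT hσ hD (K := K)
  have h1 : T 1 = 0 := by simpa using hT 1 1
  let tr : SPDO K A →ₗ[K] A ⧸ exactDensities K φ := superIntegral K φ ∘ₗ coeffHom (-1)
  set X := mapCoeff T Λ with hX
  have hXodd : parityOp X = (-1 : ℤ) ^ 1 • X := by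
    have h2 := h.odd
    refine ext_coeff fun k => ?_
    have h3 := congrArg (fun Q => T (coeff Q k)) h2
    simp only [coeff_parityOp, coeff_neg, map_smul, hσ, map_neg] at h3
    rw [coeff_parityOp, hX, coeff_mapCoeff, h3, pow_one, neg_smul, one_smul]
    rfl
  -- For n + l odd the signs met when powers of Λ are moved cyclically past X are all +1, so the n
  -- summands of T(Λ^n) contribute equally.
  have key : ∀ n l : ℕ, Odd (n + l) →
      tr (mapCoeff T (Λ ^ n) * Λ ^ l) = n • tr (X * Λ ^ (n + l - 1)) := by
    intro n
    induction n with
    | zero => intro l _; rw [pow_zero, mapCoeff_one hT, zero_mul, map_zero, zero_smul]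
    | succ n ih =>
      intro l hl
      have hc := sres_comm_mem_exactDensities hφ (hin (Λ ^ n)) (hin (X * Λ ^ l))
        (h.parityOp_pow n)
      have e1 : parityPow n (X * Λ ^ l) = X * Λ ^ l := by
        rw [parityPow_mul, parityPow_of_homogeneous hXodd,
          parityPow_of_homogeneous (h.parityOp_pow l), smul_mul_smul_comm, ← pow_add,
          Even.neg_one_pow, one_smul]
        have : Even (n * (1 + l)) := by
          rw [Nat.even_mul]
          rcases Nat.even_or_odd n with hn | hn
          · exact Or.inl hn
          · right
            rw [show n + 1 + l = n + (1 + l) by ring, Nat.odd_add] at hl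
            exact hl.mp hn
        rwa [mul_add] at this
      have e2 : tr (Λ ^ n * (X * Λ ^ l)) = tr (X * Λ ^ (n + l)) := by
        rw [e1, ← superIntegral_eq_zero_iff] at hc
        rw [← sub_eq_zero, ← map_sub, add_comm n l, pow_add, ← mul_assoc X]
        exact hc
      have e3 : mapCoeff T (Λ ^ (n + 1)) * Λ ^ l =
          mapCoeff T (Λ ^ n) * Λ ^ (l + 1) + Λ ^ n * (X * Λ ^ l) := by
        rw [pow_succ, hmul, add_mul, mul_assoc, ← pow_succ', mul_assoc]
      rw [e3, map_add, ih (l + 1) (by rwa [show n + (l + 1) = n + 1 + l by ring]), e2,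
        show n + (l + 1) - 1 = n + l by omega, show n + 1 + l - 1 = n + l by omega, succ_nsmul]
  have hodd : Odd (m + 3) := hm.add_odd (by decide)
  -- Both (m+3, 0) and (3, m) lead to X Λ^{m+2}, and the second is explicit because T(Λ³) = Tφ.
  have k1 := key (m + 3) 0 hodd
  have k2 := key 3 m (by rwa [add_comm])
  have hL : mapCoeff T (Λ ^ 3) = monomial K 0 (T φ) := by
    rw [h.cube']
    refine ext_coeff fun k => ?_
    rw [coeff_mapCoeff, laxFactor, coeff_add, map_add]
    simp only [coeff_monomial]
    split_ifs <;> simp [h1]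
  rw [hL] at k2
  have e4 : tr (monomial K 0 (T φ) * Λ ^ m) = superIntegral K φ (T φ * coeff (Λ ^ m) (-1)) := by
    change superIntegral K φ (coeff (monomial K 0 (T φ) * Λ ^ m) (-1)) = _
    rw [coeff_monomial_zero_mul]
  have e5 : tr (mapCoeff T (Λ ^ (m + 3)) * Λ ^ 0) = superIntegral K φ (T (sres (Λ ^ (m + 3)))) := by
    rw [pow_zero, mul_one]; rfl
  rw [← e5, ← e4, k1, k2, add_zero, add_comm 3 m, smul_comm]

end General

namespace FreeSDA

variable (K : Type*) [Field K] [CharZero K]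

theorem parity_eq (f : FreeSDA K) : parity K f = par K f := rfl

theorem D_eq (f : FreeSDA K) : D K f = der K f := rfl

theorem isOdd_jet_zero : IsOdd K (jet K 0) := by
  rw [IsOdd, parity_eq, par_jet]; simp

theorem iterate_D_jet_zero (k : ℕ) : (⇑(D K : FreeSDA K →ₗ[K] FreeSDA K))^[k] (jet K 0) = jet K k := by
  induction k with
  | zero => rfl
  | succ k ih => rw [Function.iterate_succ_apply', ih, D_eq, der_jet]

theorem diffPoly_eq_top : diffPoly K (jet K 0) = ⊤ := by
  refine eq_top_iff.mpr fun f _ => ?_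
  induction f using jet_induction with
  | h0 c => exact Subalgebra.algebraMap_mem _ c
  | h1 k => exact Algebra.subset_adjoin ⟨k, iterate_D_jet_zero K k⟩
  | hm a b ha hb => exact mul_mem (ha trivial) (hb trivial)
  | ha a b ha hb => exact add_mem (ha trivial) (hb trivial)

variable {K} in
/-- The homomorphism `f ↦ !![f, T f; 0, f]` that encodes the even derivation `T` commuting with `𝒟`
with `T φ = g`. -/
def evolMat {g : FreeSDA K} (hg : IsOdd K g) :
    FreeSDA K →ₐ[K] Matrix (Fin 2) (Fin 2) (FreeSDA K) :=
  lift K (fun k => !![jet K k, (⇑(D K : FreeSDA K →ₗ[K] FreeSDA K))^[k] g; 0, jet K k])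
    fun i j => by
      have h1 := fun k => parity_iterate_D hg k
      have h2 : ∀ k, parity K (jet K k) = (-1 : K) ^ (k + 1) • jet K k := par_jet K
      have e1 := homogeneous_comm (h2 i) (h1 j)
      have e2 := homogeneous_comm (h1 i) (h2 j)
      rw [Matrix.mul_fin_two, Matrix.mul_fin_two]
      ext a b
      fin_cases a <;> fin_cases b
      · simpa using jet_swap K i j
      · simp only [Matrix.smul_apply]
        simp only [Fin.zero_eta, Fin.mk_one, Matrix.of_apply, Matrix.cons_val', Matrix.cons_val_one,
          Matrix.cons_val_zero, Matrix.cons_val_fin_one]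
        rw [e1, e2, ← smul_add, add_comm (jet K j * _)]
      · simp
      · simpa using jet_swap K i j

/-- Used twice: with g the right-hand side of the equation, and with g = φ, which gives the
derivation counting the degree in φ. -/
theorem exists_evolution {g : FreeSDA K} (hg : IsOdd K g) : ∃ T : FreeSDA K →ₗ[K] FreeSDA K,
    (∀ f h, T (f * h) = T f * h + f * T h) ∧ (∀ f, T (parity K f) = parity K (T f)) ∧
      (∀ f, T (D K f) = D K (T f)) ∧ T (jet K 0) = g := by
  have hd : ∀ f, evolMat hg f 0 0 = f ∧ evolMat hg f 1 0 = 0 ∧ evolMat hg f 1 1 = f := by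
    intro f
    induction f using jet_induction with
    | h0 c => simp [Matrix.algebraMap_matrix_apply]
    | h1 k => rw [evolMat, lift_jet]; simp
    | hm a b ha hb =>
      obtain ⟨a1, a2, a3⟩ := ha
      obtain ⟨b1, b2, b3⟩ := hb
      simp [Matrix.mul_apply, Fin.sum_univ_two, a1, a2, a3, b1, b2, b3]
    | ha a b ha hb =>
      obtain ⟨a1, a2, a3⟩ := ha
      obtain ⟨b1, b2, b3⟩ := hb
      simp [a1, a2, a3, b1, b2, b3]
  let T : FreeSDA K →ₗ[K] FreeSDA K :=
    { toFun := fun f => evolMat hg f 0 1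
      map_add' := fun f h => by simp
      map_smul' := fun c f => by simp }
  have hT : ∀ f h, T (f * h) = T f * h + f * T h := fun f h => by
    change evolMat hg (f * h) 0 1 = evolMat hg f 0 1 * h + f * evolMat hg h 0 1
    rw [map_mul, Matrix.mul_apply, Fin.sum_univ_two, (hd f).1, (hd h).2.2, add_comm]
  have hc : ∀ c : K, T (algebraMap K _ c) = 0 := fun c => by
    change evolMat hg (algebraMap K _ c) 0 1 = 0
    simp [Matrix.algebraMap_matrix_apply]
  have hj : ∀ k, T (jet K k) = (⇑(D K : FreeSDA K →ₗ[K] FreeSDA K))^[k] g := fun k => by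
    change evolMat hg (jet K k) 0 1 = _
    rw [evolMat, lift_jet]; simp
  have hσ : ∀ f, T (parity K f) = parity K (T f) := by
    intro f
    induction f using jet_induction with
    | h0 c => rw [AlgHom.commutes, hc, map_zero]
    | h1 k => rw [hj, parity_iterate_D hg, parity_eq, par_jet, map_smul, hj]
    | hm a b ha hb => rw [map_mul, hT, ha, hb, hT, map_add, map_mul, map_mul]
    | ha a b ha hb => simp only [map_add, ha, hb]
  refine ⟨T, hT, hσ, fun f => ?_, hj 0⟩
  induction f using jet_induction with
  | h0 c => rw [hc, D_eq, der_algebraMap, map_zero, map_zero]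
  | h1 k => rw [D_eq, der_jet, hj, hj, Function.iterate_succ_apply']
  | hm a b ha hb =>
    rw [D_mul, map_add, hT, hT, hT, map_add, D_mul, D_mul, ha, hb, hσ]
    abel
  | ha a b ha hb => simp only [map_add, ha, hb]

theorem existsUnique_sskFlow :
    ∃! T : FreeSDA K →ₗ[K] FreeSDA K, IsSSKFlow K (jet K 0) T := by
  obtain ⟨T, h1, h2, h3, h4⟩ := exists_evolution K (isOdd_sskRhs (isOdd_jet_zero K))
  refine ⟨T, ⟨h1, h2, h3, (ssk_equation_iff _ _).mpr h4⟩, fun T' hT' => ?_⟩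
  have h0 : T' (jet K 0) = T (jet K 0) := by
    rw [h4, (ssk_equation_iff _ _).mp hT'.equation]
  have hc : ∀ S : FreeSDA K →ₗ[K] FreeSDA K, (∀ f h, S (f * h) = S f * h + f * S h) →
      ∀ c : K, S (algebraMap K _ c) = 0 := fun S hS c => by
    rw [Algebra.algebraMap_eq_smul_one, map_smul, show S 1 = 0 by simpa using hS 1 1, smul_zero]
  refine LinearMap.ext fun f => ?_
  induction f using jet_induction with
  | h0 c => rw [hc T' hT'.leibniz, hc T h1]
  | h1 k =>
    induction k with
    | zero => exact h0
    | succ k ih => rw [← der_jet, ← D_eq, hT'.comm_D, h3, ih]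
  | hm a b ha hb => rw [hT'.leibniz, h1, ha, hb]
  | ha a b ha hb => rw [map_add, map_add, ha, hb]

/-- The scaling `𝒟^k φ ↦ 2^{k+3} 𝒟^k φ`. -/
def scaling : FreeSDA K →ₐ[K] FreeSDA K :=
  lift K (fun k => (2 : K) ^ (k + 3) • jet K k) fun i j => by
    rw [smul_mul_smul_comm, smul_mul_smul_comm, jet_swap K i j, smul_comm, mul_comm ((2 : K) ^ _)]

theorem scaling_jet (k : ℕ) : scaling K (jet K k) = (2 : K) ^ (k + 3) • jet K k := lift_jet K _ _ k

theorem scaling_parity (f : FreeSDA K) : scaling K (parity K f) = parity K (scaling K f) := by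
  induction f using jet_induction with
  | h0 c => simp only [AlgHom.commutes]
  | h1 k =>
    rw [parity_eq, par_jet, map_smul, scaling_jet, parity_eq, map_smul, par_jet, smul_comm]
  | hm a b ha hb => simp only [map_mul, ha, hb]
  | ha a b ha hb => simp only [map_add, ha, hb]

theorem scaling_D (f : FreeSDA K) : scaling K (D K f) = (2 : K) • D K (scaling K f) := by
  induction f using jet_induction with
  | h0 c => rw [AlgHom.commutes, D_eq, der_algebraMap, map_zero, smul_zero]
  | h1 k =>
    rw [scaling_jet, map_smul, D_eq, der_jet, scaling_jet, smul_smul]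
    congr 1; ring
  | hm a b ha hb =>
    rw [D_mul, map_add, map_mul, map_mul, map_mul, D_mul, ha, hb, scaling_parity, smul_add,
      smul_mul_assoc, mul_smul_comm]
  | ha a b ha hb => simp only [map_add, ha, hb, smul_add]

variable {K}
variable {Λ : SPDO K (FreeSDA K)}

/-- Scaling multiplies 𝒟³ + φ by 8, so half the scaled Λ is again a monic cube root and equals Λ. -/
theorem mapOp_scaling_pow (h : IsLaxRoot K (jet K 0) Λ) (n : ℕ) :
    mapOp (scaling K) 2 (Λ ^ n) = (2 : K) ^ n • Λ ^ n := by
  have h2 : (2 : K) ≠ 0 := two_ne_zero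
  have hp := mapOp_pow h2 (scaling_parity K) (scaling_D K)
  have hlax : mapOp (scaling K) 2 (laxFactor K (jet K 0)) = (8 : K) • laxFactor K (jet K 0) := by
    refine ext_coeff fun k => ?_
    rw [coeff_mapOp, coeff_smul, laxFactor, coeff_add, coeff_monomial, coeff_monomial]
    by_cases h3 : k = 3
    · subst h3
      norm_num
    · by_cases h0 : k = 0
      · subst h0
        simp only [h3, if_false, if_true, zero_add, scaling_jet]
        norm_num
      · simp [h3, h0]
  have e : (2 : K)⁻¹ • mapOp (scaling K) 2 Λ = Λ := by
    refine cube_injective (d := 1) ?_ ?_ h.ordLE h.monic.1 ?_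
    · intro k hk
      rw [coeff_smul, coeff_mapOp, h.ordLE k hk, map_zero, smul_zero, smul_zero]
    · rw [coeff_smul, coeff_mapOp, h.monic.1, map_one, zpow_one, smul_smul, inv_mul_cancel₀ h2,
        one_smul]
    · have e3 : ∀ P : SPDO K (FreeSDA K), ((2 : K)⁻¹ • P) ^ 3 = (8 : K)⁻¹ • P ^ 3 := fun P => by
        simp only [pow_succ, pow_zero, one_mul, SPDO.smul_mul, SPDO.mul_smul', smul_smul]
        norm_num
      rw [e3, ← hp, h.cube', hlax, smul_smul, inv_mul_cancel₀ (by norm_num), one_smul]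
  have e' : mapOp (scaling K) 2 Λ = (2 : K) • Λ := by
    nth_rewrite 2 [← e]
    rw [smul_smul, mul_inv_cancel₀ h2, one_smul]
  rw [hp, e']
  induction n with
  | zero => simp
  | succ n ih => rw [pow_succ, ih, SPDO.smul_mul, SPDO.mul_smul', smul_smul, ← pow_succ, ← pow_succ]

theorem scaling_coeff_pow (h : IsLaxRoot K (jet K 0) Λ) (n : ℕ) (k : ℤ) :
    scaling K (coeff (Λ ^ n) k) = (2 : K) ^ (n - k : ℤ) • coeff (Λ ^ n) k := by
  have h1 := congrArg (fun P => (2 : K) ^ (-k) • coeff P k) (mapOp_scaling_pow h n)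
  simp only [coeff_mapOp, coeff_smul, smul_smul] at h1
  rw [← zpow_add₀ two_ne_zero, neg_add_cancel, zpow_zero, one_smul] at h1
  rw [h1, ← zpow_natCast, ← zpow_add₀ two_ne_zero, sub_eq_neg_add]

theorem linearIndependent_superIntegral (h : IsLaxRoot K (jet K 0) Λ) :
    LinearIndependent K
      fun n : {n : ℕ // superIntegral K (jet K 0) (sres (Λ ^ n)) ≠ 0} =>
        superIntegral K (jet K 0) (sres (Λ ^ (n : ℕ))) := by
  -- Scaling sends 𝒟J to 𝒟(2·scaling J), so it descends to functionals; there sres Λ^n has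
  -- eigenvalue 2^{n+1}.
  have hle : exactDensities K (jet K 0) ≤
      (exactDensities K (jet K 0)).comap (scaling K).toLinearMap := by
    rintro _ ⟨J, -, rfl⟩
    refine ⟨(2 : K) • scaling K J, ?_, ?_⟩
    · change (2 : K) • scaling K J ∈ diffPoly K (jet K 0)
      rw [diffPoly_eq_top]
      exact Algebra.mem_top
    · change D K ((2 : K) • scaling K J) = scaling K (D K J)
      rw [scaling_D, map_smul]
  let s := (exactDensities K (jet K 0)).mapQ _ (scaling K).toLinearMap hle
  refine Module.End.eigenvectors_linearIndependent' s
    (fun n : {n : ℕ // superIntegral K (jet K 0) (sres (Λ ^ n)) ≠ 0} => (2 : K) ^ ((n : ℕ) + 1))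
    ?_ _ fun n => ⟨?_, n.2⟩
  · intro n m hnm
    have h1 : ((2 ^ ((n : ℕ) + 1) : ℕ) : K) = ((2 ^ ((m : ℕ) + 1) : ℕ) : K) := by
      push_cast; exact hnm
    have h2 := Nat.pow_right_injective le_rfl (Nat.cast_injective h1)
    exact Subtype.ext (by omega)
  · rw [Module.End.mem_eigenspace_iff]
    have h1 := scaling_coeff_pow h n (-1)
    have h2 := congrArg (superIntegral K (jet K 0)) h1
    rw [map_smul, sub_neg_eq_add] at h2
    refine Eq.trans h2 ?_
    norm_cast

end FreeSDA

end SSK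

end

noncomputable section

namespace SSK

open SPDO Jet

attribute [local instance] SPDO.instRing

namespace FreeSDA

/-! ### A six-dimensional representation that detects the quadratic part modulo exact terms -/

/-- The pairing of the letters `i` and `j`, taken modulo four. -/
def pairing (i j : ZMod 4) : ℤ :=
  if i + j = 2 then (if i = 0 ∨ i = 1 then 1 else -1) else 0

/-- The matrix of the letter `r`, acting on `⟨1⟩ ⊕ V ⊕ ⟨z⟩` with `V` four-dimensional. -/
def letterMat (r : ZMod 4) : Matrix (Fin 6) (Fin 6) ℤ :=
  Matrix.of fun i j =>
    if j = 0 then (if i = Fin.castSucc (Fin.succ r) then 1 else 0)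
    else if i = 5 then
      (if j = 1 then pairing r 0 else if j = 2 then pairing r 1 else if j = 3 then pairing r 2
        else if j = 4 then pairing r 3 else 0)
    else 0

/-- The matrix of the super derivative, which shifts the basis of `V` cyclically. -/
def shiftMat : Matrix (Fin 6) (Fin 6) ℤ :=
  !![0, 0, 0, 0, 0, 0; 0, 0, 0, 0, 1, 0; 0, 1, 0, 0, 0, 0; 0, 0, 1, 0, 0, 0; 0, 0, 0, 1, 0, 0;
    0, 0, 0, 0, 0, 0]

/-- The parity sign of the letter `r`. -/
def modSign (r : ZMod 4) : ℤ := if r = 0 ∨ r = 2 then -1 else 1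

/-- Letter r sends 1 to v_r and v_s to `pairing r s` times z, so this is the antisymmetry of the
pairing on odd letters and its symmetry otherwise. Products of three letters vanish. -/
theorem letterMat_swap (i j : ZMod 4) : letterMat i * letterMat j =
    (if modSign i = -1 ∧ modSign j = -1 then (-1 : ℤ) else 1) • (letterMat j * letterMat i) := by
  revert i j
  decide +kernel

/-- On V this is integration by parts for the pairing: `pairing (r+1) s` plus the sign of r times
`pairing r (s+1)` is zero. Indices modulo four are compatible with it because moving 𝒟⁴ = ∂_x²
across costs no sign. -/
theorem shiftMat_mul_letterMat (r : ZMod 4) : shiftMat * letterMat r =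
    letterMat (r + 1) + modSign r • (letterMat r * shiftMat) := by
  revert r
  decide +kernel

theorem modSign_natCast (k : ℕ) : modSign (k : ZMod 4) = (-1) ^ (k + 1) := by
  have h : ((k : ℕ) : ZMod 4) = ((k % 4 : ℕ) : ZMod 4) := by simp
  have h2 : (-1 : ℤ) ^ (k + 1) = (-1) ^ (k % 4 + 1) := by
    conv_lhs => rw [← Nat.div_add_mod k 4]
    rw [add_assoc, pow_add, pow_mul]
    norm_num
  rw [h, h2]
  have : k % 4 < 4 := Nat.mod_lt _ (by norm_num)
  interval_cases k % 4 <;> decide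

variable (K : Type*) [Field K] [CharZero K]

/-- Change of scalars for matrices. -/
def castMat : Matrix (Fin 6) (Fin 6) ℤ →+* Matrix (Fin 6) (Fin 6) K :=
  (Int.castRingHom K).mapMatrix

/-- The representation `𝒟^k φ ↦ letterMat (k mod 4)`. -/
def rep : FreeSDA K →ₐ[K] Matrix (Fin 6) (Fin 6) K :=
  lift K (fun k => castMat K (letterMat k)) fun i j => by
    rw [← map_mul, letterMat_swap, map_zsmul, map_mul]
    have h : (if modSign (i : ZMod 4) = -1 ∧ modSign (j : ZMod 4) = -1 then (-1 : ℤ) else 1) =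
        (-1) ^ ((i + 1) * (j + 1)) := by
      rw [modSign_natCast, modSign_natCast, pow_mul]
      rcases Nat.even_or_odd (i + 1) with h | h <;> rcases Nat.even_or_odd (j + 1) with h' | h' <;>
        simp [h.neg_one_pow, h'.neg_one_pow]
    rw [h]
    rcases Nat.even_or_odd ((i + 1) * (j + 1)) with h | h <;> simp [h.neg_one_pow]

theorem rep_jet (k : ℕ) : rep K (jet K k) = castMat K (letterMat k) := lift_jet K _ _ k

theorem castMat_apply (M : Matrix (Fin 6) (Fin 6) ℤ) (i j : Fin 6) :
    castMat K M i j = (M i j : K) := rfl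

/-- The representation turns 𝒟 into the supercommutator with the shift. -/
theorem shift_mul_rep (f : FreeSDA K) : castMat K shiftMat * rep K f =
    rep K (D K f) + rep K (parity K f) * castMat K shiftMat := by
  induction f using jet_induction with
  | h0 c =>
    rw [D_eq, der_algebraMap, map_zero, zero_add, AlgHom.commutes, AlgHom.commutes,
      AlgHom.commutes]
    exact (Algebra.commutes c (castMat K shiftMat)).symm
  | h1 k =>
    rw [D_eq, der_jet, parity_eq, par_jet, map_smul, rep_jet, rep_jet, ← map_mul,
      shiftMat_mul_letterMat, map_add, map_zsmul, map_mul, modSign_natCast, smul_mul_assoc]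
    push_cast
    congr 1
    rcases Nat.even_or_odd (k + 1) with h | h <;> simp [h.neg_one_pow]
  | hm a b ha hb =>
    rw [map_mul, ← mul_assoc, ha, D_mul, map_add, map_mul, map_mul, map_mul, map_mul, add_mul,
      mul_assoc, hb, mul_add, mul_assoc (rep K (parity K a)), add_assoc]
  | ha a b ha hb => simp only [map_add, mul_add, add_mul, ha, hb]; abel

/-- The zero pattern of the matrices in the image of `rep`. -/
structure HasPattern (M : Matrix (Fin 6) (Fin 6) K) : Prop where
  diag : ∀ i, M i i = M 0 0
  off : ∀ i j, i ≠ j → i ≠ 5 → j ≠ 0 → M i j = 0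

variable {K} in
theorem HasPattern.mul_apply_zero {M N : Matrix (Fin 6) (Fin 6) K} (hM : HasPattern K M)
    {i : Fin 6} (hi : i ≠ 5) (hi0 : i ≠ 0) : (M * N) i 0 = M i 0 * N 0 0 + M 0 0 * N i 0 := by
  rw [Matrix.mul_apply, ← Finset.sum_subset (Finset.subset_univ {0, i}), Finset.sum_pair hi0.symm,
    hM.diag i]
  intro j _ hj
  simp only [Finset.mem_insert, Finset.mem_singleton, not_or] at hj
  rw [hM.off i j (Ne.symm hj.2) hi hj.1, zero_mul]

variable {K} in
theorem HasPattern.mul_apply_zero_zero {M N : Matrix (Fin 6) (Fin 6) K} (hM : HasPattern K M) :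
    (M * N) 0 0 = M 0 0 * N 0 0 := by
  rw [Matrix.mul_apply, Finset.sum_eq_single 0]
  · intro j _ hj
    rw [hM.off 0 j hj.symm (by decide) hj, zero_mul]
  · simp

variable {K} in
theorem HasPattern.mul {M N : Matrix (Fin 6) (Fin 6) K} (hM : HasPattern K M)
    (hN : HasPattern K N) : HasPattern K (M * N) := by
  have key : ∀ i j, i ≠ j → i ≠ 5 → j ≠ 0 → (M * N) i j = 0 := by
    intro i j hij hi hj
    rw [Matrix.mul_apply]
    refine Finset.sum_eq_zero fun l _ => ?_
    by_cases h1 : i = l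
    · subst h1; rw [hN.off i j hij hi hj, mul_zero]
    · by_cases h2 : l = 0
      · subst h2; rw [hN.off 0 j hj.symm (by decide) hj, mul_zero]
      · rw [hM.off i l h1 hi h2, zero_mul]
  refine ⟨fun i => ?_, key⟩
  rw [hM.mul_apply_zero_zero, Matrix.mul_apply, Finset.sum_eq_single i, hM.diag, hN.diag]
  · intro l _ hl
    by_cases h0 : l = 0
    · subst h0
      rw [hN.off 0 i hl (by decide) hl.symm, mul_zero]
    · by_cases h5 : i = 5
      · subst h5
        rw [hN.off l 5 hl hl (by decide), mul_zero]
      · rw [hM.off i l hl.symm h5 h0, zero_mul]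
  · simp

theorem letterMat_diag : ∀ (r : ZMod 4) (i : Fin 6), letterMat r i i = letterMat r 0 0 := by
  decide +kernel

theorem letterMat_off (r : ZMod 4) {i j : Fin 6} (hi : i ≠ 5) (hj : j ≠ 0) :
    letterMat r i j = 0 := by
  simp [letterMat, hi, hj]

theorem hasPattern_rep (f : FreeSDA K) : HasPattern K (rep K f) := by
  induction f using jet_induction with
  | h0 c =>
    rw [AlgHom.commutes]
    refine ⟨fun i => ?_, fun i j hij _ _ => ?_⟩
    · simp [Matrix.algebraMap_matrix_apply]
    · simp [Matrix.algebraMap_matrix_apply, hij]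
  | h1 k =>
    rw [rep_jet]
    exact ⟨fun i => by simp only [castMat_apply, letterMat_diag k i],
      fun i j _ h2 h3 => by rw [castMat_apply, letterMat_off k h2 h3, Int.cast_zero]⟩
  | hm a b ha hb => rw [map_mul]; exact ha.mul hb
  | ha a b ha hb =>
    rw [map_add]
    exact ⟨fun i => by simp only [Matrix.add_apply, ha.diag i, hb.diag i],
      fun i j h1 h2 h3 => by rw [Matrix.add_apply, ha.off i j h1 h2 h3, hb.off i j h1 h2 h3, add_zero]⟩

/-- A matrix entry of the representation. -/
def entry (i : Fin 6) : FreeSDA K →ₗ[K] K where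
  toFun f := rep K f i 0
  map_add' f g := by simp
  map_smul' c f := by simp

/-- The constant term. -/
def aug : FreeSDA K →ₗ[K] K := entry K 0

/-- The sum of the coefficients of the linear terms `𝒟^k φ` with `k ≡ r` modulo four. -/
def lin (r : ZMod 4) : FreeSDA K →ₗ[K] K := entry K (Fin.castSucc (Fin.succ r))

/-- The quadratic functional that detects nontrivial integrals. -/
def quad : FreeSDA K →ₗ[K] K := entry K 5

theorem castSucc_succ_ne (r : ZMod 4) :
    Fin.castSucc (Fin.succ r) ≠ (0 : Fin 6) ∧ Fin.castSucc (Fin.succ r) ≠ (5 : Fin 6) := by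
  revert r; decide

theorem aug_mul (f g : FreeSDA K) : aug K (f * g) = aug K f * aug K g := by
  change rep K (f * g) 0 0 = _
  rw [map_mul, (hasPattern_rep K f).mul_apply_zero_zero]
  rfl

theorem lin_mul (r : ZMod 4) (f g : FreeSDA K) :
    lin K r (f * g) = lin K r f * aug K g + aug K f * lin K r g := by
  change rep K (f * g) _ 0 = _
  rw [map_mul, (hasPattern_rep K f).mul_apply_zero (castSucc_succ_ne r).2 (castSucc_succ_ne r).1]
  rfl

theorem aug_one : aug K 1 = 1 := by
  change rep K 1 0 0 = 1
  rw [map_one]; simp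

theorem aug_jet (k : ℕ) : aug K (jet K k) = 0 := by
  change rep K (jet K k) 0 0 = 0
  have h : ∀ r : ZMod 4, letterMat r 0 0 = 0 := by decide
  rw [rep_jet, castMat_apply, h, Int.cast_zero]

theorem lin_jet (r : ZMod 4) (k : ℕ) : lin K r (jet K k) = if (k : ZMod 4) = r then 1 else 0 := by
  change rep K (jet K k) _ 0 = _
  have h : ∀ r s : ZMod 4, letterMat s (Fin.castSucc (Fin.succ r)) 0 = if s = r then 1 else 0 := by
    decide
  rw [rep_jet, castMat_apply, h]
  split_ifs <;> simp

/-- The shift kills the vector 1, so 𝒟f acts on it as the shift applied to f·1. The zero rows 0 and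
5 of the shift then annihilate `aug` and `quad` of exact terms. -/
theorem entry_D (i : Fin 6) (f : FreeSDA K) :
    entry K i (D K f) = ∑ j, (shiftMat i j : K) * rep K f j 0 := by
  have h := congrFun (congrFun (shift_mul_rep K f) i) 0
  have h0 : ∀ j, shiftMat j 0 = 0 := by decide
  rw [Matrix.add_apply, Matrix.mul_apply, Matrix.mul_apply] at h
  simp only [castMat_apply, h0, Int.cast_zero, mul_zero, Finset.sum_const_zero, add_zero] at h
  exact h.symm

theorem aug_D (f : FreeSDA K) : aug K (D K f) = 0 := by
  have h : ∀ j, shiftMat 0 j = 0 := by decide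
  rw [aug, entry_D]
  simp [h]

theorem quad_D (f : FreeSDA K) : quad K (D K f) = 0 := by
  have h : ∀ j, shiftMat 5 j = 0 := by decide
  rw [quad, entry_D]
  simp [h]

theorem lin_D (r : ZMod 4) (f : FreeSDA K) : lin K (r + 1) (D K f) = lin K r f := by
  have h : ∀ (r : ZMod 4) j, shiftMat (Fin.castSucc (Fin.succ (n := 4) (r + 1 : ZMod 4))) j =
      if j = Fin.castSucc (Fin.succ r) then 1 else 0 := by decide
  rw [lin, entry_D, Finset.sum_eq_single (Fin.castSucc (Fin.succ r))]
  · rw [h, if_pos rfl, Int.cast_one, one_mul]; rfl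
  · intro j _ hj
    rw [h, if_neg hj, Int.cast_zero, zero_mul]
  · simp

theorem aug_parity (f : FreeSDA K) : aug K (parity K f) = aug K f := by
  induction f using jet_induction with
  | h0 c => rw [AlgHom.commutes]
  | h1 k => rw [parity_eq, par_jet, map_smul, aug_jet, smul_zero]
  | hm a b ha hb => rw [map_mul, aug_mul, aug_mul, ha, hb]
  | ha a b ha hb => simp only [map_add, ha, hb]

theorem aug_scaling (f : FreeSDA K) : aug K (scaling K f) = aug K f := by
  induction f using jet_induction with
  | h0 c => rw [AlgHom.commutes]
  | h1 k => rw [scaling_jet, map_smul, aug_jet, smul_zero]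
  | hm a b ha hb => rw [map_mul, aug_mul, aug_mul, ha, hb]
  | ha a b ha hb => simp only [map_add, ha, hb]

/-- The letter 0 pairs nontrivially only with the letter 2. -/
theorem quad_jet_zero_mul (f : FreeSDA K) : quad K (jet K 0 * f) = lin K 2 f := by
  change rep K (jet K 0 * f) 5 0 = rep K f _ 0
  have h : ∀ j, letterMat (0 : ZMod 4) 5 j = if j = Fin.castSucc (Fin.succ (2 : ZMod 4)) then 1 else 0 := by
    decide
  rw [map_mul, rep_jet, Matrix.mul_apply, Finset.sum_eq_single (Fin.castSucc (Fin.succ (2 : ZMod 4)))]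
  · rw [castMat_apply, Nat.cast_zero, h, if_pos rfl, Int.cast_one, one_mul]
  · intro j _ hj
    rw [castMat_apply, Nat.cast_zero, h, if_neg hj, Int.cast_zero, zero_mul]
  · simp

theorem quad_eq_zero_of_mem {f : FreeSDA K} (hf : f ∈ exactDensities K (jet K 0)) :
    quad K f = 0 := by
  obtain ⟨J, -, rfl⟩ := hf
  exact quad_D K J

/-- The matrix of a formal polynomial. -/
def polyMat (p : Poly) : Matrix (Fin 6) (Fin 6) ℤ :=
  (p.map fun t => t.2 • (t.1.map fun k : ℕ => letterMat k).prod).sum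

theorem rep_eval (p : Poly) : rep K (eval K (jet K 0) p) = castMat K (polyMat p) := by
  have hw : ∀ w : List ℕ, rep K (evalWord K (jet K 0) w) =
      castMat K (w.map fun k : ℕ => letterMat k).prod := by
    intro w
    induction w with
    | nil => simp
    | cons i w ih =>
      rw [evalWord_cons, map_mul, ih, List.map_cons, List.prod_cons, map_mul, evalLetter,
        iterate_D_jet_zero, rep_jet]
  induction p with
  | nil => simp [polyMat]
  | cons t p ih =>
    obtain ⟨w, c⟩ := t
    rw [eval_cons, map_add, map_zsmul, hw, ih, ← map_zsmul, ← map_add]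
    simp [polyMat]

variable {K} {Λ : SPDO K (FreeSDA K)}

theorem two_zpow_ne_one {z : ℤ} (hz : z ≠ 0) : (2 : K) ^ z ≠ 1 := by
  intro h
  have h1 : (((2 : ℚ) ^ z : ℚ) : K) = ((1 : ℚ) : K) := by push_cast; exact h
  have h2 : (2 : ℚ) ^ z = 2 ^ (0 : ℤ) := by rw [zpow_zero]; exact Rat.cast_injective h1
  exact hz (zpow_right_injective₀ (by norm_num) (by norm_num) h2)

/-- The coefficient has weight n - k, and a constant has weight zero. So modulo φ the operator Λ^n
is 𝒟^n. -/
theorem aug_coeff_pow (h : IsLaxRoot K (jet K 0) Λ) (n : ℕ) (k : ℤ) :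
    aug K (coeff (Λ ^ n) k) = if k = n then 1 else 0 := by
  split_ifs with hk
  · rw [hk, (h.ordLE_pow n).2, aug_one]
  · have h1 := congrArg (aug K) (scaling_coeff_pow h n k)
    rw [aug_scaling, map_smul, smul_eq_mul] at h1
    have h2 := two_zpow_ne_one (K := K) (z := n - k) (by omega)
    by_contra h0
    exact h2 (mul_right_cancel₀ h0 (by rw [one_mul, ← h1]))

theorem coeff_D_sq_mul (Q : SPDO K (FreeSDA K)) (k : ℤ) :
    coeff (Dn K (FreeSDA K) 2 * Q) k = D K (D K (coeff Q k)) + coeff Q (k - 2) := by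
  have e : Dn K (FreeSDA K) 2 * Q = Dn K (FreeSDA K) 1 * (Dn K (FreeSDA K) 1 * Q) := by
    rw [D_mul_Dn_mul]; rfl
  rw [e, coeff_D_mul, coeff_D_mul, coeff_D_mul, map_add, map_add, D_parity, parity_parity,
    show k - 1 - 1 = k - 2 by ring]
  abel

theorem lin_coeff_D_sq_mul (r : ZMod 4) (Q : SPDO K (FreeSDA K)) (k : ℤ) :
    lin K (r + 2) (coeff (Dn K (FreeSDA K) 2 * Q) k) =
      lin K r (coeff Q k) + lin K (r + 2) (coeff Q (k - 2)) := by
  rw [coeff_D_sq_mul, map_add, show r + 2 = r + 1 + 1 by ring, lin_D, lin_D]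

/-- The binomial expansion of ∂_x³, with residues alternating between r and r + 2 since 𝒟 shifts
them by one. -/
theorem lin_coeff_D_six_mul (r : ZMod 4) (Q : SPDO K (FreeSDA K)) (k : ℤ) :
    lin K (r + 2) (coeff (Dn K (FreeSDA K) 6 * Q) k) =
      lin K r (coeff Q k) + 3 * lin K (r + 2) (coeff Q (k - 2)) + 3 * lin K r (coeff Q (k - 4)) +
        lin K (r + 2) (coeff Q (k - 6)) := by
  have e : Dn K (FreeSDA K) 6 * Q =
      Dn K (FreeSDA K) 2 * (Dn K (FreeSDA K) 2 * (Dn K (FreeSDA K) 2 * Q)) := by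
    rw [← mul_assoc, Dn_mul_Dn, ← mul_assoc, Dn_mul_Dn]; rfl
  have h4 : ∀ f, lin K (r + 2 + 2) f = lin K r f := fun f => by
    rw [show r + 2 + 2 = r by revert r; decide]
  have h1 := lin_coeff_D_sq_mul r Q
  have h2 := lin_coeff_D_sq_mul (r + 2) Q
  have h3 := lin_coeff_D_sq_mul r (Dn K (FreeSDA K) 2 * Q)
  have h5 := lin_coeff_D_sq_mul (r + 2) (Dn K (FreeSDA K) 2 * Q)
  simp only [h4] at h2 h5
  rw [e, lin_coeff_D_sq_mul, h5, h3]
  simp only [h1, h2, sub_sub]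
  norm_num
  ring

end FreeSDA

end SSK

end

/-! ### The linear part of Λ^{2M} and nonvanishing of the functionals. -/

noncomputable section

namespace SSK

open SPDO Jet

attribute [local instance] SPDO.instRing

namespace FreeSDA

section Recursion

variable {K : Type*} [Field K] [CharZero K] {Λ : SPDO K (FreeSDA K)}

theorem aug_leib {x : FreeSDA K} (hx : aug K x = 0) (n : ℤ) (i : ℕ) : aug K (leib K n i x) = 0 := by
  rw [leib_apply, map_zsmul]
  rcases i with _ | i
  · rw [pow_zero, Module.End.one_apply]
    by_cases h : Even (n - ((0 : ℕ) : ℤ))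
    · rw [sg_of_even h, hx, smul_zero]
    · rw [sg_of_odd h, aug_parity, hx, smul_zero]
  · rw [pow_succ', Module.End.mul_apply, aug_D, smul_zero]

/-- Since `lin` is a derivation over `aug` and x has no constant term, only the constant part 𝒟^N of
Q matters. -/
theorem lin_coeff_mul_monomial {Q : SPDO K (FreeSDA K)} {N : ℤ}
    (hQ : ∀ k, aug K (coeff Q k) = if k = N then 1 else 0) {x : FreeSDA K} (hx : aug K x = 0)
    (r : ZMod 4) (m k : ℤ) :
    lin K r (coeff (Q * monomial K m x) k) =
      if k ≤ N + m then lin K r (leib K N (N + m - k).toNat x) else 0 := by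
  have h0 : ∀ l, aug K (coeff (monomial K m x) l) = 0 := fun l => by
    rw [coeff_monomial]
    split_ifs
    · exact hx
    · exact map_zero _
  have h1 := (lin K r).toAddMonoidHom.map_finsum (finite_support_coeff_mul Q (monomial K m x) k)
  rw [coeff_mul]
  refine h1.trans ?_
  have h2 : ∀ p : ℤ × ℕ, (lin K r).toAddMonoidHom (coeff Q p.1 *
      leib K p.1 p.2 (coeff (monomial K m x) (k + p.2 - p.1))) =
      if p.1 = N then lin K r (leib K N p.2 (coeff (monomial K m x) (k + p.2 - N))) else 0 := by
    intro p
    change lin K r (_ * _) = _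
    rw [lin_mul, aug_leib (h0 _), mul_zero, zero_add, hQ]
    split_ifs with h
    · rw [h, one_mul]
    · rw [zero_mul]
  rw [finsum_congr h2, finsum_eq_single _ (N, (N + m - k).toNat)]
  · rw [if_pos rfl, coeff_monomial]
    dsimp only
    split_ifs with h3 h4 h4
    · rfl
    · omega
    · omega
    · rw [map_zero, map_zero]
  · rintro ⟨n, i⟩ hp
    rw [coeff_monomial]
    dsimp only
    split_ifs with h3 h4
    · exact absurd (Prod.ext h3 (by dsimp only; omega)) hp
    · rw [map_zero, map_zero]
    · rfl

theorem lin_coeff_monomial_mul {x : FreeSDA K} (hx : aug K x = 0) (r : ZMod 4) (m k : ℤ)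
    (Q : SPDO K (FreeSDA K)) :
    lin K r (coeff (monomial K m x * Q) k) =
      lin K r x * aug K (coeff (Dn K (FreeSDA K) m * Q) k) := by
  rw [monomial_mul, coeff_monomial_zero_mul, lin_mul, hx, zero_mul, add_zero]

theorem leib_odd_of_even {N : ℤ} (hN : Even N) {i : ℕ} (hi : Odd i) (x : FreeSDA K) :
    leib K N i x = 0 := by
  rw [leib_apply, superChoose, if_pos ⟨hN, hi⟩, zero_smul]

theorem laxFactor_sq : laxFactor K (jet K 0) ^ 2 = Dn K (FreeSDA K) 6 + monomial K 2 (jet K 1) -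
    monomial K 1 (jet K 2) + monomial K 0 (jet K 3) := by
  have hm : ∀ x : FreeSDA K, monomial K 1 (-x) = -monomial K 1 x := fun x => by
    refine ext_coeff fun k => ?_
    rw [coeff_neg, coeff_monomial, coeff_monomial]
    split_ifs <;> simp
  rw [← evalOp_laxSqOp (isOdd_jet_zero K)]
  simp only [laxSqOp, evalOp_cons, evalOp_nil, eval_cons, evalWord_cons, evalWord_nil, eval_nil,
    mul_one, add_zero, one_smul, neg_smul, evalLetter, iterate_D_jet_zero, hm]
  rw [Dn]
  abel

/-- The linear part of the coefficient of `𝒟^{2j+1}` in `Λ^{2M}`. -/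
def linCoeff (Λ : SPDO K (FreeSDA K)) (M : ℕ) (j : ℤ) : K :=
  lin K ((2 * M - 2 * j : ℤ) : ZMod 4) (coeff (Λ ^ (2 * M)) (2 * j + 1))

/-- The linear part of L Λ^{2M} = Λ^{2M} L at order 2j + 1. The commutator with ∂_x³ gives the left
side, its leading terms cancelling. On the right only the term -(𝒟²φ)𝒟 of L survives, because even
powers of 𝒟 have no odd super binomials. -/
theorem linCoeff_recursion (h : IsLaxRoot K (jet K 0) Λ) (M : ℕ) (j : ℤ) :
    linCoeff Λ M j + 3 * linCoeff Λ M (j - 1) + 3 * linCoeff Λ M (j - 2) =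
      (if j = M then 1 else 0) - if j ≤ M then (M.choose (M - j).toNat : K) else 0 := by
  set Q := Λ ^ (2 * M) with hQ
  have hc : laxFactor K (jet K 0) ^ 2 * Q = Q * laxFactor K (jet K 0) ^ 2 := by
    rw [hQ, ← h.cube', ← pow_mul, ← pow_add, ← pow_add, add_comm]
  set r : ZMod 4 := ((2 * M - 2 * j : ℤ) : ZMod 4) with hr
  set k : ℤ := 2 * j + 1 with hk
  have haug : ∀ k, aug K (coeff Q k) = if k = ((2 * M : ℕ) : ℤ) then 1 else 0 := aug_coeff_pow h _
  have e := congrArg (fun P => lin K (r + 2) (coeff P k)) hc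
  have hN : Even (((2 * M : ℕ) : ℤ)) := by simp
  simp only [laxFactor_sq, add_mul, sub_mul, mul_add, mul_sub, coeff_add, coeff_sub, map_add,
    map_sub] at e
  rw [lin_coeff_D_six_mul, coeff_mul_Dn, lin_coeff_monomial_mul (aug_jet K 1),
    lin_coeff_monomial_mul (aug_jet K 2), lin_coeff_monomial_mul (aug_jet K 3),
    lin_coeff_mul_monomial haug (aug_jet K 1), lin_coeff_mul_monomial haug (aug_jet K 2),
    lin_coeff_mul_monomial haug (aug_jet K 3), coeff_D_sq_mul, coeff_D_mul, map_add, map_add,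
    aug_D, aug_D, aug_parity, haug, haug, zero_add, zero_add] at e
  have e0 : coeff (Dn K (FreeSDA K) 0 * Q) k = coeff Q k := congrArg (coeff · k) (one_mul Q)
  rw [e0, haug, if_neg (by omega : ¬ k - 2 = ((2 * M : ℕ) : ℤ)),
    if_neg (by omega : ¬ k = ((2 * M : ℕ) : ℤ)), mul_zero, mul_zero] at e
  have z1 : (if k ≤ ((2 * M : ℕ) : ℤ) + 2 then
      lin K (r + 2) (leib K ((2 * M : ℕ) : ℤ) (((2 * M : ℕ) : ℤ) + 2 - k).toNat (jet K 1)) else 0)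
      = 0 := by
    split_ifs with h1
    · rw [leib_odd_of_even hN ⟨(M - j).toNat, by omega⟩, map_zero]
    · rfl
  have z3 : (if k ≤ ((2 * M : ℕ) : ℤ) + 0 then
      lin K (r + 2) (leib K ((2 * M : ℕ) : ℤ) (((2 * M : ℕ) : ℤ) + 0 - k).toNat (jet K 3)) else 0)
      = 0 := by
    split_ifs with h1
    · rw [leib_odd_of_even hN ⟨(M - j - 1).toNat, by omega⟩, map_zero]
    · rfl
  have z2 : (if k ≤ ((2 * M : ℕ) : ℤ) + 1 then
      lin K (r + 2) (leib K ((2 * M : ℕ) : ℤ) (((2 * M : ℕ) : ℤ) + 1 - k).toNat (jet K 2)) else 0)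
      = if j ≤ M then (M.choose (M - j).toNat : K) else 0 := by
    by_cases h1 : j ≤ M
    · obtain ⟨l, hl⟩ := Int.eq_ofNat_of_zero_le (show 0 ≤ (M : ℤ) - j by omega)
      have hl2 : (((2 * M : ℕ) : ℤ) + 1 - k).toNat = 2 * l := by omega
      have hrl : r + 2 = ((2 + 2 * l : ℕ) : ZMod 4) := by
        rw [hr, show (2 * M - 2 * j : ℤ) = ((2 * l : ℕ) : ℤ) by push_cast; omega]
        push_cast; ring
      have hs : superChoose ((2 * M : ℕ) : ℤ) (2 * l) = M.choose l := by
        rw [superChoose_eq_superBinom, superBinom, if_neg (by omega)]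
        have a1 : (((2 * M : ℕ) : ℤ) / 2) = Int.ofNat M := by simp
        have a2 : 2 * l / 2 = l := by omega
        rw [a1, a2, binom]
      have hj : (D K ^ (2 * l) : Module.End K (FreeSDA K)) (jet K 2) = jet K (2 + 2 * l) := by
        rw [Module.End.coe_pow, ← iterate_D_jet_zero K 2, ← Function.iterate_add_apply, add_comm,
          iterate_D_jet_zero]
      rw [if_pos (by omega), if_pos h1, hl2, hl, leib_apply, hs, sg_of_even (by
        push_cast; exact ⟨(M : ℤ) - l, by ring⟩), hj, map_zsmul, lin_jet, if_pos hrl.symm]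
      simp
    · rw [if_neg (by omega), if_neg h1]
  have z4 : lin K (r + 2) (jet K 2) * (if k - 1 = ((2 * M : ℕ) : ℤ) then (1 : K) else 0) =
      if j = M then 1 else 0 := by
    by_cases h1 : j = M
    · have hr0 : r = 0 := by rw [hr, h1, sub_self, Int.cast_zero]
      rw [if_pos (by omega), if_pos h1, hr0, lin_jet, if_pos (by decide), mul_one]
    · rw [if_neg (by omega), if_neg h1, mul_zero]
  rw [z1, z2, z3, z4] at e
  have d0 : linCoeff Λ M j = lin K r (coeff Q k) := rfl
  have d1 : linCoeff Λ M (j - 1) = lin K (r + 2) (coeff Q (k - 2)) := by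
    rw [linCoeff, hr, hk, ← hQ]
    congr 2
    · push_cast; ring
    · ring
  have d2 : linCoeff Λ M (j - 2) = lin K r (coeff Q (k - 4)) := by
    rw [linCoeff, hr, hk, ← hQ]
    have h4 : (4 : ZMod 4) = 0 := by decide
    congr 2
    · push_cast
      linear_combination h4
    · ring
  rw [d0, d1, d2]
  linear_combination e

theorem linCoeff_eq_zero (h : IsLaxRoot K (jet K 0) Λ) (M : ℕ) {j : ℤ} (hj : M ≤ j) :
    linCoeff Λ M j = 0 := by
  rw [linCoeff, (h.ordLE_pow (2 * M)).1 _ (by push_cast; omega), map_zero]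

/-- The companion matrix of `3 q² + 3 q + 1`. -/
def companion (K : Type*) [Field K] : Matrix (Fin 2) (Fin 2) K := !![-1, 1; -(1 / 3), 0]

theorem companion_sq : (companion K) ^ 2 = -companion K - algebraMap K _ (1 / 3) := by
  rw [companion, pow_two, Matrix.mul_fin_two]
  ext i j
  fin_cases i <;> fin_cases j <;>
    simp [Matrix.algebraMap_matrix_apply]
  norm_num

theorem companion_pow_add (j : ℕ) : 3 * (companion K ^ (j + 2)) 0 1 +
    3 * (companion K ^ (j + 1)) 0 1 + (companion K ^ j) 0 1 = 0 := by
  rw [pow_add, companion_sq, pow_succ, mul_sub, ← Algebra.commutes, ← Algebra.smul_def]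
  simp only [Matrix.sub_apply, mul_neg, Matrix.neg_apply, Matrix.smul_apply, smul_eq_mul]
  ring

/-- The eigenvalues are 3^{-1/2} e^{±5πi/6}, and adding 1 turns them into 3^{-1/2} e^{±πi/6}.
Working with the matrix avoids adjoining them to K. -/
theorem companion_pow_six : companion K ^ 6 = algebraMap K _ (-(1 / 27)) := by
  rw [show 6 = 2 * 3 by norm_num, pow_mul, companion_sq, companion, pow_three]
  ext i j
  fin_cases i <;> fin_cases j <;>
    simp [Matrix.mul_apply, Fin.sum_univ_two, Matrix.algebraMap_matrix_apply] <;> norm_num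

theorem companion_add_one_pow_six : (companion K + 1) ^ 6 = algebraMap K _ (-(1 / 27)) := by
  have h : (companion K + 1) ^ 2 = companion K + algebraMap K _ (2 / 3) := by
    rw [(Commute.one_right _).add_sq, companion_sq, one_pow, mul_one, two_mul,
      ← (algebraMap K (Matrix (Fin 2) (Fin 2) K)).map_one]
    have : (algebraMap K (Matrix (Fin 2) (Fin 2) K)) (2 / 3) =
        algebraMap K _ 1 - algebraMap K _ (1 / 3) := by
      rw [← map_sub]; norm_num
    rw [this]
    abel
  rw [show 6 = 2 * 3 by norm_num, pow_mul, h, companion, pow_three]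
  ext i j
  fin_cases i <;> fin_cases j <;>
    simp [Matrix.mul_apply, Fin.sum_univ_two, Matrix.algebraMap_matrix_apply] <;> norm_num

/-- Summation by parts: the weights satisfy the adjoint recursion, so only boundary terms remain.
The (0,1) entries start with 0, 1, which removes a_{-2} and isolates a_{-1}, where a_j = `linCoeff Λ
M j`. -/
theorem sum_companion (Λ : SPDO K (FreeSDA K)) (M J : ℕ) :
    ∑ j ∈ Finset.range J, (companion K ^ j) 0 1 * (linCoeff Λ M j + 3 * linCoeff Λ M (j - 1) +
      3 * linCoeff Λ M (j - 2)) = 3 * linCoeff Λ M (-1) -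
      3 * ((companion K ^ J) 0 1 + (companion K ^ (J + 1)) 0 1) * linCoeff Λ M (J - 1) -
      3 * (companion K ^ J) 0 1 * linCoeff Λ M (J - 2) := by
  induction J with
  | zero => simp [companion]
  | succ J ih =>
    rw [Finset.sum_range_succ, ih]
    have e1 : (((J + 1 : ℕ) : ℤ) - 1) = J := by push_cast; ring
    have e2 : (((J + 1 : ℕ) : ℤ) - 2) = J - 1 := by push_cast; ring
    rw [e1, e2]
    linear_combination (linCoeff Λ M J) * companion_pow_add (K := K) J

theorem linCoeff_neg_one (h : IsLaxRoot K (jet K 0) Λ) (M : ℕ) :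
    3 * linCoeff Λ M (-1) = (companion K ^ M) 0 1 - ((companion K + 1) ^ M : Matrix (Fin 2) (Fin 2) K) 0 1 := by
  -- With M + 2 summands both upper boundary terms have index at least M, where `linCoeff` vanishes.
  have h1 := sum_companion Λ M (M + 2)
  rw [linCoeff_eq_zero h M (j := ((M + 2 : ℕ) : ℤ) - 1) (by push_cast; omega),
    linCoeff_eq_zero h M (j := ((M + 2 : ℕ) : ℤ) - 2) (by push_cast; omega), mul_zero, mul_zero, sub_zero, sub_zero] at h1
  rw [← h1, (Commute.one_right (companion K)).add_pow, Matrix.sum_apply]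
  simp only [linCoeff_recursion h, mul_sub, Finset.sum_sub_distrib]
  congr 1
  · rw [Finset.sum_eq_single M]
    · simp
    · intro j _ hj
      rw [if_neg (by exact_mod_cast hj), mul_zero]
    · simp
  · rw [Finset.sum_range_succ, if_neg (by push_cast; omega), mul_zero, add_zero]
    refine Finset.sum_congr rfl fun j hj => ?_
    rw [Finset.mem_range] at hj
    have e : ((M : ℤ) - j).toNat = M - j := by omega
    rw [if_pos (by omega), e, Nat.choose_symm (by omega), one_pow, mul_one, mul_comm,
      ← nsmul_eq_mul, ← nsmul_eq_mul', Matrix.smul_apply]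

/-- With C the companion matrix, C⁶ = (C+1)⁶ = -1/27 reduces to exponent 2, where C² - (C+1)² = -2C
- 1 has (0,1) entry -2. -/
theorem linCoeff_neg_one_ne_zero (h : IsLaxRoot K (jet K 0) Λ) (k : ℕ) :
    linCoeff Λ (6 * k + 2) (-1) ≠ 0 := by
  have h1 := linCoeff_neg_one h (6 * k + 2)
  rw [pow_add, pow_mul, companion_pow_six, pow_add, pow_mul, companion_add_one_pow_six, ← map_pow,
    ← Algebra.smul_def, ← Algebra.smul_def, Matrix.smul_apply, Matrix.smul_apply] at h1
  have h2 : (companion K ^ 2) 0 1 - ((companion K + 1) ^ 2 : Matrix (Fin 2) (Fin 2) K) 0 1 = -2 := by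
    rw [(Commute.one_right _).add_sq]
    simp [companion, two_mul]
    norm_num
  intro h0
  rw [h0, mul_zero, ← smul_sub, h2, smul_eq_mul] at h1
  have h3 : (-(1 / 27) : K) ^ k ≠ 0 := pow_ne_zero _ (by norm_num)
  exact mul_ne_zero h3 (by norm_num) h1.symm

/-- The functionals with `n ≡ 7` modulo twelve do not vanish. -/
theorem superIntegral_ne_zero (h : IsLaxRoot K (jet K 0) Λ) (k : ℕ) :
    superIntegral K (jet K 0) (sres (Λ ^ (2 * (6 * k + 2) + 3))) ≠ 0 := by
  intro h0
  -- T is the derivation with Tφ = φ. It commutes with 𝒟, so it preserves exactness.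
  obtain ⟨T, h1, h2, h3, h4⟩ := exists_evolution K (isOdd_jet_zero K)
  have h5 := h.superIntegral_derivation (isOdd_jet_zero K) (diffPoly_eq_top K) h1 h2 h3
    (even_two_mul (6 * k + 2))
  obtain ⟨J, -, hJ⟩ := superIntegral_eq_zero_iff.mp h0
  have h6 : superIntegral K (jet K 0) (T (sres (Λ ^ (2 * (6 * k + 2) + 3)))) = 0 := by
    rw [superIntegral_eq_zero_iff, ← hJ, h3]
    refine ⟨T J, ?_, rfl⟩
    change T J ∈ diffPoly K (jet K 0)
    rw [diffPoly_eq_top]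
    exact Algebra.mem_top
  rw [h6, smul_zero, h4, ← map_nsmul, eq_comm, superIntegral_eq_zero_iff] at h5
  have h7 := quad_eq_zero_of_mem K h5
  rw [map_nsmul, quad_jet_zero_mul, nsmul_eq_mul] at h7
  refine linCoeff_neg_one_ne_zero h k ?_
  rcases mul_eq_zero.mp h7 with h8 | h8
  · exact absurd h8 (Nat.cast_ne_zero.mpr (by omega))
  -- For M = 6k + 2 and j = -1 the residue 2M - 2j = 12k + 6 is 2 modulo four, the one read by
  -- `quad`.
  · rw [← h8, linCoeff]
    congr 2
    have h12 : (4 : ZMod 4) = 0 := by decide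
    push_cast
    linear_combination (3 * (k : ZMod 4) + 1) * h12

/-- 11 is not 7 modulo twelve, so `quad` is evaluated on the explicit density: -18 + 9 - 18 - 6 =
-33, with the linear and cubic terms contributing nothing. -/
theorem superIntegral_eleven_ne_zero (h : IsLaxRoot K (jet K 0) Λ) :
    superIntegral K (jet K 0) (sres (Λ ^ 11)) ≠ 0 := by
  intro h0
  have h1 := quad_eq_zero_of_mem K (superIntegral_eq_zero_iff.mp h0)
  have h2 := coeff_mul_of_checkMul (isOdd_jet_zero K) (K := K) check_density11 (k := -1) (by omega)
    (by norm_num)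
  rw [sres, show 11 = 2 + 3 * 3 from rfl, h.pow_add_three_mul,
    ← evalOp_laxCubeOp (isOdd_jet_zero K), coeff_mul_congr (N := 9)
      (h.ordLE_sq_sub_rootSqTrunc (isOdd_jet_zero K)) (ordLE_evalOp (by decide)) (by norm_num),
    rootSqTrunc, SPDO.smul_mul, coeff_smul, h2, one_smul, ← eval_opCoeff, map_smul] at h1
  have h3 : quad K (eval K (jet K 0) (opCoeff (-1) densityOp11)) = -33 := by
    change rep K _ 5 0 = _
    rw [rep_eval, castMat_apply,
      show polyMat (opCoeff (-1) densityOp11) 5 0 = -33 by decide +kernel]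
    norm_num
  rw [h3] at h1
  norm_num at h1

end Recursion

end FreeSDA

end SSK

end

/-! ### Assembly of the statement. -/

noncomputable section

namespace SSK

open SPDO

attribute [local instance] SPDO.instRing

section

variable {K A : Type*} [Field K] [CharZero K] [Ring A] [Algebra K A] [SuperDifferentialAlgebra K A]
  {φ : A} {Λ : SPDO K A}

theorem IsLaxRoot.sq_pow_three (h : IsLaxRoot K φ Λ) : (Λ ^ 2) ^ 3 = laxOperator K φ := by
  rw [← pow_mul, h.pow_six]

end

namespace FreeSDA

variable {K : Type*} [Field K] [CharZero K] {Λ : SPDO K (FreeSDA K)}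

theorem superIntegral_ne_zero_iff (h : IsLaxRoot K (jet K 0) Λ) {n : ℕ} (hn : n ≤ 11) :
    superIntegral K (jet K 0) (sres (Λ ^ n)) ≠ 0 ↔ n = 7 ∨ n = 11 := by
  constructor
  · intro h0
    -- Even n give exact residues, multiples of 3 give differential operators, and n = 1, 5 have
    -- zero residue; 7 and 11 remain.
    have hodd : ¬ Even n := fun he =>
      h0 (superIntegral_eq_zero_iff.mpr (h.sres_mem_of_even (isOdd_jet_zero K) he))
    have hz : sres (Λ ^ n) ≠ 0 := fun hz => h0 (by rw [hz, map_zero])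
    have h1 : n ≠ 1 := by rintro rfl; exact hz (h.sres_one (isOdd_jet_zero K))
    have h3 : n ≠ 3 := by rintro rfl; exact hz (h.sres_three_mul 1)
    have h5 : n ≠ 5 := by rintro rfl; exact hz (h.sres_five (isOdd_jet_zero K))
    have h9 : n ≠ 9 := by rintro rfl; exact hz (h.sres_three_mul 3)
    rw [Nat.not_even_iff] at hodd
    omega
  · rintro (rfl | rfl)
    · exact superIntegral_ne_zero h 0
    · exact superIntegral_eleven_ne_zero h

theorem infinite_superIntegral_ne_zero (h : IsLaxRoot K (jet K 0) Λ) :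
    {n : ℕ | superIntegral K (jet K 0) (sres (Λ ^ n)) ≠ 0}.Infinite :=
  Set.infinite_of_injective_forall_mem (f := fun k : ℕ => 2 * (6 * k + 2) + 3)
    (fun a b hab => by simp only at hab; omega) (superIntegral_ne_zero h)

end FreeSDA

end SSK

end

theorem mainTheorem3 (K : Type*) [Field K] [CharZero K] :
    (∀ (A : Type*) [Ring A] [Algebra K A] [SuperDifferentialAlgebra K A] (φ : A), IsOdd K φ →
      ∃ Λ : SPDO K A,
        IsLaxRoot K φ Λ ∧ (∀ Λ' : SPDO K A, IsLaxRoot K φ Λ' → Λ' = Λ) ∧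
        Λ ^ 6 = laxOperator K φ ∧
        ((Λ ^ 2) ^ 3 = laxOperator K φ ∧ ∀ M : SPDO K A,
          IsMonicOfOrder 2 M → M ^ 3 = laxOperator K φ → M = Λ ^ 2) ∧
        (∀ (n : ℕ) (k : ℤ), SPDO.coeff (Λ ^ n) k ∈ diffPoly K φ) ∧
        (∀ n : ℕ, IsFermionicFunctional K φ (superIntegral K φ (SPDO.sres (Λ ^ n)))) ∧
        (∀ T : A →ₗ[K] A, IsSSKFlow K φ T → ∀ n : ℕ,
          SPDO.mapCoeff T (Λ ^ n) =
            SPDO.superCommutator ((9 : K) • SPDO.diffPart (Λ ^ 10)) (Λ ^ n) ∧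
          superIntegral K φ (T (SPDO.sres (Λ ^ n))) = 0) ∧
        superIntegral K φ (SPDO.sres (Λ ^ 7)) = superIntegral K φ (density7 K φ) ∧
        superIntegral K φ (SPDO.sres (Λ ^ 11)) = superIntegral K φ (density11 K φ)) ∧
    (∃! T : FreeSDA K →ₗ[K] FreeSDA K, IsSSKFlow K (FreeSDA.jet K 0) T) ∧
    (∀ Λ : SPDO K (FreeSDA K), IsLaxRoot K (FreeSDA.jet K 0) Λ →
      (∀ n ≤ 11, superIntegral K (FreeSDA.jet K 0) (SPDO.sres (Λ ^ n)) ≠ 0 ↔ n = 7 ∨ n = 11) ∧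
      {n : ℕ | superIntegral K (FreeSDA.jet K 0) (SPDO.sres (Λ ^ n)) ≠ 0}.Infinite ∧
      LinearIndependent K
        fun n : {n : ℕ // superIntegral K (FreeSDA.jet K 0) (SPDO.sres (Λ ^ n)) ≠ 0} =>
          superIntegral K (FreeSDA.jet K 0) (SPDO.sres (Λ ^ (n : ℕ)))) := by
  refine ⟨fun A _ _ _ φ hφ => ?_, FreeSDA.existsUnique_sskFlow K, fun Λ h =>
    ⟨fun n hn => FreeSDA.superIntegral_ne_zero_iff h hn,
      FreeSDA.infinite_superIntegral_ne_zero h, FreeSDA.linearIndependent_superIntegral h⟩⟩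
  obtain ⟨Λ, h, -⟩ := exists_isLaxRoot hφ
  exact ⟨Λ, h, fun Λ' h' => h.unique h', h.pow_six,
    ⟨h.sq_pow_three, fun M hM h3 => h.cube_root_unique hM h3⟩, fun n k => h.coeffIn_pow hφ n k,
    fun n => h.isFermionic hφ n, fun T hT n => h.flow hφ hT n,
    congrArg _ (h.sres_seven hφ), congrArg _ (h.sres_eleven hφ)⟩
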